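/- **Setting.** $H$ is a complex Hilbert space and $L(H)$ its algebra of bounded operators. $Q\in N_\kappa(H)$ means: $Q:D(Q)\to L(H)$ is meromorphic in $\mathbb C\setminus\mathbb R$ (it is holomorphic on the open set $D(Q)$, which contains all of $\mathbb C\setminus\mathbb R$ except a discrete set of points that are at worst poles), $Q(\bar z)^*=Q(z)$ for $z\in D(Q)$, and the kernel $N_Q(z,w)=\frac{Q(z)-Q(w)^*}{z-\bar w}$, $z,w\in D(Q)\cap\mathbb C^+$, has $\kappa$ negative squares: every Hermitian matrix $\big((N_Q(z_i,z_j)h_i,h_j)\big)_{i,j=1}^n$ with $z_i\in D(Q)\cap\mathbb C^+$, $h_i\in H$, has at most $\kappa$ negative eigenvalues, and some such matrix has exactly $\kappa$. A triplet $(K,A,\Gamma)$ consists of a Pontryagin space $(K,[\cdot,\cdot])$, a self-adjoint linear relation $A$ in $K$ and a bounded operator $\Gamma:H\to K$; $\Gamma^+:K\to H$ is defined by $(h,\Gamma^+k)=[\Gamma h,k]$. It represents $Q$ with reference point $z_0\in\mathbb C^+\cap D(Q)$ if $D(Q)\subseteq\rho(A)$ and $$Q(z)=Q(z_0)^*+(z-\bar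 z_0)\,\Gamma^+\big(I+(z-z_0)(A-z)^{-1}\big)\Gamma,\qquad z\in D(Q),\tag{1}$$ and the representation is minimal if $K$ is the closed linear span of $\{(I+(z-z_0)(A-z)^{-1})\Gamma h: z\in\rho(A),\,h\in H\}$. The reference point $z_0$ is fixed throughout. Subspaces $K_1,K_2$ of $K$ with $K=K_1[+]K_2$ (direct orthogonal sum) are called invariant with respect to $A$ if for $i=1,2$ every $x\in K_i\cap\operatorname{dom}A$ has some $y\in K_i$ with $\{x,y\}\in A$, and $\operatorname{dom}A=(K_1\cap\operatorname{dom}A)+(K_2\cap\operatorname{dom}A)$. **Theorem 1.** (i) Let $Q\in N_\kappa(H)$ have the minimal representation (1) by $(K,A,\Gamma)$, and let $K=K_1[+]K_2$ with nondegenerate subspaces $K_1,K_2$ that are invariant with respect to $A$. Put $A_i:=A\cap(K_i\times K_i)$ and $\Gamma_i:=E_i\Gamma$, where $E_i$ is the orthogonal projection onto $K_i$. Then there are $\kappa_1,\kappa_2\ge 0$ and functions $Q_1,Q_2$ such that (a) $Q_i\in N_{\kappa_i}(H)$, and $Q_i$ is minimally represented by $(K_i,A_i,\Gamma_i)$, where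 $K_i$ is a Pontryagin space of index $\kappa_i$ $(i=1,2)$; (b) $Q=Q_1+Q_2$ with $D(Q)=D(Q_1)\cap D(Q_2)$; (c) $\kappa_1+\kappa_2=\kappa$. (ii) Conversely, let $Q_i\in N_{\kappa_i}(H)$ be minimally represented by triplets $(K_i,A_i,\Gamma_i)$, $i=1,2$, let $Q=Q_1+Q_2$ on $D(Q)=D(Q_1)\cap D(Q_2)$, and suppose that (d) the operator $\Gamma_1^++\Gamma_2^+:K_1[+]K_2\to H$, $k_1[+]k_2\mapsto\Gamma_1^+k_1+\Gamma_2^+k_2$, is injective. Then the triplet consisting of $K_1[+]K_2$ (a Pontryagin space of index $\kappa_1+\kappa_2$), the relation $\{\{k_1[+]k_2,h_1[+]h_2\}:\{k_i,h_i\}\in A_i\}$ and the operator $h\mapsto\Gamma_1h[+]\Gamma_2h$ minimally represents $Q$. This minimal representation is unique up to isomorphism: for every triplet $(K',A',\Gamma')$ minimally representing $Q$ there is a linear homeomorphism of $K_1[+]K_2$ onto $K'$ that preserves the indefinite scalar products and carries the relation and the operator of the direct sum to $A'$ and $\Gamma'$. Moreover $Q\in N_{\kappa_1+\kappa_2}(H)$.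 -/

import Mathlib

open scoped ComplexConjugate

noncomputable section

namespace GenNevanlinna

/-! ## Operator functions and the classes `N_κ(H)` -/

section Functions

variable {H : Type*} [NormedAddCommGroup H] [InnerProductSpace ℂ H] [CompleteSpace H]

/-- A partial function `Q : D(Q) → L(H)` of a complex variable, `D(Q) = dom`.
The values of `val` outside `dom` are never used. -/
structure OpFun (H : Type*) [NormedAddCommGroup H] [InnerProductSpace ℂ H] where
  dom : Set ℂ
  val : ℂ → (H →L[ℂ] H)

/-- `Q = Q₁ + Q₂` as partial functions. -/
def OpFun.IsSum (Q Q₁ Q₂ : OpFun H) : Prop :=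
  Q.dom = Q₁.dom ∩ Q₂.dom ∧ ∀ z ∈ Q.dom, Q.val z = Q₁.val z + Q₂.val z

/-- The Nevanlinna kernel `N_Q(z, w) = (Q(z) - Q(w)^*) / (z - conj w)`. -/
def OpFun.kernel (Q : OpFun H) (z w : ℂ) : H →L[ℂ] H :=
  (z - conj w)⁻¹ • (Q.val z - ContinuousLinearMap.adjoint (Q.val w))

/-- The matrix `((N_Q(z_i, z_j) h_i, h_j))_{i,j}`, where `(·,·)` is linear in the first entry
(Mathlib's `inner` is linear in the second one). -/
def OpFun.kernelMatrix (Q : OpFun H) {n : ℕ} (z : Fin n → ℂ) (h : Fin n → H) :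
    Matrix (Fin n) (Fin n) ℂ :=
  Matrix.of fun i j => inner ℂ (h j) (Q.kernel (z i) (z j) (h i))

theorem OpFun.adjoint_kernel (Q : OpFun H) (z w : ℂ) :
    ContinuousLinearMap.adjoint (Q.kernel z w) = Q.kernel w z := by
  have hc : conj ((z - conj w)⁻¹) = -((w - conj z)⁻¹) := by
    rw [map_inv₀, map_sub, Complex.conj_conj, ← inv_neg, neg_sub]
  unfold OpFun.kernel
  rw [map_smulₛₗ, map_sub, ContinuousLinearMap.adjoint_adjoint, hc, neg_smul, ← smul_neg, neg_sub]

theorem OpFun.kernelMatrix_isHermitian (Q : OpFun H) {n : ℕ} (z : Fin n → ℂ) (h : Fin n → H) :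
    (Q.kernelMatrix z h).IsHermitian := by
  ext i j
  simp only [OpFun.kernelMatrix, Matrix.conjTranspose_apply, Matrix.of_apply]
  rw [← Q.adjoint_kernel (z j) (z i), ContinuousLinearMap.adjoint_inner_right]
  exact inner_conj_symm _ _

/-- The number (with multiplicity) of negative eigenvalues of the Hermitian matrix
`((N_Q(z_i, z_j) h_i, h_j))_{i,j}`. -/
def OpFun.negCount (Q : OpFun H) {n : ℕ} (z : Fin n → ℂ) (h : Fin n → H) : ℕ :=
  Set.ncard {i : Fin n | (Q.kernelMatrix_isHermitian z h).eigenvalues i < 0}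

/-- `Q ∈ N_κ(H)`: generalized Nevanlinna functions of index `κ`. -/
structure OpFun.IsGenNevanlinna (Q : OpFun H) (κ : ℕ) : Prop where
  /-- `D(Q)` is open and `Q` is holomorphic on it. -/
  isOpen_dom : IsOpen Q.dom
  differentiableOn : DifferentiableOn ℂ Q.val Q.dom
  /-- `Q` is meromorphic in `ℂ \ ℝ`: there `D(Q)` leaves out only a discrete and relatively
  closed set, whose points are at worst poles of `Q`. -/
  codiscrete_dom : Q.dom ∈ Filter.codiscreteWithin {z : ℂ | z.im ≠ 0}
  meromorphicOn : MeromorphicOn Q.val {z : ℂ | z.im ≠ 0}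
  /-- `Q(conj z)^* = Q(z)` for `z ∈ D(Q)`. -/
  symm : ∀ z ∈ Q.dom, conj z ∈ Q.dom ∧ ContinuousLinearMap.adjoint (Q.val (conj z)) = Q.val z
  /-- The kernel has `κ` negative squares on `D(Q) ∩ ℂ⁺`. -/
  negCount_le : ∀ (n : ℕ) (z : Fin n → ℂ) (h : Fin n → H),
    (∀ i, z i ∈ Q.dom ∧ 0 < (z i).im) → Q.negCount z h ≤ κ
  exists_negCount_eq : ∃ (n : ℕ) (z : Fin n → ℂ) (h : Fin n → H),
    (∀ i, z i ∈ Q.dom ∧ 0 < (z i).im) ∧ Q.negCount z h = κ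

end Functions

/-! ## Pontryagin spaces -/

section Pontryagin

variable {K : Type*} [NormedAddCommGroup K] [NormedSpace ℂ K]

/-- Continuous sesquilinear forms `[·,·]` (conjugate-linear in the first entry, as Mathlib's
`inner`). -/
abbrev SesqForm (K : Type*) [NormedAddCommGroup K] [NormedSpace ℂ K] := K →L⋆[ℂ] K →L[ℂ] ℂ

/-- `(K, B)` is a Pontryagin space of (negative) index `κ`: the form `B` is Hermitian and there is a
fundamental decomposition `K = P [+] N` for which `(P, B)` and `(N, -B)` are Hilbert spaces and
`dim N = κ`. Only the topology of the norm of `K` matters; the two estimates, continuity of `B` and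
completeness say that it is the Hilbert space topology given by the decomposition. -/
structure IsPontryagin (B : SesqForm K) (κ : ℕ) : Prop where
  complete : CompleteSpace K
  hermitian : ∀ x y : K, conj (B x y) = B y x
  decomposition : ∃ P N : Submodule ℂ K, IsCompl P N ∧ (∀ x ∈ P, ∀ y ∈ N, B x y = 0) ∧
    (∃ c : ℝ, 0 < c ∧ (∀ x ∈ P, c * ‖x‖ ^ 2 ≤ (B x x).re) ∧
      (∀ x ∈ N, c * ‖x‖ ^ 2 ≤ -(B x x).re)) ∧
    FiniteDimensional ℂ N ∧ Module.finrank ℂ N = κ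

/-- The restriction of a form to a subspace. -/
def SesqForm.restrict (B : SesqForm K) (L : Submodule ℂ K) : SesqForm L :=
  ContinuousLinearMap.bilinearComp B L.subtypeL L.subtypeL

/-- The form of the direct orthogonal sum `K₁ [+] K₂`. -/
def SesqForm.prod {K₁ K₂ : Type*} [NormedAddCommGroup K₁] [NormedSpace ℂ K₁]
    [NormedAddCommGroup K₂] [NormedSpace ℂ K₂] (B₁ : SesqForm K₁) (B₂ : SesqForm K₂) :
    SesqForm (K₁ × K₂) :=
  ContinuousLinearMap.bilinearComp B₁ (ContinuousLinearMap.fst ℂ K₁ K₂)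
      (ContinuousLinearMap.fst ℂ K₁ K₂) +
    ContinuousLinearMap.bilinearComp B₂ (ContinuousLinearMap.snd ℂ K₁ K₂)
      (ContinuousLinearMap.snd ℂ K₁ K₂)

/-- The subspace `L` is nondegenerate for `B`: no nonzero vector of `L` is orthogonal to `L`. -/
def IsNondegenerate (B : SesqForm K) (L : Submodule ℂ K) : Prop :=
  ∀ x ∈ L, (∀ y ∈ L, B x y = 0) → x = 0

/-- `K = K₁ [+] K₂`: direct and orthogonal sum of subspaces. -/
def IsOrthSum (B : SesqForm K) (K₁ K₂ : Submodule ℂ K) : Prop :=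
  IsCompl K₁ K₂ ∧ ∀ x ∈ K₁, ∀ y ∈ K₂, B x y = 0

/-- The operator `Γ⁺ : K → H` with `(h, Γ⁺ k) = [Γ h, k]` (see `inner_plus`). -/
def plus {H : Type*} [NormedAddCommGroup H] [InnerProductSpace ℂ H] [CompleteSpace H]
    (B : SesqForm K) (Γ : H →L[ℂ] K) : K →L[ℂ] H where
  toFun k := (InnerProductSpace.toDual ℂ H).symm ((B k).comp Γ)
  map_add' x y := by
    rw [map_add, ContinuousLinearMap.add_comp, map_add]
  map_smul' c x := by
    rw [map_smulₛₗ, ContinuousLinearMap.smul_comp, map_smulₛₗ, Complex.conj_conj, RingHom.id_apply]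
  cont := (InnerProductSpace.toDual ℂ H).symm.continuous.comp
    (((ContinuousLinearMap.compL ℂ H K ℂ).flip Γ).continuous.comp B.continuous)

theorem inner_plus {H : Type*} [NormedAddCommGroup H] [InnerProductSpace ℂ H] [CompleteSpace H]
    {B : SesqForm K} (hB : ∀ x y : K, conj (B x y) = B y x) (Γ : H →L[ℂ] K) (h : H) (k : K) :
    inner ℂ h (plus B Γ k) = B (Γ h) k := by
  rw [← inner_conj_symm, ← hB]
  congr 1
  exact InnerProductSpace.toDual_symm_apply

end Pontryagin

/-! ## Linear relations -/

section Relations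

variable {K : Type*} [NormedAddCommGroup K] [NormedSpace ℂ K]

/-- Linear relations in `K` (multivalued operators, identified with their graphs). -/
abbrev LinRel (K : Type*) [NormedAddCommGroup K] [NormedSpace ℂ K] := Submodule ℂ (K × K)

/-- The domain of a linear relation. -/
def LinRel.dom (A : LinRel K) : Submodule ℂ K := Submodule.map (LinearMap.fst ℂ K K) A

/-- `A` equals its adjoint `{(x, y) : [v, x] = [u, y] for all (u, v) ∈ A}`. -/
def LinRel.IsSelfAdj (B : SesqForm K) (A : LinRel K) : Prop :=
  ∀ x y : K, (x, y) ∈ A ↔ ∀ u v : K, (u, v) ∈ A → B v x = B u y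

/-- The relation `(A - z)⁻¹` is the graph of the bounded operator `R` on `K`. -/
def LinRel.IsResolvent (A : LinRel K) (z : ℂ) (R : K →L[ℂ] K) : Prop :=
  ∀ x y : K, (y, x + z • y) ∈ A ↔ y = R x

/-- The part `A ∩ (L × L)` of `A` in the subspace `L`, as a relation in `L`. -/
def LinRel.part (A : LinRel K) (L : Submodule ℂ K) : LinRel L :=
  Submodule.comap (LinearMap.prodMap L.subtype L.subtype) A

/-- The direct sum `{(k₁ + k₂, h₁ + h₂) : (k_i, h_i) ∈ A_i}`. -/
def LinRel.prod {K₁ K₂ : Type*} [NormedAddCommGroup K₁] [NormedSpace ℂ K₁]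
    [NormedAddCommGroup K₂] [NormedSpace ℂ K₂] (A₁ : LinRel K₁) (A₂ : LinRel K₂) :
    LinRel (K₁ × K₂) :=
  Submodule.comap (LinearMap.prodMap (LinearMap.fst ℂ K₁ K₂) (LinearMap.fst ℂ K₁ K₂)) A₁ ⊓
    Submodule.comap (LinearMap.prodMap (LinearMap.snd ℂ K₁ K₂) (LinearMap.snd ℂ K₁ K₂)) A₂

/-- `L` is invariant with respect to `A`: each `x ∈ L ∩ dom A` has an image under `A` in `L`.
(For an operator `A`: `A (L ∩ dom A) ⊆ L`.) -/
def LinRel.IsInvariant (A : LinRel K) (L : Submodule ℂ K) : Prop :=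
  ∀ x ∈ L, x ∈ A.dom → ∃ y ∈ L, (x, y) ∈ A

/-- The domain of `A` is split by `K₁` and `K₂`:
`dom A = (dom A ∩ K₁) + (dom A ∩ K₂)`; automatic if `dom A` is the whole space. -/
def LinRel.SplitsDom (A : LinRel K) (K₁ K₂ : Submodule ℂ K) : Prop :=
  A.dom = (A.dom ⊓ K₁) ⊔ (A.dom ⊓ K₂)

end Relations

/-! ## Operator representations -/

section Representations

variable {H : Type*} [NormedAddCommGroup H] [InnerProductSpace ℂ H] [CompleteSpace H]
variable {K : Type*} [NormedAddCommGroup K] [NormedSpace ℂ K]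

/-- The triplet `(K, A, Γ)`, with `(K, B)` a Pontryagin space of index `κ'`, represents `Q` with the
point of reference `z₀ ∈ ℂ⁺`: for every `z ∈ D(Q)` one has `z ∈ ρ(A)` and
`Q(z) = Q(z₀)^* + (z - conj z₀) Γ⁺ (I + (z - z₀) (A - z)⁻¹) Γ`. -/
structure IsRepresentation (κ' : ℕ) (B : SesqForm K) (A : LinRel K) (Γ : H →L[ℂ] K) (z₀ : ℂ)
    (Q : OpFun H) : Prop where
  pontryagin : IsPontryagin B κ'
  selfAdj : A.IsSelfAdj B
  im_pos : 0 < z₀.im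
  mem_dom : z₀ ∈ Q.dom
  eq : ∀ z ∈ Q.dom, ∃ R : K →L[ℂ] K, A.IsResolvent z R ∧
    Q.val z = ContinuousLinearMap.adjoint (Q.val z₀) +
      (z - conj z₀) • (plus B Γ ∘L (ContinuousLinearMap.id ℂ K + (z - z₀) • R) ∘L Γ)

/-- A representation is minimal if `K` is the closed linear span of the vectors
`(I + (z - z₀) (A - z)⁻¹) Γ h`, `z ∈ ρ(A)`, `h ∈ H`. -/
structure IsMinimalRepresentation (κ' : ℕ) (B : SesqForm K) (A : LinRel K) (Γ : H →L[ℂ] K)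
    (z₀ : ℂ) (Q : OpFun H) : Prop extends IsRepresentation κ' B A Γ z₀ Q where
  minimal : (Submodule.span ℂ {x : K | ∃ (z : ℂ) (R : K →L[ℂ] K) (h : H), A.IsResolvent z R ∧
    x = (ContinuousLinearMap.id ℂ K + (z - z₀) • R) (Γ h)}).topologicalClosure = ⊤

/-- Isomorphism of triplets: a linear homeomorphism `U : K → K'` preserving the forms, with
`A' = U A U⁻¹` and `Γ' = U Γ`. -/
def TripletIso {K' : Type*} [NormedAddCommGroup K'] [NormedSpace ℂ K']
    (B : SesqForm K) (A : LinRel K) (Γ : H →L[ℂ] K)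
    (B' : SesqForm K') (A' : LinRel K') (Γ' : H →L[ℂ] K') : Prop :=
  ∃ U : K ≃L[ℂ] K', (∀ x y, B' (U x) (U y) = B x y) ∧
    (∀ x y, (U x, U y) ∈ A' ↔ (x, y) ∈ A) ∧ ∀ h, Γ' h = U (Γ h)

end Representations

end GenNevanlinna

end

open scoped ComplexConjugate

noncomputable section

open Filter Topology

/-! Everything is read off from the resolvent `R₀ = (A - z₀)⁻¹`. With `pencil` for I - (z - z₀)R₀
and `transfer` for its inverse I + (z - z₀)(A - z)⁻¹, self-adjointness of A becomes one quadratic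
identity for `R₀`. It turns the kernel of Q into a Gram kernel: (N_Q(z, w)h, g) = [transfer(z)Γh,
transfer(w)Γg] (`form_transfer`, `inner_reprVal_sub_adjoint`).

Hence Q has at most as many negative squares as the index of K. Equality requires a maximal negative
subspace inside the span of the vectors from the upper half-plane, whereas minimality speaks of all
resolvent points. The gap is closed by Cayley transforms: they are isometric, preserve the closed
span of the upper vectors, and take transfer(conj w)Γh to transfer(w)Γh. Finitely many of them move
a negative tuple where it is needed (`IsModel.exists_isometry`). Meromorphy of the resolvent off the
real axis comes from factoring it, up to scalars and a fixed invertible operator, into an analytic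
invertible operator and a finite-rank perturbation of the identity (`meromorphicAt_inverse_sub`).
Together these give `IsModel.isGenNevanlinna`: a minimal triplet of index κ always produces a
function in N_κ(H).

For (i), nondegeneracy makes each summand the orthogonal complement of the other, hence closed, so
the projections are bounded. Invariance and the splitting of the domain make them commute with A,
the multivalued part being controlled by self-adjointness (`IsOrthSum.exists_reduces`). Each
projection therefore carries the whole minimal model to its summand. The free constant Q(z₀)^* is
divided so that each half keeps the symmetry, and indices add by counting negative vectors.

For (ii), the direct sum represents Q by direct verification. Injectivity of Γ⁺ makes the range of Γ
dense, by Hahn-Banach and the Riesz theorem for Pontryagin spaces, and the range of Γ is already the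
z = z₀ part of the minimality span. Uniqueness holds because Q determines the Gram matrix of dense
families, and in Pontryagin spaces an isometry between dense subspaces that carries one such family
to the other is bicontinuous (`norm_linearCombination_le`). -/

namespace GenNevanlinna

/-! ### Negative eigenvalues of a Hermitian matrix and negative definite subspaces. -/

section Inertia

variable {n : Type*} [Fintype n] [DecidableEq n] {M : Matrix n n ℂ}

theorem re_quadForm_eigenvectorUnitary (hM : M.IsHermitian) (a : n → ℂ) :
    (star ((hM.eigenvectorUnitary : Matrix n n ℂ).mulVec a) ⬝ᵥ
      M.mulVec ((hM.eigenvectorUnitary : Matrix n n ℂ).mulVec a)).re =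
      ∑ i, hM.eigenvalues i * ‖a i‖ ^ 2 := by
  set U : Matrix n n ℂ := (hM.eigenvectorUnitary : Matrix n n ℂ) with hU
  have hUU : star U * U = 1 := Unitary.coe_star_mul_self hM.eigenvectorUnitary
  have h1 : M.mulVec (U.mulVec a) = U.mulVec ((Matrix.diagonal
      ((RCLike.ofReal : ℝ → ℂ) ∘ hM.eigenvalues)).mulVec a) := by
    conv_lhs => rw [hM.spectral_theorem, Unitary.conjStarAlgAut_apply]
    rw [← hU, Matrix.mulVec_mulVec, Matrix.mulVec_mulVec, mul_assoc, hUU, mul_one]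
  rw [h1, Matrix.star_mulVec, ← Matrix.dotProduct_mulVec, Matrix.mulVec_mulVec,
    ← Matrix.star_eq_conjTranspose, hUU, Matrix.one_mulVec]
  simp only [dotProduct, Matrix.mulVec_diagonal, Complex.re_sum, Pi.star_apply, Function.comp]
  refine Finset.sum_congr rfl fun i _ => ?_
  have : star (a i) * (((hM.eigenvalues i : ℝ) : ℂ) * a i) =
      ((hM.eigenvalues i * ‖a i‖ ^ 2 : ℝ) : ℂ) := by
    rw [Complex.ofReal_mul, Complex.ofReal_pow, ← Complex.conj_mul' (a i)]
    simp only [Complex.star_def]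
    ring
  exact (congrArg Complex.re this).trans (Complex.ofReal_re _)

/-- One half of Sylvester's law: the eigenvectors with negative eigenvalue span a negative definite
subspace. The other half is `le_card_neg`. -/
theorem exists_linearMap_neg (hM : M.IsHermitian) :
    ∃ T : ({i // hM.eigenvalues i < 0} → ℂ) →ₗ[ℂ] (n → ℂ),
      ∀ a, a ≠ 0 → (star (T a) ⬝ᵥ M.mulVec (T a)).re < 0 := by
  classical
  let E : ({i // hM.eigenvalues i < 0} → ℂ) →ₗ[ℂ] (n → ℂ) :=
    { toFun := fun a i => if h : hM.eigenvalues i < 0 then a ⟨i, h⟩ else 0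
      map_add' := fun a b => by
        ext i; by_cases h : hM.eigenvalues i < 0 <;> simp [h]
      map_smul' := fun c a => by
        ext i; by_cases h : hM.eigenvalues i < 0 <;> simp [h] }
  refine ⟨(Matrix.mulVecLin (hM.eigenvectorUnitary : Matrix n n ℂ)).comp E, fun a ha => ?_⟩
  simp only [LinearMap.comp_apply, Matrix.mulVecLin_apply]
  rw [re_quadForm_eigenvectorUnitary]
  obtain ⟨i, hi⟩ := Function.ne_iff.mp ha
  refine Finset.sum_neg' (fun j _ => ?_) ⟨i.1, Finset.mem_univ _, ?_⟩
  · by_cases h : hM.eigenvalues j < 0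
    · exact mul_nonpos_of_nonpos_of_nonneg h.le (by positivity)
    · have : E a j = 0 := by simp [E, h]
      simp [this]
  · have : E a i.1 = a i := by simp [E, i.2]
    rw [this]
    exact mul_neg_of_neg_of_pos i.2 (by have := norm_pos_iff.mpr hi; positivity)

/-- A vector whose coordinates along the negative eigenvectors all vanish has nonnegative form. On a
negative definite subspace these coordinates are therefore injective. -/
theorem le_card_neg (hM : M.IsHermitian) {k : ℕ} (T : (Fin k → ℂ) →ₗ[ℂ] (n → ℂ))
    (hT : ∀ a, a ≠ 0 → (star (T a) ⬝ᵥ M.mulVec (T a)).re < 0) :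
    k ≤ Fintype.card {i // hM.eigenvalues i < 0} := by
  set U : Matrix n n ℂ := (hM.eigenvectorUnitary : Matrix n n ℂ) with hU
  have hUU : U * star U = 1 := Unitary.coe_mul_star_self hM.eigenvectorUnitary
  let L : (Fin k → ℂ) →ₗ[ℂ] ({i // hM.eigenvalues i < 0} → ℂ) :=
    (LinearMap.funLeft ℂ ℂ (Subtype.val)).comp ((Matrix.mulVecLin (star U)).comp T)
  have hL : Function.Injective L := by
    rw [injective_iff_map_eq_zero]
    intro a ha
    by_contra h0
    have h1 := hT a h0
    have h2 : T a = U.mulVec ((star U).mulVec (T a)) := by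
      rw [Matrix.mulVec_mulVec, hUU, Matrix.one_mulVec]
    rw [h2, re_quadForm_eigenvectorUnitary] at h1
    refine absurd h1 (not_lt.mpr (Finset.sum_nonneg fun i _ => ?_))
    by_cases h : hM.eigenvalues i < 0
    · have h3 : (star U).mulVec (T a) i = 0 := congrFun ha ⟨i, h⟩
      rw [h3]; simp
    · exact mul_nonneg (not_lt.mp h) (by positivity)
  simpa using LinearMap.finrank_le_finrank_of_injective hL

end Inertia

/-! ### Geometry of Pontryagin spaces: negative tuples, frames, Riesz theorem. -/

section Geometry

variable {K : Type*} [NormedAddCommGroup K] [NormedSpace ℂ K]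

/-- The vectors `v` span a subspace of dimension `k` on which `B` is negative definite. -/
def IsNegTuple (B : SesqForm K) {k : ℕ} (v : Fin k → K) : Prop :=
  ∀ c : Fin k → ℂ, c ≠ 0 → (B (∑ i, c i • v i) (∑ i, c i • v i)).re < 0

/-- The form `B` induces an operator `K → K*` that is bounded below. -/
def IsBddBelow (B : SesqForm K) : Prop := ∃ c : ℝ, 0 < c ∧ ∀ x, c * ‖x‖ ≤ ‖B x‖

/-- A negative tuple with its coordinate functionals, for which `B` is uniformly positive on the
orthogonal complement. -/
structure IsFrame (B : SesqForm K) {k : ℕ} (v : Fin k → K) (π : Fin k → K →L[ℂ] ℂ) : Prop where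
  neg : IsNegTuple B v
  orth : ∀ i x, B (v i) (x - ∑ j, π j x • v j) = 0
  pos : ∃ c : ℝ, 0 < c ∧ ∀ x, (∀ i, B (v i) x = 0) → c * ‖x‖ ^ 2 ≤ (B x x).re

variable {B : SesqForm K}

theorem form_smul_left (B : SesqForm K) (c : ℂ) (x y : K) : B (c • x) y = conj c * B x y := by
  rw [map_smulₛₗ, _root_.smul_apply, smul_eq_mul]

theorem form_smul_right (B : SesqForm K) (c : ℂ) (x y : K) : B x (c • y) = c * B x y := by
  rw [map_smul, smul_eq_mul]

theorem form_sum_left (B : SesqForm K) {ι : Type*} (s : Finset ι) (c : ι → ℂ) (v : ι → K) (x : K) :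
    B (∑ i ∈ s, c i • v i) x = ∑ i ∈ s, conj (c i) * B (v i) x := by
  rw [map_sum, _root_.sum_apply]
  exact Finset.sum_congr rfl fun i _ => form_smul_left B _ _ _

theorem re_form_add (hB : ∀ x y, conj (B x y) = B y x) (x y : K) :
    (B (x + y) (x + y)).re = (B x x).re + 2 * (B x y).re + (B y y).re := by
  have : (B y x).re = (B x y).re := by rw [← hB x y, Complex.conj_re]
  simp only [map_add, _root_.add_apply, Complex.add_re, this]
  ring

theorem form_eq_zero_symm (hB : ∀ x y, conj (B x y) = B y x) {x y : K} (h : B x y = 0) :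
    B y x = 0 := by
  rw [← hB x y, h, map_zero]

theorem norm_form_symm (hB : ∀ x y, conj (B x y) = B y x) (x y : K) : ‖B y x‖ = ‖B x y‖ := by
  rw [← hB x y, Complex.norm_conj]

theorem re_form_smul (c : ℂ) (x : K) : (B (c • x) (c • x)).re = ‖c‖ ^ 2 * (B x x).re := by
  have : B (c • x) (c • x) = ((‖c‖ ^ 2 : ℝ) : ℂ) * B x x := by
    rw [form_smul_left, form_smul_right,
      Complex.ofReal_pow, ← Complex.conj_mul']
    ring
  rw [this, Complex.re_ofReal_mul]

theorem norm_form_le (B : SesqForm K) (x y : K) : ‖B x y‖ ≤ ‖B‖ * ‖x‖ * ‖y‖ :=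
  B.le_opNorm₂ x y

theorem IsNegTuple.eq_zero {k : ℕ} {v : Fin k → K} (hv : IsNegTuple B v) {c : Fin k → ℂ}
    (h : ∀ j, B (v j) (∑ i, c i • v i) = 0) : c = 0 := by
  by_contra h0
  have h1 := hv c h0
  have h2 : B (∑ i, c i • v i) (∑ i, c i • v i) = 0 := by
    rw [form_sum_left]
    exact Finset.sum_eq_zero fun i _ => by rw [h, mul_zero]
  rw [h2] at h1
  exact lt_irrefl _ h1

/-- Definiteness makes the Gram matrix of `v` invertible; its inverse applied to the functionals `B
(v i)` gives the coordinates of the orthogonal projection onto the span. -/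
theorem IsNegTuple.exists_coord {k : ℕ} {v : Fin k → K} (hv : IsNegTuple B v) :
    ∃ π : Fin k → K →L[ℂ] ℂ, ∀ i x, B (v i) (x - ∑ j, π j x • v j) = 0 := by
  let G : Matrix (Fin k) (Fin k) ℂ := Matrix.of fun i j => B (v i) (v j)
  have hG : IsUnit G := by
    rw [← Matrix.mulVec_injective_iff_isUnit]
    intro a b hab
    have h0 : a - b = 0 := by
      refine hv.eq_zero fun j => ?_
      have : (G.mulVec (a - b)) j = 0 := by
        rw [Matrix.mulVec_sub, hab, sub_self]; rfl
      rw [← this]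
      simp [G, Matrix.mulVec, dotProduct, mul_comm]
    exact sub_eq_zero.mp h0
  have hdet := (Matrix.isUnit_iff_isUnit_det G).mp hG
  refine ⟨fun j => ∑ i, G⁻¹ j i • B (v i), fun i x => ?_⟩
  have h1 : (G * G⁻¹).mulVec (fun i => B (v i) x) i = B (v i) x := by
    rw [Matrix.mul_nonsing_inv _ hdet, Matrix.one_mulVec]
  rw [← Matrix.mulVec_mulVec] at h1
  rw [map_sub, sub_eq_zero, ← h1, map_sum]
  simp only [Matrix.mulVec, dotProduct, map_smul, smul_eq_mul, G, Matrix.of_apply,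
    _root_.sum_apply, _root_.smul_apply]
  exact Finset.sum_congr rfl fun j _ => by ring

theorem IsNegTuple.comp_isometry {K' : Type*} [NormedAddCommGroup K'] [NormedSpace ℂ K']
    {B' : SesqForm K'} {k : ℕ} {v : Fin k → K} (hv : IsNegTuple B v) {w : Fin k → K'}
    (h : ∀ i j, B' (w i) (w j) = B (v i) (v j)) : IsNegTuple B' w := by
  intro c hc
  have := hv c hc
  simpa only [map_sum, _root_.sum_apply, map_smulₛₗ, _root_.smul_apply,
    h] using this

/-- The form attains a positive minimum on the compact unit sphere of ℂ^k; homogeneity does the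
rest. -/
theorem IsNegTuple.exists_bound {k : ℕ} {v : Fin k → K} (hv : IsNegTuple B v) :
    ∃ c : ℝ, 0 < c ∧ ∀ a : Fin k → ℂ,
      c * ‖a‖ ^ 2 ≤ -(B (∑ i, a i • v i) (∑ i, a i • v i)).re ∧
      c * ‖∑ i, a i • v i‖ ^ 2 ≤ -(B (∑ i, a i • v i) (∑ i, a i • v i)).re := by
  let T : (Fin k → ℂ) →L[ℂ] K := LinearMap.toContinuousLinearMap
    (Fintype.linearCombination ℂ v)
  have hT : ∀ a, T a = ∑ i, a i • v i := fun a => Fintype.linearCombination_apply ℂ v a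
  obtain ⟨m, hm, hle⟩ := (isCompact_sphere (0 : Fin k → ℂ) 1).exists_forall_le'
    (f := fun a => -(B (T a) (T a)).re) (a := 0)
    (by
      have h1 : Continuous fun a => B (T a) (T a) :=
        (B.continuous.comp T.continuous).clm_apply T.continuous
      exact (Complex.continuous_re.comp h1).neg.continuousOn)
    (fun a ha => by
      have : a ≠ 0 := by rintro rfl; simp at ha
      have := hv a this
      rw [← hT] at this
      linarith)
  have key : ∀ a, m * ‖a‖ ^ 2 ≤ -(B (T a) (T a)).re := by
    intro a
    by_cases ha : a = 0
    · simp [ha]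
    have hn : ‖a‖ ≠ 0 := norm_ne_zero_iff.mpr ha
    have h1 := hle (((‖a‖⁻¹ : ℝ) : ℂ) • a) (by
      rw [mem_sphere_zero_iff_norm, norm_smul]
      simp [hn])
    rw [map_smul] at h1
    rw [re_form_smul, Complex.norm_real, norm_inv, norm_norm, ← mul_neg] at h1
    calc m * ‖a‖ ^ 2 ≤ (‖a‖⁻¹ ^ 2 * -(B (T a) (T a)).re) * ‖a‖ ^ 2 := by gcongr
      _ = _ := by field_simp
  -- One constant serves both estimates: dividing by ‖T‖² + 1 ≥ 1 pays for ‖T a‖ ≤ ‖T‖‖a‖ and only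
  -- weakens the bound in ‖a‖.
  refine ⟨m / (‖T‖ ^ 2 + 1), by positivity, fun a => ?_⟩
  rw [← hT]
  refine ⟨?_, ?_⟩
  · refine le_trans ?_ (key a)
    gcongr
    exact div_le_self hm.le (by nlinarith [sq_nonneg ‖T‖])
  have h2 : ‖T a‖ ^ 2 ≤ (‖T‖ ^ 2 + 1) * ‖a‖ ^ 2 := by
    have := T.le_opNorm a
    calc ‖T a‖ ^ 2 ≤ (‖T‖ * ‖a‖) ^ 2 := by gcongr
      _ ≤ _ := by nlinarith [sq_nonneg ‖a‖]
  calc m / (‖T‖ ^ 2 + 1) * ‖T a‖ ^ 2 ≤ m / (‖T‖ ^ 2 + 1) * ((‖T‖ ^ 2 + 1) * ‖a‖ ^ 2) := by gcongr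
    _ = m * ‖a‖ ^ 2 := by field_simp
    _ ≤ _ := key a

/-- Being a negative tuple is an open condition. -/
theorem IsNegTuple.eventually {k : ℕ} {v : Fin k → K} (hv : IsNegTuple B v) :
    ∀ᶠ w in 𝓝 v, IsNegTuple B w := by
  have hc : Continuous fun p : (Fin k → K) × (Fin k → ℂ) =>
      (B (∑ i, p.2 i • p.1 i) (∑ i, p.2 i • p.1 i)).re := by
    have h1 : Continuous fun p : (Fin k → K) × (Fin k → ℂ) => ∑ i, p.2 i • p.1 i := by fun_prop
    exact Complex.continuous_re.comp ((B.continuous.comp h1).clm_apply h1)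
  -- Compactness of the sphere makes the neighbourhood of `v` uniform in the coefficients; other
  -- coefficients are rescaled to the sphere.
  have := (isCompact_sphere (0 : Fin k → ℂ) 1).eventually_forall_of_forall_eventually (x₀ := v)
    (P := fun w c => (B (∑ i, c i • w i) (∑ i, c i • w i)).re < 0) (fun c hc' => by
      have hc0 : c ≠ 0 := by rintro rfl; simp at hc'
      exact hc.continuousAt.eventually_lt continuousAt_const (hv c hc0))
  filter_upwards [this] with w hw c hc0
  have hn : ‖c‖ ≠ 0 := norm_ne_zero_iff.mpr hc0
  have h1 := hw (((‖c‖⁻¹ : ℝ) : ℂ) • c) (by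
    rw [mem_sphere_zero_iff_norm, norm_smul]
    simp [hn])
  simp only [Pi.smul_apply, smul_assoc] at h1
  rw [← Finset.smul_sum, re_form_smul] at h1
  by_contra h2
  exact absurd h1 (not_lt.mpr (mul_nonneg (by positivity) (not_lt.mp h2)))

theorem IsNegTuple.exists_mem_of_mem_closure {k : ℕ} {v : Fin k → K} (hv : IsNegTuple B v)
    {S : Set K} (h : ∀ i, v i ∈ closure S) : ∃ w : Fin k → K, IsNegTuple B w ∧ ∀ i, w i ∈ S := by
  have h1 : v ∈ closure (Set.univ.pi fun _ : Fin k => S) := by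
    rw [closure_pi_set]
    exact fun i _ => h i
  obtain ⟨w, hw1, hw2⟩ := mem_closure_iff_nhds.mp h1 _ hv.eventually
  exact ⟨w, hw1, fun i => hw2 i trivial⟩

/-- Cauchy–Schwarz for a form that is nonnegative on a subspace. -/
theorem norm_form_sq_le (hB : ∀ x y, conj (B x y) = B y x) {P : Submodule ℂ K}
    (hP : ∀ x ∈ P, 0 ≤ (B x x).re) {x y : K} (hx : x ∈ P) (hy : y ∈ P) :
    ‖B x y‖ ^ 2 ≤ (B x x).re * (B y y).re := by
  let c : PreInnerProductSpace.Core ℂ P :=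
    { inner := fun x y => B x y
      conj_inner_symm := fun x y => hB y x
      re_inner_nonneg := fun x => hP x x.2
      add_left := fun x y z => by simp
      smul_left := fun x y r => by simp }
  have := @InnerProductSpace.Core.inner_mul_inner_self_le ℂ P _ _ _ c ⟨x, hx⟩ ⟨y, hy⟩
  change ‖B x y‖ * ‖B y x‖ ≤ (B x x).re * (B y y).re at this
  rwa [norm_form_symm hB x y, ← sq] at this

/-- A maximal negative tuple of a form that is bounded below is part of a frame. -/
theorem IsNegTuple.exists_isFrame (hB : ∀ x y, conj (B x y) = B y x) (hb : IsBddBelow B) {k : ℕ}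
    {v : Fin k → K} (hv : IsNegTuple B v) (hmax : ∀ w : Fin (k + 1) → K, ¬ IsNegTuple B w) :
    ∃ π, IsFrame B v π := by
  obtain ⟨π, hπ⟩ := hv.exists_coord
  refine ⟨π, hv, hπ, ?_⟩
  let P : Submodule ℂ K := ⨅ i, (B (v i) : K →ₗ[ℂ] ℂ).ker
  have hPmem : ∀ x, x ∈ P ↔ ∀ i, B (v i) x = 0 := fun x => by simp [P]
  have hspan : ∀ (a : Fin k → ℂ) x, (∀ i, B (v i) x = 0) → B (∑ i, a i • v i) x = 0 := by
    intro a x hx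
    rw [form_sum_left]
    exact Finset.sum_eq_zero fun i _ => by rw [hx, mul_zero]
  -- A negative vector orthogonal to `v` would lengthen the tuple, against maximality.
  have hpos : ∀ x ∈ P, 0 ≤ (B x x).re := by
    intro x hx
    rw [hPmem] at hx
    by_contra hneg
    push Not at hneg
    refine hmax (Fin.cons x v) fun c hc => ?_
    rw [Fin.sum_univ_succ]
    simp only [Fin.cons_zero, Fin.cons_succ]
    have h0 : B (∑ i : Fin k, c i.succ • v i) (c 0 • x) = 0 := by
      rw [map_smul, hspan _ x hx, smul_zero]
    rw [re_form_add hB, form_eq_zero_symm hB h0, re_form_smul, Complex.zero_re]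
    by_cases hc0 : (fun i : Fin k => c i.succ) = 0
    · have h1 : c 0 ≠ 0 := by
        intro h1
        apply hc
        ext i
        refine Fin.cases h1 (fun j => congrFun hc0 j) i
      have h2 : ∑ i : Fin k, c i.succ • v i = 0 :=
        Finset.sum_eq_zero fun i _ => by rw [show c i.succ = 0 from congrFun hc0 i, zero_smul]
      rw [h2]
      have : 0 < ‖c 0‖ := norm_pos_iff.mpr h1
      simp only [map_zero, Complex.zero_re]
      have : ‖c 0‖ ^ 2 * (B x x).re < 0 := mul_neg_of_pos_of_neg (by positivity) hneg
      linarith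
    · have h1 := hv _ hc0
      have : ‖c 0‖ ^ 2 * (B x x).re ≤ 0 := mul_nonpos_of_nonneg_of_nonpos (by positivity) hneg.le
      linarith
  let E : K →L[ℂ] K := ContinuousLinearMap.id ℂ K - ∑ j, (π j).smulRight (v j)
  have hE : ∀ x, E x = x - ∑ j, π j x • v j := fun x => by
    simp [E]
  obtain ⟨c, hc, hcb⟩ := hb
  set b : ℝ := ‖B‖ * ‖E‖ ^ 2 with hbdef
  have hb0 : 0 ≤ b := by positivity
  refine ⟨c ^ 2 / (b + 1), by positivity, fun x hx => ?_⟩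
  have hxP := (hPmem x).mpr hx
  -- For x in P, `B x` only sees the component `E y` in P, where Cauchy-Schwarz applies. Combined
  -- with c‖x‖ ≤ ‖B x‖ this yields coercivity on P.
  have hBx : ‖B x‖ ≤ Real.sqrt ((B x x).re * b) := by
    refine ContinuousLinearMap.opNorm_le_bound _ (Real.sqrt_nonneg _) fun y => ?_
    have h1 : B x y = B x (E y) := by
      rw [hE, map_sub, form_eq_zero_symm hB (hspan (fun j => π j y) x hx), sub_zero]
    have hEy : E y ∈ P := (hPmem _).mpr fun i => by rw [hE]; exact hπ i y
    have h2 := norm_form_sq_le hB hpos hxP hEy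
    have h3 : (B (E y) (E y)).re ≤ b * ‖y‖ ^ 2 := by
      refine (Complex.re_le_norm _).trans ((norm_form_le B _ _).trans ?_)
      have := E.le_opNorm y
      calc ‖B‖ * ‖E y‖ * ‖E y‖ ≤ ‖B‖ * (‖E‖ * ‖y‖) * (‖E‖ * ‖y‖) := by gcongr
        _ = _ := by rw [hbdef]; ring
    rw [h1]
    refine abs_le_of_sq_le_sq' ?_ (by positivity) |>.2
    rw [mul_pow, Real.sq_sqrt (mul_nonneg (hpos x hxP) hb0)]
    calc ‖B x (E y)‖ ^ 2 ≤ _ := h2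
      _ ≤ (B x x).re * (b * ‖y‖ ^ 2) := by have := hpos x hxP; gcongr
      _ = _ := by ring
  have h4 : (c * ‖x‖) ^ 2 ≤ (B x x).re * b := by
    rw [← Real.sq_sqrt (mul_nonneg (hpos x hxP) hb0)]
    have := (hcb x).trans hBx
    gcongr
  have h5 : (B x x).re * b ≤ (B x x).re * (b + 1) := by
    have := hpos x hxP
    gcongr; linarith
  rw [div_mul_eq_mul_div, div_le_iff₀ (by positivity), ← mul_pow]
  exact h4.trans h5

/-- Test `B (p + n)` on p - n: the cross terms vanish and the value is at least c(‖p‖² + ‖n‖²) ≥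
(c/2)(‖p‖ + ‖n‖)². -/
theorem IsPontryagin.isBddBelow {κ : ℕ} (h : IsPontryagin B κ) : IsBddBelow B := by
  obtain ⟨P, N, hPN, horth, ⟨c, hc, hP, hN⟩, -, -⟩ := h.decomposition
  refine ⟨c / 2, by positivity, fun x => ?_⟩
  obtain ⟨p, hp, n, hn, rfl⟩ := Submodule.mem_sup.mp (hPN.sup_eq_top.symm ▸ Submodule.mem_top :
    x ∈ P ⊔ N)
  have h1 : (B (p + n) (p - n)).re = (B p p).re - (B n n).re := by
    simp [horth p hp n hn, form_eq_zero_symm h.hermitian (horth p hp n hn), sub_eq_add_neg]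
  have h2 : (B (p + n) (p - n)).re ≤ ‖B (p + n)‖ * (‖p‖ + ‖n‖) :=
    (Complex.re_le_norm _).trans (((B (p + n)).le_opNorm _).trans (by
      gcongr; exact norm_sub_le _ _))
  have h3 := hP p hp
  have h4 := hN n hn
  have h5 : c / 2 * (‖p‖ + ‖n‖) ≤ ‖B (p + n)‖ := by
    by_contra hlt
    push Not at hlt
    have h6 : 0 < ‖p‖ + ‖n‖ := by
      by_contra h0
      have := norm_nonneg (B (p + n))
      nlinarith
    nlinarith [mul_lt_mul_of_pos_right hlt h6, sq_nonneg (‖p‖ - ‖n‖)]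
  refine le_trans ?_ h5
  gcongr
  exact norm_add_le _ _

/-- The projection onto N along P has kernel P, where the form is nonnegative, so it is injective on
a negative definite subspace. -/
theorem IsPontryagin.le_of_isNegTuple {κ : ℕ} (h : IsPontryagin B κ) {k : ℕ} {v : Fin k → K}
    (hv : IsNegTuple B v) : k ≤ κ := by
  obtain ⟨P, N, hPN, -, ⟨c, hc, hP, -⟩, hfin, hdim⟩ := h.decomposition
  let L := (N.projectionOnto P hPN.symm).comp (Fintype.linearCombination ℂ v)
  have hL : Function.Injective L := by
    rw [injective_iff_map_eq_zero]
    intro a ha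
    by_contra h0
    have h1 := hv a h0
    have h2 : ∑ i, a i • v i ∈ P := by
      rw [← Fintype.linearCombination_apply ℂ v a]
      exact (Submodule.projectionOnto_apply_eq_zero_iff _).mp ha
    have h3 := hP _ h2
    have : 0 ≤ c * ‖∑ i, a i • v i‖ ^ 2 := by positivity
    linarith
  have := LinearMap.finrank_le_finrank_of_injective hL
  rwa [hdim, Module.finrank_fin_fun] at this

theorem IsPontryagin.exists_isNegTuple {κ : ℕ} (h : IsPontryagin B κ) :
    ∃ v : Fin κ → K, IsNegTuple B v := by
  obtain ⟨P, N, hPN, -, ⟨c, hc, -, hN⟩, hfin, hdim⟩ := h.decomposition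
  let b := Module.finBasisOfFinrankEq ℂ N hdim
  refine ⟨fun i => b i, fun a ha => ?_⟩
  have h1 : ∑ i, a i • (b i : K) = ((∑ i, a i • b i : N) : K) := by simp
  have h2 : (∑ i, a i • b i : N) ≠ 0 := by
    intro h0
    exact ha (funext fun i => Fintype.linearIndependent_iff.mp b.linearIndependent a h0 i)
  rw [h1]
  have h3 := hN _ (∑ i, a i • b i : N).2
  have : 0 < ‖((∑ i, a i • b i : N) : K)‖ := 
    norm_pos_iff.mpr fun h0 => h2 (Subtype.ext h0)
  have : 0 < c * ‖((∑ i, a i • b i : N) : K)‖ ^ 2 := by positivity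
  linarith

theorem IsPontryagin.exists_isFrame {κ : ℕ} (h : IsPontryagin B κ) {v : Fin κ → K}
    (hv : IsNegTuple B v) : ∃ π, IsFrame B v π :=
  hv.exists_isFrame h.hermitian h.isBddBelow fun _ hw => by
    have := h.le_of_isNegTuple hw
    omega

theorem IsPontryagin.exists_isNegTuple_of_dense {κ : ℕ} (h : IsPontryagin B κ) {S : Set K}
    (hS : Dense S) : ∃ v : Fin κ → K, IsNegTuple B v ∧ ∀ i, v i ∈ S := by
  obtain ⟨v, hv⟩ := h.exists_isNegTuple
  exact hv.exists_mem_of_mem_closure fun i => hS (v i)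

theorem IsFrame.form_coord {k : ℕ} {v : Fin k → K} {π : Fin k → K →L[ℂ] ℂ} (hf : IsFrame B v π)
    (a : Fin k → ℂ) (x : K) : B (∑ i, a i • v i) (x - ∑ j, π j x • v j) = 0 := by
  rw [form_sum_left]
  exact Finset.sum_eq_zero fun i _ => by rw [hf.orth, mul_zero]

theorem IsFrame.re_form {k : ℕ} {v : Fin k → K} {π : Fin k → K →L[ℂ] ℂ} (hf : IsFrame B v π)
    (hB : ∀ x y, conj (B x y) = B y x) (x : K) :
    (B x x).re = (B (∑ j, π j x • v j) (∑ j, π j x • v j)).re +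
      (B (x - ∑ j, π j x • v j) (x - ∑ j, π j x • v j)).re := by
  have h1 := re_form_add hB (∑ j, π j x • v j) (x - ∑ j, π j x • v j)
  rw [add_sub_cancel, hf.form_coord] at h1
  simpa using h1

/-- The fundamental decomposition consists of the span of `v` and its orthogonal complement. This is
how subspaces are recognised as Pontryagin spaces. -/
theorem IsFrame.isPontryagin {k : ℕ} {v : Fin k → K} {π : Fin k → K →L[ℂ] ℂ} (hf : IsFrame B v π)
    (hK : CompleteSpace K) (hB : ∀ x y, conj (B x y) = B y x) : IsPontryagin B k := by
  let P : Submodule ℂ K := ⨅ i, (B (v i) : K →ₗ[ℂ] ℂ).ker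
  have hPmem : ∀ x, x ∈ P ↔ ∀ i, B (v i) x = 0 := fun x => by simp [P]
  let N : Submodule ℂ K := Submodule.span ℂ (Set.range v)
  have hNmem : ∀ x, x ∈ N ↔ ∃ a : Fin k → ℂ, ∑ i, a i • v i = x := fun x =>
    Submodule.mem_span_range_iff_exists_fun ℂ
  have hli : LinearIndependent ℂ v := by
    rw [Fintype.linearIndependent_iff]
    intro a ha i
    by_contra h0
    have := hf.neg a (fun h => h0 (congrFun h i))
    rw [ha] at this
    simp at this
  have horth : ∀ x ∈ P, ∀ y ∈ N, B x y = 0 := by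
    intro x hx y hy
    obtain ⟨a, rfl⟩ := (hNmem y).mp hy
    refine form_eq_zero_symm hB ?_
    rw [form_sum_left]
    exact Finset.sum_eq_zero fun i _ => by rw [(hPmem x).mp hx, mul_zero]
  obtain ⟨c, hc, hcP⟩ := hf.pos
  obtain ⟨d, hd, hdN⟩ := hf.neg.exists_bound
  refine ⟨hK, hB, P, N, ⟨?_, ?_⟩, horth, ⟨min c d, by positivity, fun x hx => ?_, fun x hx => ?_⟩,
    FiniteDimensional.span_of_finite ℂ (Set.finite_range v), ?_⟩
  · rw [Submodule.disjoint_def]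
    intro x hxP hxN
    have h0 := horth x hxP x hxN
    obtain ⟨a, rfl⟩ := (hNmem x).mp hxN
    by_contra hne
    have := hf.neg a (by rintro rfl; simp at hne)
    rw [h0] at this
    simp at this
  · rw [codisjoint_iff, eq_top_iff]
    intro x _
    refine Submodule.mem_sup.mpr ⟨x - ∑ j, π j x • v j, (hPmem _).mpr fun i => hf.orth i x,
      ∑ j, π j x • v j, (hNmem _).mpr ⟨_, rfl⟩, sub_add_cancel _ _⟩
  · refine le_trans ?_ (hcP x ((hPmem x).mp hx))
    gcongr
    exact min_le_left _ _
  · obtain ⟨a, rfl⟩ := (hNmem x).mp hx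
    refine le_trans ?_ (hdN a).2
    gcongr
    exact min_le_right _ _
  · simpa using finrank_span_eq_card hli

/-- The norm is controlled by the form and its values on a negative tuple. -/
theorem IsFrame.exists_estimate {k : ℕ} {v : Fin k → K} {π : Fin k → K →L[ℂ] ℂ}
    (hf : IsFrame B v π) (hB : ∀ x y, conj (B x y) = B y x) :
    ∃ c M : ℝ, 0 < c ∧ 0 < M ∧
      ∀ x, c * ‖x‖ ^ 2 ≤ (B x x).re + M * (∑ i, ‖B (v i) x‖) ^ 2 := by
  obtain ⟨c, hc, hcP⟩ := hf.pos
  obtain ⟨d, hd, hdN⟩ := hf.neg.exists_bound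
  refine ⟨c / 2, (‖B‖ + c) / d ^ 2, by positivity, by positivity, fun x => ?_⟩
  set n := ∑ j, π j x • v j with hn
  set a : Fin k → ℂ := fun j => π j x with ha
  set s := ∑ i, ‖B (v i) x‖ with hs
  have hs0 : 0 ≤ s := Finset.sum_nonneg fun _ _ => norm_nonneg _
  have h1 := hf.re_form hB x
  have h2 := hcP (x - n) fun i => hf.orth i x
  have h3 : -(B n n).re ≤ ‖a‖ * s := by
    have h4 : B n n = B n x := by
      have := hf.form_coord a x
      rw [map_sub, sub_eq_zero] at this
      exact this.symm
    have h5 : ‖B n x‖ ≤ ‖a‖ * s := by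
      rw [hn, form_sum_left, hs, Finset.mul_sum]
      refine (norm_sum_le _ _).trans (Finset.sum_le_sum fun i _ => ?_)
      rw [norm_mul, Complex.norm_conj]
      gcongr
      exact norm_le_pi_norm a i
    rw [h4]
    exact (neg_le_abs _).trans ((Complex.abs_re_le_norm _).trans h5)
  obtain ⟨h6, h7⟩ := hdN a
  -- From d‖a‖² ≤ -[n, n] ≤ ‖a‖ s after cancelling one factor ‖a‖.
  have h8 : d * ‖a‖ ≤ s := by
    by_contra hlt
    push Not at hlt
    have : 0 < ‖a‖ := by
      by_contra h0
      nlinarith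
    have := mul_lt_mul_of_pos_right hlt this
    have h9 := h6.trans h3
    nlinarith
  have h10 : ‖n‖ ^ 2 ≤ s ^ 2 / d ^ 2 := by
    rw [le_div_iff₀ (by positivity)]
    have h9 := h7.trans h3
    have : d * ‖n‖ ^ 2 * d ≤ ‖a‖ * s * d := by gcongr
    nlinarith [mul_le_mul_of_nonneg_right h8 hs0]
  have h11 : ‖x‖ ^ 2 ≤ 2 * ‖n‖ ^ 2 + 2 * ‖x - n‖ ^ 2 := by
    have : ‖x‖ ≤ ‖n‖ + ‖x - n‖ := by simpa using norm_add_le n (x - n)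
    have : ‖x‖ ^ 2 ≤ (‖n‖ + ‖x - n‖) ^ 2 := by gcongr
    nlinarith [sq_nonneg (‖n‖ - ‖x - n‖)]
  have h12 : -(‖B‖ * ‖n‖ ^ 2) ≤ (B n n).re := by
    have : ‖B n n‖ ≤ ‖B‖ * ‖n‖ ^ 2 := (norm_form_le B n n).trans_eq (by ring)
    exact (neg_le_neg this).trans (neg_le_of_abs_le (Complex.abs_re_le_norm _))
  have h13 : (‖B‖ + c) * ‖n‖ ^ 2 ≤ (‖B‖ + c) / d ^ 2 * s ^ 2 := by
    calc (‖B‖ + c) * ‖n‖ ^ 2 ≤ (‖B‖ + c) * (s ^ 2 / d ^ 2) := by gcongr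
      _ = _ := by ring
  rw [h1]
  nlinarith

/-- `E` stands for `F` renormed by the form `T`. Coercivity and continuity make the norms
equivalent, so `E` is complete and the Hilbert space theorem applies there. Keeping two types
separates the two norms on the same vector space. -/
theorem exists_riesz_of_linearEquiv {E F : Type*} [NormedAddCommGroup E] [InnerProductSpace ℂ E]
    [NormedAddCommGroup F] [NormedSpace ℂ F] [CompleteSpace F] (e : E ≃ₗ[ℂ] F) (T : SesqForm F)
    (hT : ∀ x y, T (e x) (e y) = inner ℂ x y) {c : ℝ} (hc : 0 < c)
    (hcT : ∀ x, c * ‖x‖ ^ 2 ≤ (T x x).re) (f : F →L[ℂ] ℂ) : ∃ y, f = T y := by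
  have hn : ∀ x, ‖x‖ ^ 2 = (T (e x) (e x)).re := fun x => by
    rw [hT]; exact norm_sq_eq_re_inner (𝕜 := ℂ) x
  have h1 : ∀ x, ‖e x‖ ≤ Real.sqrt c⁻¹ * ‖x‖ := fun x => by
    refine abs_le_of_sq_le_sq' ?_ (by positivity) |>.2
    rw [mul_pow, Real.sq_sqrt (by positivity), hn, inv_mul_eq_div, le_div_iff₀ hc, mul_comm]
    exact hcT _
  have h2 : ∀ y, ‖e.symm y‖ ≤ Real.sqrt ‖T‖ * ‖y‖ := fun y => by
    refine abs_le_of_sq_le_sq' ?_ (by positivity) |>.2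
    rw [mul_pow, Real.sq_sqrt (by positivity), hn, e.apply_symm_apply]
    exact (Complex.re_le_norm _).trans ((norm_form_le T y y).trans_eq (by ring))
  let E' : E ≃L[ℂ] F := e.toContinuousLinearEquivOfBounds _ _ h1 h2
  have : CompleteSpace E := by
    rw [completeSpace_congr (e := E'.toEquiv) E'.isUniformEmbedding]
    infer_instance
  let y := (InnerProductSpace.toDual ℂ E).symm (f.comp (E' : E →L[ℂ] F))
  refine ⟨e y, ContinuousLinearMap.ext fun x => ?_⟩
  obtain ⟨x, rfl⟩ := e.surjective x
  rw [hT]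
  exact (InnerProductSpace.toDual_symm_apply (x := x) (y := f.comp (E' : E →L[ℂ] F))).symm

/-- A complete space with a coercive Hermitian form satisfies the Riesz representation theorem. -/
theorem exists_riesz_of_coercive {F : Type*} [NormedAddCommGroup F] [NormedSpace ℂ F]
    [CompleteSpace F] {T : SesqForm F} (hT : ∀ x y, conj (T x y) = T y x) {c : ℝ} (hc : 0 < c)
    (hcT : ∀ x, c * ‖x‖ ^ 2 ≤ (T x x).re) (f : F →L[ℂ] ℂ) : ∃ y, f = T y := by
  let core : InnerProductSpace.Core ℂ F :=
    { inner := fun x y => T x y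
      conj_inner_symm := fun x y => hT y x
      re_inner_nonneg := fun x => le_trans (by positivity) (hcT x)
      add_left := fun x y z => by rw [map_add, _root_.add_apply]
      smul_left := fun x y r => form_smul_left T r x y
      definite := fun x hx => by
        have h1 := hcT x
        rw [show T x x = 0 from hx, Complex.zero_re] at h1
        have h2 : ‖x‖ ^ 2 ≤ 0 := by
          by_contra h0
          push Not at h0
          nlinarith [mul_pos hc h0]
        simpa using le_antisymm h2 (sq_nonneg _) }
  exact @exists_riesz_of_linearEquiv F F core.toNormedAddCommGroup
    (InnerProductSpace.ofCore core.toCore) _ _ _ (LinearEquiv.refl ℂ F) T (fun _ _ => rfl) c hc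
    hcT f

theorem IsPontryagin.exists_riesz {κ : ℕ} (h : IsPontryagin B κ) (f : K →L[ℂ] ℂ) :
    ∃ y, f = B y := by
  have := h.complete
  obtain ⟨v, hv⟩ := h.exists_isNegTuple
  obtain ⟨π, hf⟩ := h.exists_isFrame hv
  obtain ⟨c, hc, hcP⟩ := hf.pos
  obtain ⟨d, hd, hdN⟩ := hf.neg.exists_bound
  obtain ⟨n, hn⟩ : ∃ n : K →L[ℂ] K, ∀ x, n x = ∑ j, π j x • v j :=
    ⟨∑ j, (π j).smulRight (v j), fun x => by simp⟩
  obtain ⟨p, hp⟩ : ∃ p : K →L[ℂ] K, ∀ x, p x = x - ∑ j, π j x • v j :=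
    ⟨ContinuousLinearMap.id ℂ K - n, fun x => by simp [hn]⟩
  have horth : ∀ x y, B (n x) (p y) = 0 := fun x y => by rw [hn, hp]; exact hf.form_coord _ y
  have hxpn : ∀ x, x = p x + n x := fun x => by rw [hp, hn, sub_add_cancel]
  -- The Hilbert form obtained by flipping the sign on the negative part; p - n is the fundamental
  -- symmetry, so T x = B (p x - n x).
  let T : SesqForm K := B.bilinearComp p p - B.bilinearComp n n
  have hT : ∀ x y, T x y = B (p x) (p y) - B (n x) (n y) := fun x y => rfl
  have hTB : ∀ x y, T x y = B (p x - n x) y := fun x y => by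
    have h1 := horth x y
    have h2 := form_eq_zero_symm h.hermitian (horth y x)
    conv_rhs => rw [hxpn y]
    rw [hT, map_sub B, _root_.sub_apply, map_add (B (p x)), map_add (B (n x)), h1, h2]
    ring
  obtain ⟨y, rfl⟩ := exists_riesz_of_coercive (T := T) (c := min c d / 2)
    (fun x y => by rw [hT, hT, map_sub, h.hermitian, h.hermitian]) (by positivity)
    (fun x => by
      have h1 := hcP (p x) fun i => by rw [hp]; exact hf.orth i x
      have h2 := (hdN fun j => π j x).2
      rw [← hn] at h2
      have h3 : ‖x‖ ≤ ‖p x‖ + ‖n x‖ := by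
        conv_lhs => rw [hxpn x]
        exact norm_add_le _ _
      have h4 : min c d * ‖p x‖ ^ 2 ≤ (B (p x) (p x)).re := by
        refine le_trans ?_ h1
        gcongr
        exact min_le_left _ _
      have h5 : min c d * ‖n x‖ ^ 2 ≤ -(B (n x) (n x)).re := by
        refine le_trans ?_ h2
        gcongr
        exact min_le_right _ _
      have h6 : ‖x‖ ^ 2 ≤ 2 * (‖p x‖ ^ 2 + ‖n x‖ ^ 2) := by
        have : ‖x‖ ^ 2 ≤ (‖p x‖ + ‖n x‖) ^ 2 := by gcongr
        nlinarith [sq_nonneg (‖p x‖ - ‖n x‖)]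
      have h7 : 0 < min c d := by positivity
      rw [hT, Complex.sub_re]
      nlinarith) f
  exact ⟨p y - n y, ContinuousLinearMap.ext fun x => hTB y x⟩

end Geometry

/-! ### Inverting finite-rank perturbations, and the method of continuity. -/

section Inverses

variable {K : Type*} [NormedAddCommGroup K] [NormedSpace ℂ K]

theorem inverse_eq_of_mul_eq_one {R : Type*} [Ring R] {a b : R} (ha : IsUnit a) (h : a * b = 1) :
    Ring.inverse a = b := by
  rw [← mul_one (Ring.inverse a), ← h, ← mul_assoc, Ring.inverse_mul_cancel _ ha, one_mul]

theorem isUnit_of_mul_eq_one_of_injective {T R : K →L[ℂ] K} (h : T * R = 1)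
    (hT : ∀ x, T x = 0 → x = 0) : IsUnit T := by
  refine ⟨⟨T, R, h, ContinuousLinearMap.ext fun x => ?_⟩, rfl⟩
  refine sub_eq_zero.mp (hT _ ?_)
  have h1 := congrArg (fun L : K →L[ℂ] K => L (T x)) h
  change T (R (T x)) = T x at h1
  rw [map_sub, sub_eq_zero]
  exact h1

/-- The matrix governing the invertibility of `1 + ∑ x_j ⊗ π_j`. -/
def perturbMatrix {k : ℕ} (π : Fin k → K →L[ℂ] ℂ) (x : Fin k → K) : Matrix (Fin k) (Fin k) ℂ :=
  Matrix.of fun i j => (1 : Matrix (Fin k) (Fin k) ℂ) i j + π i (x j)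

theorem perturbMatrix_mulVec {k : ℕ} (π : Fin k → K →L[ℂ] ℂ) (x : Fin k → K) (a : Fin k → ℂ)
    (i : Fin k) : (perturbMatrix π x).mulVec a i = a i + π i (∑ j, a j • x j) := by
  have h1 : (1 : Matrix (Fin k) (Fin k) ℂ).mulVec a i = a i := by rw [Matrix.one_mulVec]
  simp only [Matrix.mulVec, dotProduct] at h1
  simp only [perturbMatrix, Matrix.mulVec, dotProduct, Matrix.of_apply, add_mul,
    Finset.sum_add_distrib, h1, map_sum, map_smul, smul_eq_mul]
  congr 1
  exact Finset.sum_congr rfl fun j _ => mul_comm _ _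

/-- A null vector c of the matrix makes ∑ c_j x_j a null vector of the operator; if that sum is
zero, the matrix equation reduces to c = 0. -/
theorem isUnit_perturbMatrix {k : ℕ} {π : Fin k → K →L[ℂ] ℂ} {x : Fin k → K}
    (h : ∀ y, y + ∑ j, π j y • x j = 0 → y = 0) : IsUnit (perturbMatrix π x).det := by
  rw [← Matrix.isUnit_iff_isUnit_det, ← Matrix.mulVec_injective_iff_isUnit]
  intro a b hab
  rw [← sub_eq_zero]
  set c := a - b with hc
  have h1 : ∀ i, c i + π i (∑ j, c j • x j) = 0 := fun i => by
    rw [← perturbMatrix_mulVec, hc, Matrix.mulVec_sub, hab, sub_self]; rfl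
  have h2 : ∑ j, c j • x j = 0 := by
    refine h _ ?_
    rw [← Finset.sum_add_distrib]
    exact Finset.sum_eq_zero fun i _ => by rw [← add_smul, h1, zero_smul]
  funext i
  have := h1 i
  rwa [h2, map_zero, add_zero] at this

/-- The Woodbury formula: inverting a finite-rank perturbation of 1 costs only the inversion of a k
× k matrix. -/
theorem perturb_mul_inverse {k : ℕ} {π : Fin k → K →L[ℂ] ℂ} {x : Fin k → K}
    (h : IsUnit (perturbMatrix π x).det) :
    (1 + ∑ j, (π j).smulRight (x j)) *
      (1 - ∑ i, ∑ j, (perturbMatrix π x)⁻¹ i j • (π j).smulRight (x i) : K →L[ℂ] K) = 1 := by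
  ext y
  set c := (perturbMatrix π x)⁻¹.mulVec fun j => π j y with hc
  have h1 : (1 - ∑ i, ∑ j, (perturbMatrix π x)⁻¹ i j • (π j).smulRight (x i) : K →L[ℂ] K) y =
      y - ∑ i, c i • x i := by
    simp [hc, Matrix.mulVec, dotProduct, Finset.sum_smul, smul_smul]
  have h2 : (perturbMatrix π x).mulVec c = fun j => π j y := by
    rw [hc, Matrix.mulVec_mulVec, Matrix.mul_nonsing_inv _ h, Matrix.one_mulVec]
  have h3 : ∀ i, π i (y - ∑ i, c i • x i) = c i := fun i => by
    have := congrFun h2 i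
    rw [perturbMatrix_mulVec] at this
    rw [map_sub, ← this, add_sub_cancel_right]
  rw [mul_apply_eq_comp, h1]
  simp [-map_sub, -map_sum, h3]

theorem isUnit_perturb {k : ℕ} {π : Fin k → K →L[ℂ] ℂ} {x : Fin k → K}
    (h : ∀ y, y + ∑ j, π j y • x j = 0 → y = 0) :
    IsUnit (1 + ∑ j, (π j).smulRight (x j) : K →L[ℂ] K) :=
  isUnit_of_mul_eq_one_of_injective (perturb_mul_inverse (isUnit_perturbMatrix h)) fun y hy =>
    h y (by simpa using hy)

/-- The method of continuity. -/
theorem isUnit_add_of_bddBelow [CompleteSpace K] {W X : K →L[ℂ] K} {δ : ℝ} (hδ : 0 < δ)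
    (hb : ∀ t : ℝ, 0 ≤ t → t ≤ 1 → ∀ x, δ * ‖x‖ ≤ ‖(W + (t : ℂ) • X) x‖) (hW : IsUnit W) :
    IsUnit (W + X) := by
  -- The path from W to W + X is cut into n steps, so short that each is a Neumann perturbation: the
  -- inverse has norm at most 1/δ, and ‖X‖/(δn) < 1.
  obtain ⟨n, hn⟩ := exists_nat_gt (‖X‖ / δ)
  have hn0 : (0 : ℝ) < n := lt_of_le_of_lt (by positivity) hn
  have key : ∀ m : ℕ, m ≤ n → IsUnit (W + (((m / n : ℝ)) : ℂ) • X) := by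
    intro m
    induction m with
    | zero => intro _; simpa using hW
    | succ m ih =>
      intro hm
      obtain ⟨u, hu⟩ := ih (by omega)
      have hmn : (m : ℝ) / n ≤ 1 := by
        rw [div_le_one hn0]; exact_mod_cast (by omega : m ≤ n)
      have h1 : ‖(↑u⁻¹ : K →L[ℂ] K)‖ ≤ δ⁻¹ := by
        refine ContinuousLinearMap.opNorm_le_bound _ (by positivity) fun y => ?_
        have h2 := hb (m / n) (by positivity) hmn ((↑u⁻¹ : K →L[ℂ] K) y)
        rw [← hu, ← mul_apply_eq_comp, Units.mul_inv] at h2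
        rw [inv_mul_eq_div, le_div_iff₀ hδ, mul_comm]
        exact h2
      have h3 : W + (((m + 1 : ℕ) / n : ℝ) : ℂ) • X =
          u * (1 - (-(((n : ℝ)⁻¹ : ℝ) : ℂ)) • (↑u⁻¹ * X)) := by
        rw [mul_sub, mul_smul_comm, ← mul_assoc, Units.mul_inv, one_mul, mul_one, hu, neg_smul,
          sub_neg_eq_add, add_assoc, ← add_smul]
        congr 2
        push_cast
        field_simp
      rw [h3]
      refine u.isUnit.mul (isUnit_one_sub_of_norm_lt_one ?_)
      rw [norm_smul, norm_neg, Complex.norm_real, norm_inv, Real.norm_of_nonneg hn0.le]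
      calc (n : ℝ)⁻¹ * ‖(↑u⁻¹ : K →L[ℂ] K) * X‖ ≤ (n : ℝ)⁻¹ * (δ⁻¹ * ‖X‖) := by
            gcongr
            exact (norm_mul_le _ _).trans (by gcongr)
        _ = (‖X‖ / δ) / n := by field_simp
        _ < 1 := by rwa [div_lt_one hn0]
  have := key n le_rfl
  rwa [div_self hn0.ne', Complex.ofReal_one, one_smul] at this

/-- Both sides are quadratic, and the right one is O(st) once t < s, so t cannot be small against s.
-/
theorem exists_pos_mul_le {e m : ℝ} (he : 0 < e) (hm : 0 ≤ m) :
    ∃ δ : ℝ, 0 < δ ∧ ∀ s t : ℝ, 0 ≤ s → 0 ≤ t → e * s ^ 2 ≤ m * (s * t + t ^ 2) → δ * s ≤ t := by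
  refine ⟨min 1 (e / (4 * (m + 1))), by positivity, fun s t hs ht h => ?_⟩
  by_contra hlt
  push Not at hlt
  have h1 : t < s := lt_of_lt_of_le hlt (by
    calc _ ≤ 1 * s := by gcongr; exact min_le_left _ _
      _ = s := one_mul s)
  have h2 : t < e / (4 * (m + 1)) * s := lt_of_lt_of_le hlt (by gcongr; exact min_le_right _ _)
  have h3 : 4 * (m + 1) * t < e * s := by
    rw [div_mul_eq_mul_div, lt_div_iff₀ (by positivity)] at h2
    linarith
  have h4 : s * t + t ^ 2 ≤ 2 * (s * t) := by nlinarith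
  nlinarith [mul_nonneg hs ht, mul_le_mul_of_nonneg_left h4 hm]

end Inverses

/-! ### Resolvents of isometric automorphisms of a Pontryagin space in the unit disc. -/

section Isometry

variable {K : Type*} [NormedAddCommGroup K] [NormedSpace ℂ K] {B : SesqForm K} {k : ℕ}
  {v : Fin k → K} {π : Fin k → K →L[ℂ] ℂ}

/-- The operator acting as `V - l` on the complement of the negative tuple `v` and as the identity
on its span. -/
def compressed (v : Fin k → K) (π : Fin k → K →L[ℂ] ℂ) (V : K →L[ℂ] K) (l : ℂ) : K →L[ℂ] K :=
  (V - l • 1) - ∑ j, (π j).smulRight ((V - l • 1) (v j) - v j)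

theorem compressed_apply (V : K →L[ℂ] K) (l : ℂ) (x : K) :
    compressed v π V l x = V (x - ∑ j, π j x • v j) - l • (x - ∑ j, π j x • v j) +
      ∑ j, π j x • v j := by
  simp [compressed, smul_sub, Finset.smul_sum, Finset.sum_sub_distrib, map_sum,
    smul_comm l]
  abel

/-- Write x = p + n along the frame, y for the image of x, and u = lp - n, so that Vp = u + y. Since
V is isometric, (1 - |l|²)[p, p] - [n, n] = 2 Re [u, y] + [y, y]. The left side is coercive in x and
the right side is small with y. -/
theorem compressed_bddBelow (hf : IsFrame B v π) (hB : ∀ x y, conj (B x y) = B y x)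
    {V : K →L[ℂ] K} (hV : ∀ x y, B (V x) (V y) = B x y) {r : ℝ} (hr : r < 1) :
    ∃ δ : ℝ, 0 < δ ∧ ∀ l : ℂ, ‖l‖ ≤ r → ∀ x, δ * ‖x‖ ≤ ‖compressed v π V l x‖ := by
  by_cases hr0 : 0 ≤ r
  swap
  · exact ⟨1, one_pos, fun l hl => absurd ((norm_nonneg l).trans hl) hr0⟩
  obtain ⟨c, hc, hcP⟩ := hf.pos
  obtain ⟨d, hd, hdN⟩ := hf.neg.exists_bound
  obtain ⟨n, hn⟩ : ∃ n : K →L[ℂ] K, ∀ x, n x = ∑ j, π j x • v j :=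
    ⟨∑ j, (π j).smulRight (v j), fun x => by simp⟩
  set C := 1 + 2 * ‖n‖ with hC
  have hr2 : 0 < 1 - r ^ 2 := by nlinarith
  set e := min ((1 - r ^ 2) * c) d with he
  have he0 : 0 < e := by positivity
  obtain ⟨δ, hδ, hδ'⟩ := exists_pos_mul_le (e := e / 2) (m := 2 * ‖B‖ * C + ‖B‖) (by positivity)
    (by positivity)
  refine ⟨δ, hδ, fun l hl x => hδ' _ _ (norm_nonneg _) (norm_nonneg _) ?_⟩
  set y := compressed v π V l x with hy
  rw [compressed_apply, ← hn] at hy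
  obtain ⟨p, hp⟩ : ∃ p, p = x - n x := ⟨_, rfl⟩
  rw [← hp] at hy
  have hpn : x = p + n x := by rw [hp, sub_add_cancel]
  have hnp : B (n x) p = 0 := by rw [hp, hn]; exact hf.form_coord _ _
  have h1 := hcP p fun i => by rw [hp, hn]; exact hf.orth i x
  have h2 := (hdN fun j => π j x).2
  rw [← hn] at h2
  obtain ⟨u, hu⟩ : ∃ u, u = l • p + -n x := ⟨_, rfl⟩
  have hVp : V p = u + y := by rw [hy, hu]; abel
  have h3 : (B p p).re = (B u u).re + 2 * (B u y).re + (B y y).re := by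
    rw [← re_form_add hB, ← hVp, hV]
  have h4 : (B u u).re = ‖l‖ ^ 2 * (B p p).re + (B (n x) (n x)).re := by
    have h5 : B (l • p) (-n x) = 0 := by
      rw [form_smul_left, map_neg, form_eq_zero_symm hB hnp, neg_zero, mul_zero]
    rw [hu, re_form_add hB, h5, re_form_smul]
    simp
  have h5 : ‖p‖ ≤ ‖x‖ + ‖n x‖ := by rw [hp]; exact norm_sub_le _ _
  have h6 : ‖n x‖ ≤ ‖n‖ * ‖x‖ := n.le_opNorm x
  have h7 : ‖u‖ ≤ C * ‖x‖ := by
    have : ‖u‖ ≤ ‖p‖ + ‖n x‖ := by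
      rw [hu]
      refine (norm_add_le _ _).trans ?_
      rw [norm_neg, norm_smul]
      have : ‖l‖ * ‖p‖ ≤ 1 * ‖p‖ := by gcongr; linarith
      linarith
    rw [hC]; linarith
  have h8 : (B u y).re ≤ ‖B‖ * (C * ‖x‖) * ‖y‖ :=
    (Complex.re_le_norm _).trans ((norm_form_le B u y).trans (by gcongr))
  have h9 : (B y y).re ≤ ‖B‖ * ‖y‖ * ‖y‖ := (Complex.re_le_norm _).trans (norm_form_le B y y)
  have h10 : ‖l‖ ^ 2 ≤ r ^ 2 := by gcongr
  have hpp : 0 ≤ (B p p).re := le_trans (by positivity) h1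
  have h11 : e * ‖p‖ ^ 2 ≤ (1 - ‖l‖ ^ 2) * (B p p).re := by
    calc e * ‖p‖ ^ 2 ≤ ((1 - r ^ 2) * c) * ‖p‖ ^ 2 := by gcongr; exact min_le_left _ _
      _ = (1 - r ^ 2) * (c * ‖p‖ ^ 2) := by ring
      _ ≤ (1 - r ^ 2) * (B p p).re := by gcongr
      _ ≤ _ := by gcongr
  have h12 : e * ‖n x‖ ^ 2 ≤ -(B (n x) (n x)).re := by
    refine le_trans ?_ h2
    gcongr
    exact min_le_right _ _
  have h13 : ‖x‖ ^ 2 ≤ 2 * (‖p‖ ^ 2 + ‖n x‖ ^ 2) := by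
    have : ‖x‖ ≤ ‖p‖ + ‖n x‖ := by
      conv_lhs => rw [hpn]
      exact norm_add_le _ _
    have : ‖x‖ ^ 2 ≤ (‖p‖ + ‖n x‖) ^ 2 := by gcongr
    nlinarith [sq_nonneg (‖p‖ - ‖n x‖)]
  have h14 : e / 2 * ‖x‖ ^ 2 ≤ e * ‖p‖ ^ 2 + e * ‖n x‖ ^ 2 := by nlinarith
  have h15 : 0 ≤ ‖B‖ * (‖x‖ * ‖y‖) := by positivity
  have h16 : 0 ≤ ‖B‖ * C * ‖y‖ ^ 2 := by positivity
  nlinarith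

/-- The uniform lower bound allows continuation along tl from t = 0 to t = 1. At t = 0 the operator
is V times a finite-rank perturbation of 1, for which injectivity suffices. -/
theorem isUnit_compressed [CompleteSpace K] (hf : IsFrame B v π)
    (hB : ∀ x y, conj (B x y) = B y x) {V : K →L[ℂ] K} (hV : ∀ x y, B (V x) (V y) = B x y)
    (hVu : IsUnit V) {l : ℂ} (hl : ‖l‖ < 1) : IsUnit (compressed v π V l) := by
  obtain ⟨δ, hδ, hb⟩ := compressed_bddBelow hf hB hV hl
  have hadd : ∀ t : ℂ, compressed v π V (t * l) = compressed v π V 0 +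
      t • (compressed v π V l - compressed v π V 0) := by
    intro t
    ext x
    simp only [compressed_apply, _root_.add_apply, _root_.smul_apply, _root_.sub_apply]
    module
  have h0 : IsUnit (compressed v π V 0) := by
    obtain ⟨U, rfl⟩ := hVu
    have h1 : compressed v π (U : K →L[ℂ] K) 0 =
        U * (1 + ∑ j, (π j).smulRight ((↑U⁻¹ : K →L[ℂ] K) (v j) - v j)) := by
      ext x
      have h2 : ∀ y, (U : K →L[ℂ] K) ((↑U⁻¹ : K →L[ℂ] K) y) = y := fun y => by
        rw [← mul_apply_eq_comp, Units.mul_inv]; rfl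
      simp [compressed_apply, h2, Finset.sum_sub_distrib, smul_sub, map_sum]
      abel
    rw [h1]
    refine U.isUnit.mul (isUnit_perturb fun y hy => ?_)
    have h3 : compressed v π (U : K →L[ℂ] K) 0 y = 0 := by
      rw [h1, mul_apply_eq_comp]
      have : (1 + ∑ j, (π j).smulRight ((↑U⁻¹ : K →L[ℂ] K) (v j) - v j) : K →L[ℂ] K) y = 0 := by
        simpa using hy
      rw [this, map_zero]
    have h4 := hb 0 (by simp) y
    rw [h3, norm_zero] at h4
    exact norm_le_zero_iff.mp (by
      by_contra h5
      push Not at h5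
      nlinarith [mul_pos hδ h5])
  have := isUnit_add_of_bddBelow (X := compressed v π V l - compressed v π V 0) hδ
    (fun t ht0 ht1 x => by
      rw [← hadd]
      refine hb _ ?_ x
      rw [norm_mul, Complex.norm_real, Real.norm_of_nonneg ht0]
      exact mul_le_of_le_one_left (norm_nonneg _) ht1) h0
  rwa [add_sub_cancel] at this

theorem analyticAt_det {n : Type*} [Fintype n] [DecidableEq n] {M : ℂ → Matrix n n ℂ} {z : ℂ}
    (hM : ∀ i j, AnalyticAt ℂ (fun w => M w i j) z) : AnalyticAt ℂ (fun w => (M w).det) z := by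
  simp only [Matrix.det_apply, Units.smul_def, zsmul_eq_mul]
  exact Finset.analyticAt_fun_sum _ fun σ _ =>
    analyticAt_const.mul (Finset.analyticAt_fun_prod _ fun i _ => hM _ _)

/-- Cramer's rule. With 0⁻¹ = 0 the formula persists for singular matrices, so no condition on the
determinant is needed. -/
theorem meromorphicAt_matrix_inv {n : Type*} [Fintype n] [DecidableEq n] {M : ℂ → Matrix n n ℂ}
    {z : ℂ} (hM : ∀ i j, AnalyticAt ℂ (fun w => M w i j) z) (i j : n) :
    MeromorphicAt (fun w => (M w)⁻¹ i j) z := by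
  simp only [Matrix.inv_def, Matrix.smul_apply, Ring.inverse_eq_inv', smul_eq_mul,
    Matrix.adjugate_apply]
  refine (analyticAt_det hM).meromorphicAt.inv.mul (analyticAt_det fun a b => ?_).meromorphicAt
  by_cases h : a = j
  · simpa [Matrix.updateRow_apply, h] using analyticAt_const
  · simpa [Matrix.updateRow_apply, h] using hM a b

theorem analyticAt_ringInverse [CompleteSpace K] {F : ℂ → K →L[ℂ] K} {z : ℂ}
    (hF : AnalyticAt ℂ F z) (hz : IsUnit (F z)) : AnalyticAt ℂ (fun w => Ring.inverse (F w)) z := by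
  obtain ⟨u, hu⟩ := hz
  have := analyticAt_inverse (𝕜 := ℂ) u
  rw [hu] at this
  exact this.comp hF

theorem _root_.MeromorphicAt.clm_apply {E F : Type*} [NormedAddCommGroup E] [NormedSpace ℂ E]
    [NormedAddCommGroup F] [NormedSpace ℂ F] {f : ℂ → E} {z : ℂ} (hf : MeromorphicAt f z)
    (L : E →L[ℂ] F) : MeromorphicAt (fun w => L (f w)) z := by
  obtain ⟨n, hn⟩ := hf
  refine ⟨n, ?_⟩
  have := (L.analyticAt _).comp hn
  refine this.congr (Eventually.of_forall fun w => ?_)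
  simp

/-- The resolvent of an isometric automorphism of a Pontryagin space is meromorphic in the unit
disc. -/
theorem meromorphicAt_inverse_sub [CompleteSpace K] (hf : IsFrame B v π)
    (hB : ∀ x y, conj (B x y) = B y x) {V : K →L[ℂ] K} (hV : ∀ x y, B (V x) (V y) = B x y)
    (hVu : IsUnit V) {l : ℂ → ℂ} {z : ℂ} (hl : AnalyticAt ℂ l z) (hlz : ‖l z‖ < 1)
    (hu : ∀ᶠ w in 𝓝[≠] z, IsUnit (V - l w • 1)) :
    MeromorphicAt (fun w => Ring.inverse (V - l w • 1)) z := by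
  let W : ℂ → K →L[ℂ] K := fun w => compressed v π V (l w)
  have hD : AnalyticAt ℂ (fun w => V - l w • (1 : K →L[ℂ] K)) z :=
    analyticAt_const.sub (hl.smul analyticAt_const)
  have hy : ∀ j, AnalyticAt ℂ (fun w => (V - l w • (1 : K →L[ℂ] K)) (v j) - v j) z := fun j =>
    (((ContinuousLinearMap.apply ℂ K (v j)).analyticAt _).comp hD).sub analyticAt_const
  have hsr : ∀ (j : Fin k) (f : ℂ → K), AnalyticAt ℂ f z →
      AnalyticAt ℂ (fun w => (π j).smulRight (f w)) z := fun j f hf' =>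
    ((ContinuousLinearMap.smulRightL ℂ K K (π j)).analyticAt _).comp hf'
  have hW : AnalyticAt ℂ W z :=
    hD.sub (Finset.analyticAt_fun_sum _ fun j _ => hsr j _ (hy j))
  have hWz : IsUnit (W z) := isUnit_compressed hf hB hV hVu hlz
  have hWi : AnalyticAt ℂ (fun w => Ring.inverse (W w)) z := analyticAt_ringInverse hW hWz
  let x : Fin k → ℂ → K := fun j w =>
    Ring.inverse (W w) ((V - l w • (1 : K →L[ℂ] K)) (v j) - v j)
  have hx : ∀ j, AnalyticAt ℂ (x j) z := fun j =>
    ((ContinuousLinearMap.id ℂ (K →L[ℂ] K)).analyticAt_bilinear _).comp₂ hWi (hy j)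
  have hS : ∀ i j, AnalyticAt ℂ (fun w => perturbMatrix π (fun j => x j w) i j) z := fun i j =>
    analyticAt_const.add (((π i).analyticAt _).comp (hx j))
  -- The Woodbury inverse of the finite-rank factor, times W⁻¹. Only the inverse of the k × k matrix
  -- can contribute poles.
  have hmer : MeromorphicAt (fun w => Ring.inverse (W w) - ∑ i, ∑ j,
      (perturbMatrix π (fun j => x j w))⁻¹ i j •
        ((π j).smulRight (x i w) * Ring.inverse (W w))) z :=
    hWi.meromorphicAt.sub (MeromorphicAt.fun_sum fun i _ => MeromorphicAt.fun_sum fun j _ =>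
      (meromorphicAt_matrix_inv hS i j).smul ((hsr j _ (hx i)).mul hWi).meromorphicAt)
  refine hmer.congr ?_
  have hev : ∀ᶠ w in 𝓝[≠] z, ‖l w‖ < 1 :=
    nhdsWithin_le_nhds (hl.continuousAt.norm.eventually_lt continuousAt_const hlz)
  filter_upwards [hu, hev] with w hw1 hw2
  have hWw : IsUnit (W w) := isUnit_compressed hf hB hV hVu hw2
  -- W differs from V - l by the finite-rank operator that `compressed` subtracts; factoring W out
  -- on the left turns its vectors into x_j.
  have hfac : V - l w • 1 = W w * (1 + ∑ j, (π j).smulRight (x j w)) := by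
    ext y
    have h1 : ∀ y, W w (Ring.inverse (W w) y) = y := fun y => by
      rw [← mul_apply_eq_comp, Ring.mul_inverse_cancel _ hWw]; rfl
    have h2 : W w y = (V - l w • (1 : K →L[ℂ] K)) y -
        ∑ j, π j y • ((V - l w • (1 : K →L[ℂ] K)) (v j) - v j) := by
      simp [W, compressed]
    rw [mul_apply_eq_comp, _root_.add_apply, map_add, _root_.sum_apply, map_sum]
    simp only [ContinuousLinearMap.smulRight_apply, map_smul, x, h1, one_apply_eq_self]
    rw [h2, sub_add_cancel]
  have hdet : IsUnit (perturbMatrix π (fun j => x j w)).det := by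
    refine isUnit_perturbMatrix fun y hy => ?_
    obtain ⟨u, hu⟩ := hw1
    have h1 : (u : K →L[ℂ] K) y = 0 := by
      rw [hu, hfac, mul_apply_eq_comp]
      have : (1 + ∑ j, (π j).smulRight (x j w) : K →L[ℂ] K) y = 0 := by simpa using hy
      rw [this, map_zero]
    have h2 : (↑u⁻¹ : K →L[ℂ] K) ((u : K →L[ℂ] K) y) = y := by
      rw [← mul_apply_eq_comp, Units.inv_mul]; rfl
    rw [← h2, h1, map_zero]
  symm
  have hfin : Ring.inverse (W w) - ∑ i, ∑ j, (perturbMatrix π (fun j => x j w))⁻¹ i j •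
        ((π j).smulRight (x i w) * Ring.inverse (W w)) =
      (1 - ∑ i, ∑ j, (perturbMatrix π (fun j => x j w))⁻¹ i j • (π j).smulRight (x i w)) *
        Ring.inverse (W w) := by
    simp only [sub_mul, one_mul, Finset.sum_mul, smul_mul_assoc]
  rw [hfin]
  refine inverse_eq_of_mul_eq_one hw1 ?_
  rw [hfac, mul_assoc, ← mul_assoc (1 + _), perturb_mul_inverse hdet, one_mul,
    Ring.mul_inverse_cancel _ hWw]

end Isometry

/-! ### Resolvents and Cayley transforms expressed by the resolvent at the reference point. -/

section Pencil

variable {K : Type*} [NormedAddCommGroup K] [NormedSpace ℂ K]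

/-- `I - (z - z₀) R₀`, which is `(A - z) (A - z₀)⁻¹` if `R₀ = (A - z₀)⁻¹`. -/
def pencil (R₀ : K →L[ℂ] K) (z₀ z : ℂ) : K →L[ℂ] K := 1 - (z - z₀) • R₀

/-- The operator `I + (z - z₀) (A - z)⁻¹`, expressed by `R₀ = (A - z₀)⁻¹`. -/
def transfer (R₀ : K →L[ℂ] K) (z₀ z : ℂ) : K →L[ℂ] K := Ring.inverse (pencil R₀ z₀ z)

/-- The Cayley transform `(A - conj w) (A - w)⁻¹`, expressed by `R₀ = (A - z₀)⁻¹`. -/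
def cayley (R₀ : K →L[ℂ] K) (z₀ w : ℂ) : K →L[ℂ] K := pencil R₀ z₀ (conj w) * transfer R₀ z₀ w

variable {R₀ : K →L[ℂ] K} {z₀ z w : ℂ}

theorem pencil_apply (x : K) : pencil R₀ z₀ z x = x - (z - z₀) • R₀ x := rfl

@[simp] theorem pencil_self : pencil R₀ z₀ z₀ = 1 := by simp [pencil]

@[simp] theorem transfer_self : transfer R₀ z₀ z₀ = 1 := by simp [transfer]

theorem pencil_mul_transfer (h : IsUnit (pencil R₀ z₀ z)) :
    pencil R₀ z₀ z * transfer R₀ z₀ z = 1 := Ring.mul_inverse_cancel _ h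

theorem transfer_mul_pencil (h : IsUnit (pencil R₀ z₀ z)) :
    transfer R₀ z₀ z * pencil R₀ z₀ z = 1 := Ring.inverse_mul_cancel _ h

theorem pencil_transfer_apply (h : IsUnit (pencil R₀ z₀ z)) (x : K) :
    pencil R₀ z₀ z (transfer R₀ z₀ z x) = x := by
  rw [← mul_apply_eq_comp, pencil_mul_transfer h]; rfl

theorem commute_pencil {T : K →L[ℂ] K} (hT : Commute T R₀) : Commute T (pencil R₀ z₀ z) :=
  (Commute.one_right T).sub_right (hT.smul_right _)

theorem commute_transfer {T : K →L[ℂ] K} (hT : Commute T R₀) : Commute T (transfer R₀ z₀ z) := by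
  by_cases h : IsUnit (pencil R₀ z₀ z)
  · have h1 := (commute_pencil hT (z₀ := z₀) (z := z)).eq
    have h2 := pencil_mul_transfer h
    have h3 := transfer_mul_pencil h
    calc T * transfer R₀ z₀ z = transfer R₀ z₀ z * (pencil R₀ z₀ z * T) * transfer R₀ z₀ z := by
          rw [← mul_assoc, h3, one_mul]
      _ = transfer R₀ z₀ z * T * (pencil R₀ z₀ z * transfer R₀ z₀ z) := by
          rw [← h1]; simp only [mul_assoc]
      _ = transfer R₀ z₀ z * T := by rw [h2, mul_one]
  · rw [transfer, Ring.inverse_non_unit _ h]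
    exact Commute.zero_right T

theorem commute_cayley {T : K →L[ℂ] K} (hT : Commute T R₀) : Commute T (cayley R₀ z₀ z) :=
  (commute_pencil hT).mul_right (commute_transfer hT)

theorem transfer_eq (h : IsUnit (pencil R₀ z₀ z)) :
    transfer R₀ z₀ z = 1 + (z - z₀) • (transfer R₀ z₀ z * R₀) := by
  have h1 := transfer_mul_pencil h
  rw [pencil, mul_sub, mul_one, mul_smul_comm, sub_eq_iff_eq_add] at h1
  exact h1

/-- Membership of (y, x + zy) in A is the equation pencil(z) y = R₀ x. A bounded resolvent R at z
makes 1 + (z - z₀)R a right inverse of the pencil, and its uniqueness makes the pencil injective. -/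
theorem isResolvent_iff {A : LinRel K} (hA : A.IsResolvent z₀ R₀) (z : ℂ) (R : K →L[ℂ] K) :
    A.IsResolvent z R ↔ IsUnit (pencil R₀ z₀ z) ∧ R = transfer R₀ z₀ z * R₀ := by
  have key : ∀ x y : K, (y, x + z • y) ∈ A ↔ pencil R₀ z₀ z y = R₀ x := by
    intro x y
    have h1 := hA (x + (z - z₀) • y) y
    rw [show x + (z - z₀) • y + z₀ • y = x + z • y by module] at h1
    rw [h1, pencil_apply, map_add, map_smul, sub_eq_iff_eq_add]
  constructor
  · intro hR
    have h1 : ∀ x, pencil R₀ z₀ z (R x) = R₀ x := fun x => (key x _).mp ((hR x _).mpr rfl)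
    have h2 : pencil R₀ z₀ z * (1 + (z - z₀) • R) = 1 := by
      ext x
      rw [mul_apply_eq_comp, _root_.add_apply, map_add, _root_.smul_apply, map_smul, h1]
      simp [pencil_apply]
    have h3 : IsUnit (pencil R₀ z₀ z) := by
      refine isUnit_of_mul_eq_one_of_injective h2 fun x hx => ?_
      have := (hR 0 x).mp ((key 0 x).mpr (by rw [hx, map_zero]))
      rwa [map_zero] at this
    refine ⟨h3, ?_⟩
    have h4 : pencil R₀ z₀ z * R = R₀ := ContinuousLinearMap.ext h1
    calc R = transfer R₀ z₀ z * pencil R₀ z₀ z * R := by rw [transfer_mul_pencil h3, one_mul]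
      _ = _ := by rw [mul_assoc, h4]
  · rintro ⟨h, rfl⟩ x y
    rw [key]
    constructor
    · intro h1
      rw [mul_apply_eq_comp, ← h1, ← mul_apply_eq_comp, transfer_mul_pencil h]; rfl
    · rintro rfl
      rw [mul_apply_eq_comp, pencil_transfer_apply h]

theorem differentiable_pencil : Differentiable ℂ (pencil R₀ z₀) := by
  unfold pencil
  fun_prop

theorem analyticAt_transfer [CompleteSpace K] (h : IsUnit (pencil R₀ z₀ z)) :
    AnalyticAt ℂ (transfer R₀ z₀) z :=
  analyticAt_ringInverse (differentiable_pencil.analyticAt z) h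

/-- Partial fractions: the pencil is affine in its parameter, so at conj w it is an affine
combination of its values at z and w, each cancelling one transfer factor. -/
theorem cayley_mul_transfer (hz : IsUnit (pencil R₀ z₀ z)) (hw : IsUnit (pencil R₀ z₀ w))
    (hne : z ≠ w) : ∃ a b : ℂ, cayley R₀ z₀ w * transfer R₀ z₀ z =
      a • transfer R₀ z₀ w + b • transfer R₀ z₀ z := by
  have hsub : z - w ≠ 0 := sub_ne_zero.mpr hne
  set a : ℂ := (conj w - w) / (z - w) with ha
  have h1 : pencil R₀ z₀ (conj w) = a • pencil R₀ z₀ z + (1 - a) • pencil R₀ z₀ w := by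
    have : conj w = a * z + (1 - a) * w := by rw [ha]; field_simp; ring
    unfold pencil
    rw [this]
    module
  refine ⟨a, 1 - a, ?_⟩
  have hc : Commute (pencil R₀ z₀ w) (transfer R₀ z₀ w) :=
    (pencil_mul_transfer hw).trans (transfer_mul_pencil hw).symm
  have hc2 : Commute (pencil R₀ z₀ z) (transfer R₀ z₀ w) :=
    commute_transfer ((commute_pencil (Commute.refl R₀)).symm)
  rw [cayley, h1, add_mul, add_mul, smul_mul_assoc, smul_mul_assoc, smul_mul_assoc, smul_mul_assoc,
    pencil_mul_transfer hw, one_mul, hc2.eq, mul_assoc, pencil_mul_transfer hz, mul_one]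

theorem norm_sub_lt_norm_sub_conj (hz : 0 < z.im) (hw : 0 < w.im) :
    ‖z - w‖ < ‖z - conj w‖ := by
  rw [← sq_lt_sq₀ (norm_nonneg _) (norm_nonneg _), ← Complex.normSq_eq_norm_sq,
    ← Complex.normSq_eq_norm_sq, Complex.normSq_apply, Complex.normSq_apply]
  simp only [Complex.sub_re, Complex.sub_im, Complex.conj_re, Complex.conj_im]
  nlinarith [mul_pos hz hw]

theorem dense_of_mem_codiscreteWithin {D : Set ℂ}
    (hD : D ∈ codiscreteWithin {z : ℂ | z.im ≠ 0}) : Dense (D ∩ {z : ℂ | z.im ≠ 0}) := by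
  have ho : IsOpen {z : ℂ | z.im ≠ 0} := isOpen_ne_fun Complex.continuous_im continuous_const
  have h1 : {z : ℂ | z.im ≠ 0} ⊆ closure (D ∩ {z : ℂ | z.im ≠ 0}) := by
    intro z hz
    rw [mem_codiscreteWithin_iff_forall_mem_nhdsNE] at hD
    have h2 : D ∩ {z : ℂ | z.im ≠ 0} ∈ 𝓝[≠] z := by
      filter_upwards [hD z hz, nhdsWithin_le_nhds (ho.mem_nhds hz)] with w hw1 hw2
      exact ⟨hw1.resolve_right (fun h => h hw2), hw2⟩
    exact mem_closure_iff_frequently.mpr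
      ((Eventually.frequently h2).filter_mono nhdsWithin_le_nhds)
  have h2 : Dense {z : ℂ | z.im ≠ 0} := by
    rw [Metric.dense_iff]
    intro z r hr
    by_cases hz : z.im = 0
    · refine ⟨z + (r / 2 : ℝ) * Complex.I, ?_, ?_⟩
      · rw [Metric.mem_ball, dist_eq_norm, add_sub_cancel_left, norm_mul, Complex.norm_I,
          Complex.norm_real, Real.norm_of_nonneg (by positivity)]
        linarith
      · simp [hz, hr.ne']
    · exact ⟨z, Metric.mem_ball_self hr, hz⟩
  intro z
  exact closure_minimal h1 isClosed_closure (h2 z)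

theorem isUnit_const_smul_iff {c : ℂ} (hc : c ≠ 0) {T : K →L[ℂ] K} : IsUnit (c • T) ↔ IsUnit T :=
  isUnit_smul_iff (Units.mk0 c hc) T

theorem inverse_smul {c : ℂ} (hc : c ≠ 0) {T : K →L[ℂ] K} (hT : IsUnit T) :
    Ring.inverse (c • T) = c⁻¹ • Ring.inverse T := by
  refine inverse_eq_of_mul_eq_one ?_ ?_
  · exact (isUnit_const_smul_iff hc).mpr hT
  · rw [smul_mul_smul_comm, Ring.mul_inverse_cancel _ hT, mul_inv_cancel₀ hc, one_smul]

end Pencil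

/-! ### Minimal models: isometries, negative vectors from the upper half-plane, meromorphy. -/

section Model

variable {H : Type*} [NormedAddCommGroup H] [InnerProductSpace ℂ H]
variable {K : Type*} [NormedAddCommGroup K] [NormedSpace ℂ K]

/-- The data of a minimal triplet, with the relation `A` replaced by its resolvent `R₀` at `z₀`. -/
structure IsModel (κ : ℕ) (B : SesqForm K) (R₀ : K →L[ℂ] K) (Γ : H →L[ℂ] K) (z₀ : ℂ)
    (D : Set ℂ) : Prop where
  pontryagin : IsPontryagin B κ
  adj : ∀ x y, (z₀ - conj z₀) * B (R₀ x) (R₀ y) = B x (R₀ y) - B (R₀ x) y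
  im_pos : 0 < z₀.im
  mem : z₀ ∈ D
  codiscrete : D ∈ codiscreteWithin {z : ℂ | z.im ≠ 0}
  conj_mem : ∀ z ∈ D, conj z ∈ D
  isUnit : ∀ z ∈ D, IsUnit (pencil R₀ z₀ z)
  minimal : (Submodule.span ℂ {x : K | ∃ (z : ℂ) (h : H), IsUnit (pencil R₀ z₀ z) ∧
    x = transfer R₀ z₀ z (Γ h)}).topologicalClosure = ⊤

variable {κ : ℕ} {B : SesqForm K} {R₀ : K →L[ℂ] K} {Γ : H →L[ℂ] K} {z₀ : ℂ} {D : Set ℂ}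

/-- The span of the vectors `(I + (z - z₀) (A - z)⁻¹) Γ h` with `z ∈ S`. -/
def transferSpan (R₀ : K →L[ℂ] K) (Γ : H →L[ℂ] K) (z₀ : ℂ) (S : Set ℂ) : Submodule ℂ K :=
  Submodule.span ℂ {x : K | ∃ z ∈ S, ∃ h : H, x = transfer R₀ z₀ z (Γ h)}

theorem mem_transferSpan {S : Set ℂ} {z : ℂ} (hz : z ∈ S) (h : H) :
    transfer R₀ z₀ z (Γ h) ∈ transferSpan R₀ Γ z₀ S :=
  Submodule.subset_span ⟨z, hz, h, rfl⟩

theorem setOf_resolvent_eq {A : LinRel K} (hA : A.IsResolvent z₀ R₀) :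
    {x : K | ∃ (z : ℂ) (R : K →L[ℂ] K) (h : H), A.IsResolvent z R ∧
      x = (ContinuousLinearMap.id ℂ K + (z - z₀) • R) (Γ h)} =
    {x : K | ∃ (z : ℂ) (h : H), IsUnit (pencil R₀ z₀ z) ∧ x = transfer R₀ z₀ z (Γ h)} := by
  ext x
  constructor
  · rintro ⟨z, R, h, hR, rfl⟩
    obtain ⟨hu, rfl⟩ := (isResolvent_iff hA z R).mp hR
    exact ⟨z, h, hu, by
      conv_rhs => rw [transfer_eq hu]
      rfl⟩
  · rintro ⟨z, h, hu, rfl⟩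
    exact ⟨z, _, h, (isResolvent_iff hA z _).mpr ⟨hu, rfl⟩, by
      conv_lhs => rw [transfer_eq hu]
      rfl⟩

/-- Substituting x = pencil(w) x' and y = pencil(z) y' leaves a scalar multiple of `hadj`. The right
side is what the kernel numerator of Q produces, so this is the source of the Gram structure. -/
theorem form_transfer (hadj : ∀ x y, (z₀ - conj z₀) * B (R₀ x) (R₀ y) = B x (R₀ y) - B (R₀ x) y)
    {z w : ℂ} (hz : IsUnit (pencil R₀ z₀ z)) (hw : IsUnit (pencil R₀ z₀ w)) (x y : K) :
    (z - conj w) * B (transfer R₀ z₀ w x) (transfer R₀ z₀ z y) =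
      -(z₀ - conj z₀) * B x y + (z - conj z₀) * B x (transfer R₀ z₀ z y) -
        (conj w - z₀) * B (transfer R₀ z₀ w x) y := by
  set x' := transfer R₀ z₀ w x with hx
  set y' := transfer R₀ z₀ z y with hy
  have h1 : x = x' - (w - z₀) • R₀ x' := by rw [hx, ← pencil_apply, pencil_transfer_apply hw]
  have h2 : y = y' - (z - z₀) • R₀ y' := by rw [hy, ← pencil_apply, pencil_transfer_apply hz]
  rw [h1, h2]
  simp only [map_sub, map_smul, _root_.sub_apply, form_smul_left, smul_eq_mul]
  have h3 := hadj x' y'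
  linear_combination ((conj w - conj z₀) * (z - z₀)) * h3

theorem form_cayley (hadj : ∀ x y, (z₀ - conj z₀) * B (R₀ x) (R₀ y) = B x (R₀ y) - B (R₀ x) y)
    {w : ℂ} (hw : IsUnit (pencil R₀ z₀ w)) (x y : K) :
    B (cayley R₀ z₀ w x) (cayley R₀ z₀ w y) = B x y := by
  obtain ⟨x', hx⟩ : ∃ x', x' = transfer R₀ z₀ w x := ⟨_, rfl⟩
  obtain ⟨y', hy⟩ : ∃ y', y' = transfer R₀ z₀ w y := ⟨_, rfl⟩
  have h1 : x = x' - (w - z₀) • R₀ x' := by rw [hx, ← pencil_apply, pencil_transfer_apply hw]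
  have h2 : y = y' - (w - z₀) • R₀ y' := by rw [hy, ← pencil_apply, pencil_transfer_apply hw]
  rw [cayley, mul_apply_eq_comp, mul_apply_eq_comp, ← hx, ← hy, pencil_apply, pencil_apply, h1, h2]
  simp only [map_sub, map_smul, _root_.sub_apply, form_smul_left, smul_eq_mul, Complex.conj_conj]
  have h3 := hadj x' y'
  linear_combination (-(w - conj w)) * h3

namespace IsModel

variable (m : IsModel κ B R₀ Γ z₀ D)
include m

theorem completeSpace : CompleteSpace K := m.pontryagin.complete

theorem ne_conj : z₀ - conj z₀ ≠ 0 := by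
  intro h
  have := congrArg Complex.im h
  simp at this
  linarith [m.im_pos]

/-- The transfer vectors depend continuously on the resolvent point, and the nonreal points of D are
dense in ℂ. -/
theorem topologicalClosure_transferSpan :
    (transferSpan R₀ Γ z₀ (D ∩ {z : ℂ | z.im ≠ 0})).topologicalClosure = ⊤ := by
  have := m.completeSpace
  rw [eq_top_iff, ← m.minimal]
  refine Submodule.topologicalClosure_minimal _ ?_ (Submodule.isClosed_topologicalClosure _)
  rw [Submodule.span_le]
  rintro _ ⟨z, h, hz, rfl⟩
  have h1 : ContinuousAt (fun w => transfer R₀ z₀ w (Γ h)) z :=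
    (analyticAt_transfer hz).continuousAt.clm_apply continuousAt_const
  have h2 := mem_closure_image h1 (dense_of_mem_codiscreteWithin m.codiscrete z)
  refine closure_mono ?_ h2
  rintro _ ⟨w, hw, rfl⟩
  exact mem_transferSpan hw h

/-- On transfer vectors with z ≠ w this is `cayley_mul_transfer`; z = w is a limit of that case,
which is why the closure is needed. -/
theorem cayley_mem {w : ℂ} (hw : w ∈ D ∩ {z : ℂ | 0 < z.im}) {x : K}
    (hx : x ∈ (transferSpan R₀ Γ z₀ (D ∩ {z : ℂ | 0 < z.im})).topologicalClosure) :
    cayley R₀ z₀ w x ∈ (transferSpan R₀ Γ z₀ (D ∩ {z : ℂ | 0 < z.im})).topologicalClosure := by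
  have := m.completeSpace
  set C := (transferSpan R₀ Γ z₀ (D ∩ {z : ℂ | 0 < z.im})).topologicalClosure with hC
  have hle : (transferSpan R₀ Γ z₀ (D ∩ {z : ℂ | 0 < z.im})) ≤ C :=
    Submodule.le_topologicalClosure _
  have hcl : IsClosed (C : Set K) := Submodule.isClosed_topologicalClosure _
  have hne : ∀ z ∈ D ∩ {z : ℂ | 0 < z.im}, z ≠ w → ∀ h : H,
      cayley R₀ z₀ w (transfer R₀ z₀ z (Γ h)) ∈ C := by
    intro z hz hzw h
    obtain ⟨a, b, hab⟩ := cayley_mul_transfer (m.isUnit z hz.1) (m.isUnit w hw.1) hzw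
    rw [← mul_apply_eq_comp, hab]
    exact C.add_mem (C.smul_mem _ (hle (mem_transferSpan hw h)))
      (C.smul_mem _ (hle (mem_transferSpan hz h)))
  have hself : ∀ h : H, cayley R₀ z₀ w (transfer R₀ z₀ w (Γ h)) ∈ C := by
    intro h
    have h1 : ContinuousAt (fun z => cayley R₀ z₀ w (transfer R₀ z₀ z (Γ h))) w :=
      (cayley R₀ z₀ w).continuous.continuousAt.comp
        ((analyticAt_transfer (m.isUnit w hw.1)).continuousAt.clm_apply continuousAt_const)
    have h2 : ∀ᶠ z in 𝓝[≠] w, cayley R₀ z₀ w (transfer R₀ z₀ z (Γ h)) ∈ C := by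
      have h3 := (mem_codiscreteWithin_iff_forall_mem_nhdsNE.mp m.codiscrete) w hw.2.ne'
      have h4 : {z : ℂ | 0 < z.im} ∈ 𝓝 w :=
        (isOpen_lt continuous_const Complex.continuous_im).mem_nhds hw.2
      filter_upwards [h3, nhdsWithin_le_nhds h4, self_mem_nhdsWithin] with z hz1 hz2 hz3
      refine hne z ⟨hz1.resolve_right fun hh => hh (ne_of_gt hz2), hz2⟩ hz3 h
    exact hcl.mem_of_tendsto (h1.tendsto.mono_left nhdsWithin_le_nhds) h2
  have hmap : transferSpan R₀ Γ z₀ (D ∩ {z : ℂ | 0 < z.im}) ≤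
      C.comap (cayley R₀ z₀ w : K →ₗ[ℂ] K) := by
    refine Submodule.span_le.mpr ?_
    rintro _ ⟨z, hz, h, rfl⟩
    by_cases hzw : z = w
    · rw [hzw]; exact hself h
    · exact hne z hz hzw h
  have h5 : IsClosed ((C.comap (cayley R₀ z₀ w : K →ₗ[ℂ] K) : Submodule ℂ K) : Set K) :=
    hcl.preimage (cayley R₀ z₀ w).continuous
  exact Submodule.topologicalClosure_minimal _ hmap h5 hx

/-- T is a product of Cayley transforms. The factor at w cancels pencil(conj w) and replaces it by
pencil(w); since all factors commute, it may act first, and the others preserve the closed upper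
span. -/
theorem exists_isometry (s : Finset ℂ) (hs : ∀ w ∈ s, w ∈ D ∩ {z : ℂ | 0 < z.im}) :
    ∃ T : K →L[ℂ] K, (∀ x y, B (T x) (T y) = B x y) ∧ Commute T R₀ ∧
      (∀ x ∈ (transferSpan R₀ Γ z₀ (D ∩ {z : ℂ | 0 < z.im})).topologicalClosure,
        T x ∈ (transferSpan R₀ Γ z₀ (D ∩ {z : ℂ | 0 < z.im})).topologicalClosure) ∧
      ∀ w ∈ s, ∀ h, T (transfer R₀ z₀ (conj w) (Γ h)) ∈
        (transferSpan R₀ Γ z₀ (D ∩ {z : ℂ | 0 < z.im})).topologicalClosure := by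
  classical
  induction s using Finset.induction_on with
  | empty => exact ⟨1, fun _ _ => rfl, Commute.one_left _, fun x hx => hx, by simp⟩
  | insert w s hws ih =>
    obtain ⟨T, hT1, hT2, hT3, hT4⟩ := ih fun z hz => hs z (Finset.mem_insert_of_mem hz)
    have hw := hs w (Finset.mem_insert_self w s)
    have hwu := m.isUnit w hw.1
    have hcw : Commute (cayley R₀ z₀ w) R₀ := (commute_cayley (Commute.refl R₀)).symm
    refine ⟨T * cayley R₀ z₀ w, fun x y => ?_, hT2.mul_left hcw, fun x hx => ?_,
      fun z hz h => ?_⟩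
    · rw [mul_apply_eq_comp, mul_apply_eq_comp, hT1, form_cayley m.adj hwu]
    · exact hT3 _ (m.cayley_mem hw hx)
    · rcases Finset.mem_insert.mp hz with rfl | hz
      · have hzu := m.isUnit _ (m.conj_mem z hw.1)
        have h1 : cayley R₀ z₀ z * transfer R₀ z₀ (conj z) = transfer R₀ z₀ z := by
          have hc : Commute (pencil R₀ z₀ (conj z)) (transfer R₀ z₀ z) :=
            commute_transfer ((commute_pencil (Commute.refl R₀)).symm)
          rw [cayley, hc.eq, mul_assoc, pencil_mul_transfer hzu, mul_one]
        rw [mul_apply_eq_comp, ← mul_apply_eq_comp (cayley R₀ z₀ z), h1]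
        exact hT3 _ (Submodule.le_topologicalClosure _ (mem_transferSpan hw h))
      · rw [(commute_cayley hT2).eq, mul_apply_eq_comp]
        exact m.cayley_mem hw (hT4 z hz h)

/-- The vectors belonging to the upper half-plane span a subspace containing a maximal negative
tuple. -/
theorem exists_isNegTuple : ∃ v : Fin κ → K, IsNegTuple B v ∧
    ∀ i, v i ∈ transferSpan R₀ Γ z₀ (D ∩ {z : ℂ | 0 < z.im}) := by
  classical
  obtain ⟨v, hv, hvm⟩ := m.pontryagin.exists_isNegTuple_of_dense
    (Submodule.dense_iff_topologicalClosure_eq_top.mpr m.topologicalClosure_transferSpan)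
  choose T hTS hTv using fun i => Submodule.mem_span_finite_of_mem_span (hvm i)
  set S := Finset.univ.biUnion T with hS
  have hSS : ∀ x ∈ S, ∃ z ∈ D ∩ {z : ℂ | z.im ≠ 0}, ∃ h : H, x = transfer R₀ z₀ z (Γ h) := by
    intro x hx
    obtain ⟨i, -, hi⟩ := Finset.mem_biUnion.mp hx
    exact hTS i hi
  choose! ζ hζ using hSS
  -- The reflections of those parameters that lie in the lower half-plane.
  set s := (S.image fun x => conj (ζ x)).filter fun z => 0 < z.im with hs
  obtain ⟨U, hU1, -, hU3, hU4⟩ := m.exists_isometry s (by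
    intro w hw
    obtain ⟨hw1, hw2⟩ := Finset.mem_filter.mp hw
    obtain ⟨x, hx, rfl⟩ := Finset.mem_image.mp hw1
    exact Set.mem_inter (m.conj_mem _ (hζ x hx).1.1) hw2)
  have hUS : ∀ x ∈ S, U x ∈
      (transferSpan R₀ Γ z₀ (D ∩ {z : ℂ | 0 < z.im})).topologicalClosure := by
    intro x hx
    obtain ⟨hz, h, hxh⟩ := hζ x hx
    rcases lt_or_gt_of_ne hz.2 with hlt | hgt
    · have h1 : conj (ζ x) ∈ s := Finset.mem_filter.mpr
        (And.intro (Finset.mem_image_of_mem (fun x => conj (ζ x)) hx) (by simpa using hlt))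
      have h2 := hU4 _ h1 h
      rw [Complex.conj_conj, ← hxh] at h2
      exact h2
    · refine hU3 x (Submodule.le_topologicalClosure _ ?_)
      rw [hxh]
      have h1 : ζ x ∈ D ∩ {z : ℂ | 0 < z.im} := ⟨hz.1, hgt⟩
      exact mem_transferSpan h1 h
  have hUv : ∀ i, U (v i) ∈ closure
      (transferSpan R₀ Γ z₀ (D ∩ {z : ℂ | 0 < z.im}) : Set K) := by
    intro i
    have h1 : Submodule.span ℂ (T i : Set K) ≤
        (transferSpan R₀ Γ z₀ (D ∩ {z : ℂ | 0 < z.im})).topologicalClosure.comap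
          (U : K →ₗ[ℂ] K) := by
      rw [Submodule.span_le]
      intro x hx
      exact hUS x (Finset.mem_biUnion.mpr ⟨i, Finset.mem_univ _, hx⟩)
    exact h1 (hTv i)
  exact (hv.comp_isometry (w := fun i => U (v i)) fun i j => hU1 _ _).exists_mem_of_mem_closure hUv

/-- The pencil is a Möbius image of the isometry U, the Cayley transform at z₀. In the lower
half-plane it is a multiple of U - l with |l| < 1; in the upper one the same holds for U⁻¹, up to
the factor U. -/
theorem meromorphicAt_transfer {z : ℂ} (hz : z.im ≠ 0) : MeromorphicAt (transfer R₀ z₀) z := by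
  have := m.completeSpace
  have hB := m.pontryagin.hermitian
  obtain ⟨v, hv⟩ := m.pontryagin.exists_isNegTuple
  obtain ⟨π, hf⟩ := m.pontryagin.exists_isFrame hv
  have hne := m.ne_conj
  set U := cayley R₀ z₀ z₀ with hU
  have hUp : U = pencil R₀ z₀ (conj z₀) := by rw [hU, cayley, transfer_self, mul_one]
  have hUu : IsUnit U := by rw [hUp]; exact m.isUnit _ (m.conj_mem _ m.mem)
  have hUf : ∀ x y, B (U x) (U y) = B x y :=
    form_cayley m.adj (by rw [pencil_self]; exact isUnit_one)
  have hpen : ∀ w, pencil R₀ z₀ w =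
      (z₀ - conj z₀)⁻¹ • ((w - conj z₀) • (1 : K →L[ℂ] K) - (w - z₀) • U) := by
    intro w
    rw [hUp, eq_inv_smul_iff₀ hne]
    unfold pencil
    module
  have hev : ∀ᶠ w in 𝓝[≠] z, IsUnit (pencil R₀ z₀ w) := by
    have h3 := (mem_codiscreteWithin_iff_forall_mem_nhdsNE.mp m.codiscrete) z hz
    have h4 : {w : ℂ | w.im ≠ 0} ∈ 𝓝 z :=
      (isOpen_ne_fun Complex.continuous_im continuous_const).mem_nhds hz
    filter_upwards [h3, nhdsWithin_le_nhds h4] with w hw1 hw2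
    exact m.isUnit w (hw1.resolve_right fun hh => hh hw2)
  have hconj : ∀ w : ℂ, 0 < w.im → w - conj z₀ ≠ 0 := by
    intro w hw h
    have := congrArg Complex.im h
    simp at this
    linarith [m.im_pos]
  have hlow : ∀ w : ℂ, w.im < 0 → w - z₀ ≠ 0 := by
    intro w hw h
    have := congrArg Complex.im h
    simp at this
    linarith [m.im_pos]
  rcases lt_or_gt_of_ne hz with hlt | hgt
  · let l : ℂ → ℂ := fun w => (w - conj z₀) / (w - z₀)
    have hl : AnalyticAt ℂ l z :=
      (analyticAt_id.sub analyticAt_const).div (analyticAt_id.sub analyticAt_const) (hlow z hlt)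
    have hlz : ‖l z‖ < 1 := by
      rw [norm_div, div_lt_one (norm_pos_iff.mpr (hlow z hlt))]
      have := norm_sub_lt_norm_sub_conj (z := conj z) (w := z₀) (by simpa using hlt) m.im_pos
      rw [← map_sub, Complex.norm_conj] at this
      rw [← Complex.norm_conj (z - conj z₀), map_sub, Complex.conj_conj]
      rwa [← Complex.norm_conj (conj z - z₀), map_sub, Complex.conj_conj,
        ← Complex.norm_conj (z - conj z₀), map_sub, Complex.conj_conj] at this
    have hfac : ∀ w : ℂ, w.im < 0 →
        pencil R₀ z₀ w = (-(w - z₀) / (z₀ - conj z₀)) • (U - l w • 1) := by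
      intro w hw
      have h1 : (w - conj z₀) = l w * (w - z₀) := (div_mul_cancel₀ _ (hlow w hw)).symm
      rw [hpen, h1, div_eq_inv_mul]
      module
    have hlt' : ∀ᶠ w in 𝓝[≠] z, w.im < 0 := nhdsWithin_le_nhds
      ((isOpen_lt Complex.continuous_im continuous_const).mem_nhds hlt)
    have hu : ∀ᶠ w in 𝓝[≠] z, IsUnit (U - l w • 1) := by
      filter_upwards [hev, hlt'] with w hw1 hw2
      rw [hfac w hw2] at hw1
      exact (isUnit_const_smul_iff (div_ne_zero (neg_ne_zero.mpr (hlow w hw2)) hne)).mp hw1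
    have hm := meromorphicAt_inverse_sub hf hB hUf hUu hl hlz hu
    have hs : MeromorphicAt (fun w : ℂ => (-(w - z₀) / (z₀ - conj z₀))⁻¹) z :=
      (((analyticAt_id.sub analyticAt_const).neg).div analyticAt_const hne).meromorphicAt.inv
    refine (hs.smul hm).congr ?_
    filter_upwards [hu, hlt'] with w hw1 hw2
    rw [transfer, hfac w hw2,
      inverse_smul (div_ne_zero (neg_ne_zero.mpr (hlow w hw2)) hne) hw1]
    rfl
  · let l : ℂ → ℂ := fun w => (w - z₀) / (w - conj z₀)
    obtain ⟨u, hu⟩ := hUu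
    have hl : AnalyticAt ℂ l z :=
      (analyticAt_id.sub analyticAt_const).div (analyticAt_id.sub analyticAt_const) (hconj z hgt)
    have hlz : ‖l z‖ < 1 := by
      rw [norm_div, div_lt_one (norm_pos_iff.mpr (hconj z hgt))]
      exact norm_sub_lt_norm_sub_conj hgt m.im_pos
    have hfac : ∀ w : ℂ, 0 < w.im →
        pencil R₀ z₀ w = ((w - conj z₀) / (z₀ - conj z₀)) •
          (u * ((↑u⁻¹ : K →L[ℂ] K) - l w • 1)) := by
      intro w hw
      have h1 : (w - z₀) = l w * (w - conj z₀) := (div_mul_cancel₀ _ (hconj w hw)).symm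
      have h2 : (u : K →L[ℂ] K) * ((↑u⁻¹ : K →L[ℂ] K) - l w • 1) = 1 - l w • U := by
        rw [mul_sub (u : K →L[ℂ] K), Units.mul_inv, mul_smul_comm, mul_one, hu]
      rw [hpen, h1, h2, div_eq_inv_mul]
      module
    have hgt' : ∀ᶠ w in 𝓝[≠] z, 0 < w.im := nhdsWithin_le_nhds
      ((isOpen_lt continuous_const Complex.continuous_im).mem_nhds hgt)
    have hu2 : ∀ᶠ w in 𝓝[≠] z, IsUnit ((↑u⁻¹ : K →L[ℂ] K) - l w • 1) := by
      filter_upwards [hev, hgt'] with w hw1 hw2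
      rw [hfac w hw2] at hw1
      have := (isUnit_const_smul_iff (div_ne_zero (hconj w hw2) hne)).mp hw1
      exact (Units.isUnit_units_mul u _).mp this
    have hinv : ∀ x y, B ((↑u⁻¹ : K →L[ℂ] K) x) ((↑u⁻¹ : K →L[ℂ] K) y) = B x y := by
      intro x y
      have h2 : ∀ y, U ((↑u⁻¹ : K →L[ℂ] K) y) = y := fun y => by
        rw [← hu, ← mul_apply_eq_comp, Units.mul_inv]; rfl
      rw [← hUf, h2, h2]
    have hm := meromorphicAt_inverse_sub hf hB hinv u⁻¹.isUnit hl hlz hu2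
    have hs : MeromorphicAt (fun w : ℂ => ((w - conj z₀) / (z₀ - conj z₀))⁻¹) z :=
      ((analyticAt_id.sub analyticAt_const).div analyticAt_const hne).meromorphicAt.inv
    have hm2 := hm.clm_apply ((ContinuousLinearMap.mul ℂ (K →L[ℂ] K)).flip (↑u⁻¹ : K →L[ℂ] K))
    refine (hs.smul hm2).congr ?_
    filter_upwards [hu2, hgt'] with w hw1 hw2
    rw [transfer, hfac w hw2, inverse_smul (div_ne_zero (hconj w hw2) hne) (u.isUnit.mul hw1),
      Ring.inverse_mul (Or.inl u.isUnit), Ring.inverse_unit]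
    rfl

end IsModel

end Model

/-! ### Gram matrices and negative tuples. -/

section Gram

variable {K : Type*} [NormedAddCommGroup K] [NormedSpace ℂ K] {B : SesqForm K}

/-- The kernel matrix has its indices reversed relative to a form that is conjugate-linear in the
first entry; hence the conjugated coefficients. -/
theorem quadForm_gram {n : ℕ} {M : Matrix (Fin n) (Fin n) ℂ} {x : Fin n → K}
    (hM : ∀ i j, M i j = B (x j) (x i)) (d : Fin n → ℂ) :
    star d ⬝ᵥ M.mulVec d = B (∑ i, conj (d i) • x i) (∑ i, conj (d i) • x i) := by
  rw [form_sum_left, Finset.sum_congr rfl fun i _ => by rw [map_sum, Finset.mul_sum],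
    Finset.sum_comm]
  simp only [dotProduct, Matrix.mulVec, Finset.mul_sum, hM, map_smul, smul_eq_mul,
    Complex.conj_conj, Pi.star_apply, Complex.star_def]
  exact Finset.sum_congr rfl fun i _ => Finset.sum_congr rfl fun j _ => by ring

theorem exists_isNegTuple_of_gram {n : ℕ} {M : Matrix (Fin n) (Fin n) ℂ} {x : Fin n → K}
    (hM : ∀ i j, M i j = B (x j) (x i)) (hH : M.IsHermitian) :
    ∃ v : Fin (Fintype.card {i // hH.eigenvalues i < 0}) → K, IsNegTuple B v := by
  obtain ⟨T, hT⟩ := exists_linearMap_neg hH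
  let e := (Fintype.equivFin {i // hH.eigenvalues i < 0}).symm
  refine ⟨fun j => ∑ i, conj (T (Pi.single (e j) 1) i) • x i, fun c hc => ?_⟩
  let a : {i // hH.eigenvalues i < 0} → ℂ := fun i => conj (c (e.symm i))
  have ha : a ≠ 0 := fun h0 => hc (funext fun j => by
    have := congrFun h0 (e j)
    simpa [a] using this)
  have h1 : T a = ∑ j, conj (c j) • T (Pi.single (e j) 1) := by
    conv_lhs => rw [← Finset.univ_sum_single a]
    rw [map_sum, ← e.sum_comp]
    refine Finset.sum_congr rfl fun j _ => ?_
    rw [← map_smul, ← Pi.single_smul]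
    simp [a]
  have h2 : ∑ j, c j • ∑ i, conj (T (Pi.single (e j) 1) i) • x i = ∑ i, conj (T a i) • x i := by
    simp only [h1, Finset.sum_apply, Pi.smul_apply, smul_eq_mul, map_sum, map_mul,
      Complex.conj_conj, Finset.sum_smul, Finset.smul_sum, smul_smul]
    exact Finset.sum_comm
  rw [h2, ← quadForm_gram hM]
  exact hT a ha

theorem le_card_neg_of_isNegTuple {n : ℕ} {M : Matrix (Fin n) (Fin n) ℂ} {x : Fin n → K}
    (hM : ∀ i j, M i j = B (x j) (x i)) (hH : M.IsHermitian) {k : ℕ} {v : Fin k → K}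
    (hv : IsNegTuple B v) (hvx : ∀ i, v i ∈ Submodule.span ℂ (Set.range x)) :
    k ≤ Fintype.card {i // hH.eigenvalues i < 0} := by
  choose a ha using fun i => (Submodule.mem_span_range_iff_exists_fun ℂ).mp (hvx i)
  let T : (Fin k → ℂ) →ₗ[ℂ] (Fin n → ℂ) :=
    Fintype.linearCombination ℂ fun i => fun j => conj (a i j)
  refine le_card_neg hH T fun d hd => ?_
  have h1 : ∑ j, conj (T d j) • x j = ∑ i, conj (d i) • v i := by
    simp only [T, Fintype.linearCombination_apply, Finset.sum_apply, Pi.smul_apply, smul_eq_mul,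
      map_sum, map_mul, Complex.conj_conj, Finset.sum_smul, ← ha, Finset.smul_sum, smul_smul]
    exact Finset.sum_comm
  rw [quadForm_gram hM, h1]
  refine hv (fun i => conj (d i)) fun h0 => hd (funext fun i => ?_)
  have := congrFun h0 i
  simpa using this

end Gram

/-! ### From minimal representations to generalized Nevanlinna functions and their index. -/

section Values

variable {H : Type*} [NormedAddCommGroup H] [InnerProductSpace ℂ H] [CompleteSpace H]
variable {K : Type*} [NormedAddCommGroup K] [NormedSpace ℂ K]

/-- The operator function represented by `R₀ = (A - z₀)⁻¹` and `Γ` with `Q(z₀)^* = S`. -/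
def reprVal (S : H →L[ℂ] H) (B : SesqForm K) (R₀ : K →L[ℂ] K) (Γ : H →L[ℂ] K) (z₀ z : ℂ) :
    H →L[ℂ] H :=
  S + (z - conj z₀) • (plus B Γ ∘L transfer R₀ z₀ z ∘L Γ)

variable {κ : ℕ} {B : SesqForm K} {R₀ : K →L[ℂ] K} {Γ : H →L[ℂ] K} {z₀ : ℂ} {S : H →L[ℂ] H}
  {Q : OpFun H}

theorem inner_reprVal (hB : ∀ x y, conj (B x y) = B y x) (z : ℂ) (g h : H) :
    inner ℂ g (reprVal S B R₀ Γ z₀ z h) =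
      inner ℂ g (S h) + (z - conj z₀) * B (Γ g) (transfer R₀ z₀ z (Γ h)) := by
  simp only [reprVal, _root_.add_apply, _root_.smul_apply, ContinuousLinearMap.comp_apply,
    inner_add_right, inner_smul_right, inner_plus hB]

/-- `hS` says that the value at z₀ is the adjoint of S, the only consistency condition on the
additive constant; the rest is `form_transfer`. -/
theorem inner_reprVal_sub_adjoint (hB : ∀ x y, conj (B x y) = B y x)
    (hadj : ∀ x y, (z₀ - conj z₀) * B (R₀ x) (R₀ y) = B x (R₀ y) - B (R₀ x) y)
    (hS : ContinuousLinearMap.adjoint S = S + (z₀ - conj z₀) • (plus B Γ ∘L Γ))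
    {z w : ℂ} (hz : IsUnit (pencil R₀ z₀ z)) (hw : IsUnit (pencil R₀ z₀ w)) (g h : H) :
    inner ℂ g ((reprVal S B R₀ Γ z₀ z -
      ContinuousLinearMap.adjoint (reprVal S B R₀ Γ z₀ w)) h) =
      (z - conj w) * B (transfer R₀ z₀ w (Γ g)) (transfer R₀ z₀ z (Γ h)) := by
  have h1 : inner ℂ g (ContinuousLinearMap.adjoint (reprVal S B R₀ Γ z₀ w) h) =
      inner ℂ g (ContinuousLinearMap.adjoint S h) +
        (conj w - z₀) * B (transfer R₀ z₀ w (Γ g)) (Γ h) := by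
    rw [ContinuousLinearMap.adjoint_inner_right, ContinuousLinearMap.adjoint_inner_right,
      ← inner_conj_symm, inner_reprVal hB, map_add, inner_conj_symm, map_mul, hB, map_sub,
      Complex.conj_conj]
  have h2 : inner ℂ g (ContinuousLinearMap.adjoint S h) =
      inner ℂ g (S h) + (z₀ - conj z₀) * B (Γ g) (Γ h) := by
    rw [hS]
    simp only [_root_.add_apply, _root_.smul_apply, ContinuousLinearMap.comp_apply,
      inner_add_right, inner_smul_right, inner_plus hB]
  rw [_root_.sub_apply, inner_sub_right, inner_reprVal hB, h1, h2, form_transfer hadj hz hw]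
  ring

theorem ne_conj_of_im_pos {z w : ℂ} (hz : 0 < z.im) (hw : 0 < w.im) : z - conj w ≠ 0 := by
  intro h
  have := congrArg Complex.im h
  simp at this
  linarith

theorem OpFun.negCount_eq_card (Q : OpFun H) {n : ℕ} (z : Fin n → ℂ) (h : Fin n → H) :
    Q.negCount z h =
      Fintype.card {i // (Q.kernelMatrix_isHermitian z h).eigenvalues i < 0} := by
  rw [← Nat.card_eq_fintype_card]
  rfl

namespace IsModel

variable (m : IsModel κ B R₀ Γ z₀ Q.dom)
include m

theorem kernelMatrix_apply
    (hS : ContinuousLinearMap.adjoint S = S + (z₀ - conj z₀) • (plus B Γ ∘L Γ))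
    (hQ : ∀ z ∈ Q.dom, Q.val z = reprVal S B R₀ Γ z₀ z) {n : ℕ} {z : Fin n → ℂ} {h : Fin n → H}
    (hz : ∀ i, z i ∈ Q.dom ∧ 0 < (z i).im) (i j : Fin n) :
    Q.kernelMatrix z h i j =
      B (transfer R₀ z₀ (z j) (Γ (h j))) (transfer R₀ z₀ (z i) (Γ (h i))) := by
  have hne := ne_conj_of_im_pos (hz i).2 (hz j).2
  rw [OpFun.kernelMatrix, Matrix.of_apply, OpFun.kernel, _root_.smul_apply, inner_smul_right,
    hQ _ (hz i).1, hQ _ (hz j).1, inner_reprVal_sub_adjoint m.pontryagin.hermitian m.adj hS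
    (m.isUnit _ (hz i).1) (m.isUnit _ (hz j).1), inv_mul_cancel_left₀ hne]

/-- Kernel matrices are Gram matrices in K, so κ bounds their negative eigenvalues. The bound is
attained because a negative κ-tuple lies in the span of finitely many upper half-plane vectors. -/
theorem isGenNevanlinna (ho : IsOpen Q.dom)
    (hS : ContinuousLinearMap.adjoint S = S + (z₀ - conj z₀) • (plus B Γ ∘L Γ))
    (hQ : ∀ z ∈ Q.dom, Q.val z = reprVal S B R₀ Γ z₀ z) : Q.IsGenNevanlinna κ := by
  have := m.completeSpace
  have hB := m.pontryagin.hermitian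
  let L : (K →L[ℂ] K) →L[ℂ] (H →L[ℂ] H) :=
    (ContinuousLinearMap.compL ℂ H K H (plus B Γ)).comp
      ((ContinuousLinearMap.compL ℂ H K K).flip Γ)
  have hle : ∀ (n : ℕ) (z : Fin n → ℂ) (h : Fin n → H),
      (∀ i, z i ∈ Q.dom ∧ 0 < (z i).im) → Q.negCount z h ≤ κ := by
    intro n z h hz
    rw [OpFun.negCount_eq_card]
    obtain ⟨v, hv⟩ := exists_isNegTuple_of_gram (m.kernelMatrix_apply hS hQ hz (h := h))
      (Q.kernelMatrix_isHermitian z h)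
    exact m.pontryagin.le_of_isNegTuple hv
  refine ⟨ho, ?_, m.codiscrete, ?_, fun z hz => ⟨m.conj_mem z hz, ?_⟩, hle, ?_⟩
  · intro z hz
    have h1 : DifferentiableAt ℂ (fun w => S + (w - conj z₀) • L (transfer R₀ z₀ w)) z :=
      (differentiableAt_const S).add (((differentiableAt_id).sub_const _).smul
        (L.differentiableAt.comp z (analyticAt_transfer (m.isUnit z hz)).differentiableAt))
    exact (h1.differentiableWithinAt).congr (fun w hw => hQ w hw) (hQ z hz)
  · intro z hz
    have h1 : MeromorphicAt (fun w => S + (w - conj z₀) • L (transfer R₀ z₀ w)) z :=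
      (MeromorphicAt.const S z).add
        (((MeromorphicAt.id z).sub (MeromorphicAt.const _ z)).smul
          ((m.meromorphicAt_transfer hz).clm_apply L))
    refine h1.congr ?_
    have h3 := (mem_codiscreteWithin_iff_forall_mem_nhdsNE.mp m.codiscrete) z hz
    have h4 : {w : ℂ | w.im ≠ 0} ∈ 𝓝 z :=
      (isOpen_ne_fun Complex.continuous_im continuous_const).mem_nhds hz
    filter_upwards [h3, nhdsWithin_le_nhds h4] with w hw1 hw2
    exact (hQ w (hw1.resolve_right fun hh => hh hw2)).symm
  · have h1 := hQ z hz
    have h2 := hQ _ (m.conj_mem z hz)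
    refine ContinuousLinearMap.ext fun h => ext_inner_left ℂ fun g => ?_
    -- At w = conj z the factor z - conj w vanishes, which is the symmetry of Q.
    have h3 := inner_reprVal_sub_adjoint hB m.adj hS (m.isUnit z hz)
      (m.isUnit _ (m.conj_mem z hz)) g h
    rw [Complex.conj_conj, sub_self, zero_mul, ← h1, ← h2, _root_.sub_apply, inner_sub_right,
      sub_eq_zero] at h3
    exact h3.symm
  · classical
    obtain ⟨v, hv, hvm⟩ := m.exists_isNegTuple
    choose T hTS hTv using fun i => Submodule.mem_span_finite_of_mem_span (hvm i)
    set U := Finset.univ.biUnion T with hU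
    have hUS : ∀ x : U, ∃ z ∈ Q.dom ∩ {z : ℂ | 0 < z.im}, ∃ h : H,
        (x : K) = transfer R₀ z₀ z (Γ h) := by
      intro x
      obtain ⟨i, -, hi⟩ := Finset.mem_biUnion.mp x.2
      exact hTS i hi
    choose ζ hζ h hh using hUS
    let e := U.equivFin.symm
    have hz : ∀ i, ζ (e i) ∈ Q.dom ∧ 0 < (ζ (e i)).im := fun i => hζ (e i)
    refine ⟨U.card, fun i => ζ (e i), fun i => h (e i), hz, le_antisymm (hle _ _ _ hz) ?_⟩
    rw [OpFun.negCount_eq_card]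
    refine le_card_neg_of_isNegTuple (m.kernelMatrix_apply hS hQ hz (h := fun i => h (e i)))
      _ hv fun i => ?_
    refine Submodule.span_mono ?_ (hTv i)
    intro x hx
    have hxU : x ∈ U := Finset.mem_biUnion.mpr ⟨i, Finset.mem_univ _, hx⟩
    refine ⟨e.symm ⟨x, hxU⟩, ?_⟩
    change transfer R₀ z₀ (ζ (e (e.symm ⟨x, hxU⟩))) (Γ (h (e (e.symm ⟨x, hxU⟩)))) = x
    rw [e.apply_symm_apply, ← hh]

end IsModel

theorem OpFun.IsGenNevanlinna.index_unique {κ' : ℕ} (h : Q.IsGenNevanlinna κ)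
    (h' : Q.IsGenNevanlinna κ') : κ = κ' := by
  obtain ⟨n, z, x, hz, rfl⟩ := h.exists_negCount_eq
  obtain ⟨n', z', x', hz', rfl⟩ := h'.exists_negCount_eq
  exact le_antisymm (h'.negCount_le n z x hz) (h.negCount_le n' z' x' hz')

section Conversion

variable {A : LinRel K}

theorem LinRel.IsSelfAdj.adj_resolvent (hsa : A.IsSelfAdj B) (hA : A.IsResolvent z₀ R₀) (x y : K) :
    (z₀ - conj z₀) * B (R₀ x) (R₀ y) = B x (R₀ y) - B (R₀ x) y := by
  have h1 := (hsa _ _).mp ((hA y _).mpr rfl) _ _ ((hA x _).mpr rfl)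
  rw [map_add, _root_.add_apply, form_smul_left, map_add, form_smul_right] at h1
  linear_combination -h1

theorem IsMinimalRepresentation.exists_isModel (h : IsMinimalRepresentation κ B A Γ z₀ Q)
    (hD : Q.dom ∈ codiscreteWithin {z : ℂ | z.im ≠ 0}) (hc : ∀ z ∈ Q.dom, conj z ∈ Q.dom) :
    ∃ (R₀ : K →L[ℂ] K) (S : H →L[ℂ] H), A.IsResolvent z₀ R₀ ∧ IsModel κ B R₀ Γ z₀ Q.dom ∧
      ContinuousLinearMap.adjoint S = S + (z₀ - conj z₀) • (plus B Γ ∘L Γ) ∧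
      ∀ z ∈ Q.dom, Q.val z = reprVal S B R₀ Γ z₀ z := by
  obtain ⟨R₀, hR₀, h0⟩ := h.eq z₀ h.mem_dom
  have hval : ∀ z ∈ Q.dom, IsUnit (pencil R₀ z₀ z) ∧
      Q.val z = reprVal (ContinuousLinearMap.adjoint (Q.val z₀)) B R₀ Γ z₀ z := by
    intro z hz
    obtain ⟨R, hR, hRe⟩ := h.eq z hz
    obtain ⟨hu, rfl⟩ := (isResolvent_iff hR₀ z R).mp hR
    refine ⟨hu, hRe.trans ?_⟩
    rw [reprVal]
    conv_rhs => rw [transfer_eq hu]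
    rfl
  refine ⟨R₀, ContinuousLinearMap.adjoint (Q.val z₀), hR₀,
    ⟨h.pontryagin, h.selfAdj.adj_resolvent hR₀, h.im_pos, h.mem_dom, hD, hc,
      fun z hz => (hval z hz).1, ?_⟩, ?_, fun z hz => (hval z hz).2⟩
  · rw [← setOf_resolvent_eq hR₀]
    exact h.minimal
  · rw [ContinuousLinearMap.adjoint_adjoint]
    conv_lhs => rw [(hval z₀ h.mem_dom).2, reprVal, transfer_self]
    rfl

theorem IsModel.isMinimalRepresentation (m : IsModel κ B R₀ Γ z₀ Q.dom) (hsa : A.IsSelfAdj B)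
    (hA : A.IsResolvent z₀ R₀)
    (hS : ContinuousLinearMap.adjoint S = S + (z₀ - conj z₀) • (plus B Γ ∘L Γ))
    (hQ : ∀ z ∈ Q.dom, Q.val z = reprVal S B R₀ Γ z₀ z) :
    IsMinimalRepresentation κ B A Γ z₀ Q := by
  have h0 : ContinuousLinearMap.adjoint (Q.val z₀) = S := by
    rw [hQ _ m.mem, reprVal, transfer_self]
    change ContinuousLinearMap.adjoint (S + (z₀ - conj z₀) • (plus B Γ ∘L Γ)) = S
    rw [← hS, ContinuousLinearMap.adjoint_adjoint]
  refine ⟨⟨m.pontryagin, hsa, m.im_pos, m.mem, fun z hz => ?_⟩, ?_⟩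
  · refine ⟨_, (isResolvent_iff hA z _).mpr ⟨m.isUnit z hz, rfl⟩, ?_⟩
    rw [h0, hQ z hz, reprVal]
    conv_lhs => rw [transfer_eq (m.isUnit z hz)]
    rfl
  · rw [setOf_resolvent_eq hA]
    exact m.minimal

/-- The space of a minimal representation forces its own index on Q, and the number of negative
squares is unique. -/
theorem IsMinimalRepresentation.index_eq {κ' : ℕ} (h : IsMinimalRepresentation κ' B A Γ z₀ Q)
    (hQ : Q.IsGenNevanlinna κ) : κ = κ' := by
  obtain ⟨R₀, S, -, m, hS, hval⟩ := h.exists_isModel hQ.codiscrete_dom fun z hz => (hQ.symm z hz).1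
  exact hQ.index_unique (m.isGenNevanlinna hQ.isOpen_dom hS hval)

end Conversion

end Values

/-! ### Uniqueness of minimal representations. -/

section Uniqueness

variable {K K' : Type*} [NormedAddCommGroup K] [NormedSpace ℂ K] [NormedAddCommGroup K']
  [NormedSpace ℂ K'] {B : SesqForm K} {B' : SesqForm K'} {ι : Type*} {x : ι → K} {x' : ι → K'}

theorem form_linearCombination (h : ∀ i j, B' (x' i) (x' j) = B (x i) (x j)) (f g : ι →₀ ℂ) :
    B' (Finsupp.linearCombination ℂ x' f) (Finsupp.linearCombination ℂ x' g) =
      B (Finsupp.linearCombination ℂ x f) (Finsupp.linearCombination ℂ x g) := by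
  induction f using Finsupp.induction_linear with
  | zero => simp
  | add f₁ f₂ h₁ h₂ => simp only [map_add, _root_.add_apply, h₁, h₂]
  | single i a =>
    induction g using Finsupp.induction_linear with
    | zero => simp
    | add f₁ f₂ h₁ h₂ => simp only [map_add, h₁, h₂]
    | single j b =>
      simp only [Finsupp.linearCombination_single, form_smul_left, map_smul, h]

/-- The norm is controlled by the form and by finitely many products with a maximal negative tuple.
That tuple can be chosen in the dense span, so all these quantities can be computed, and bounded, in
K. -/
theorem norm_linearCombination_le {κ : ℕ} (hP : IsPontryagin B' κ)
    (hd : Dense (Submodule.span ℂ (Set.range x') : Set K'))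
    (h : ∀ i j, B' (x' i) (x' j) = B (x i) (x j)) :
    ∃ C : ℝ, ∀ f, ‖Finsupp.linearCombination ℂ x' f‖ ≤ C * ‖Finsupp.linearCombination ℂ x f‖ := by
  obtain ⟨v, hv, hvm⟩ := hP.exists_isNegTuple_of_dense hd
  obtain ⟨π, hf⟩ := hP.exists_isFrame hv
  obtain ⟨c, M, hc, hM, hest⟩ := hf.exists_estimate hP.hermitian
  choose g hg using fun i => (Finsupp.mem_span_range_iff_exists_finsupp).mp (hvm i)
  set s := ∑ i, ‖B‖ * ‖Finsupp.linearCombination ℂ x (g i)‖ with hs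
  have hs0 : 0 ≤ s := Finset.sum_nonneg fun _ _ => by positivity
  refine ⟨Real.sqrt ((‖B‖ + M * s ^ 2) / c), fun f => ?_⟩
  set y := Finsupp.linearCombination ℂ x f with hy
  refine abs_le_of_sq_le_sq' ?_ (by positivity) |>.2
  rw [mul_pow, Real.sq_sqrt (by positivity), div_mul_eq_mul_div, le_div_iff₀ hc, mul_comm]
  refine (hest _).trans ?_
  have h1 : ∑ i, ‖B' (v i) (Finsupp.linearCombination ℂ x' f)‖ ≤ s * ‖y‖ := by
    rw [hs, Finset.sum_mul]
    refine Finset.sum_le_sum fun i _ => ?_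
    have h2 : v i = Finsupp.linearCombination ℂ x' (g i) := (hg i).symm
    rw [h2, form_linearCombination h]
    exact norm_form_le _ _ _
  have h3 : (B' (Finsupp.linearCombination ℂ x' f) (Finsupp.linearCombination ℂ x' f)).re ≤
      ‖B‖ * ‖y‖ * ‖y‖ := by
    rw [form_linearCombination h]
    exact (Complex.re_le_norm _).trans (norm_form_le _ _ _)
  calc _ ≤ ‖B‖ * ‖y‖ * ‖y‖ + M * (s * ‖y‖) ^ 2 := by gcongr
    _ = _ := by ring

/-- Families with the same Gram matrix and dense spans in Pontryagin spaces are related by an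
isometric homeomorphism. -/
theorem exists_isometric_equiv {κ κ' : ℕ} (hP : IsPontryagin B κ) (hP' : IsPontryagin B' κ')
    (hd : Dense (Submodule.span ℂ (Set.range x) : Set K))
    (hd' : Dense (Submodule.span ℂ (Set.range x') : Set K'))
    (h : ∀ i j, B' (x' i) (x' j) = B (x i) (x j)) :
    ∃ U : K ≃L[ℂ] K', (∀ y z, B' (U y) (U z) = B y z) ∧ ∀ i, U (x i) = x' i := by
  have := hP.complete
  have := hP'.complete
  obtain ⟨C, hC⟩ := norm_linearCombination_le hP' hd' h
  obtain ⟨C', hC'⟩ := norm_linearCombination_le hP hd fun i j => (h i j).symm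
  have hr : DenseRange (Finsupp.linearCombination ℂ x) := by
    rw [DenseRange, ← LinearMap.coe_range, Finsupp.range_linearCombination]
    exact hd
  have hr' : DenseRange (Finsupp.linearCombination ℂ x') := by
    rw [DenseRange, ← LinearMap.coe_range, Finsupp.range_linearCombination]
    exact hd'
  let U : K ≃L[ℂ] K' := (LinearEquiv.refl ℂ (ι →₀ ℂ)).extend (Finsupp.linearCombination ℂ x)
    (Finsupp.linearCombination ℂ x') hr ⟨C, fun f => hC f⟩ hr' ⟨C', fun f => hC' f⟩
  have hU : ∀ f, U (Finsupp.linearCombination ℂ x f) = Finsupp.linearCombination ℂ x' f :=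
    fun f => LinearEquiv.extend_eq (LinearEquiv.refl ℂ (ι →₀ ℂ)) _ _ hr _ hr' _ f
  refine ⟨U, fun y z => ?_, fun i => by simpa using hU (Finsupp.single i 1)⟩
  refine DenseRange.induction_on₂ (p := fun y z => B' (U y) (U z) = B y z) hr ?_ ?_ y z
  · refine isClosed_eq ?_ ?_
    · exact (B'.continuous.comp (U.continuous.comp continuous_fst)).clm_apply
        (U.continuous.comp continuous_snd)
    · exact (B.continuous.comp continuous_fst).clm_apply continuous_snd
  · intro f g
    rw [hU, hU, form_linearCombination h]

theorem transfer_mul_resolvent {R₀ : K →L[ℂ] K} {z₀ z : ℂ} (hz : IsUnit (pencil R₀ z₀ z)) (y : K) :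
    (z - z₀) • R₀ (transfer R₀ z₀ z y) = transfer R₀ z₀ z y - y := by
  have h := pencil_transfer_apply hz y
  rw [pencil_apply, sub_eq_iff_eq_add'] at h
  exact eq_sub_of_add_eq h.symm

variable {H : Type*} [NormedAddCommGroup H] [InnerProductSpace ℂ H] [CompleteSpace H]

/-- Triplets minimally representing the same function are isomorphic. -/
theorem IsMinimalRepresentation.tripletIso {κ κ' κ'' : ℕ} {A : LinRel K} {A' : LinRel K'}
    {Γ : H →L[ℂ] K} {Γ' : H →L[ℂ] K'} {z₀ : ℂ} {Q : OpFun H} (hQ : Q.IsGenNevanlinna κ'')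
    (h : IsMinimalRepresentation κ B A Γ z₀ Q) (h' : IsMinimalRepresentation κ' B' A' Γ' z₀ Q) :
    TripletIso B A Γ B' A' Γ' := by
  obtain ⟨R, S, hA, m, hS, hval⟩ := h.exists_isModel hQ.codiscrete_dom fun z hz => (hQ.symm z hz).1
  obtain ⟨R', S', hA', m', hS', hval'⟩ :=
    h'.exists_isModel hQ.codiscrete_dom fun z hz => (hQ.symm z hz).1
  have := m.completeSpace
  have := m'.completeSpace
  have hB := m.pontryagin.hermitian
  have hB' := m'.pontryagin.hermitian
  set D := Q.dom ∩ {z : ℂ | z.im ≠ 0} with hD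
  have hnhds : ∀ z ∈ D, ∀ᶠ w in 𝓝[≠] z, w ∈ D := by
    intro z hz
    have h3 := (mem_codiscreteWithin_iff_forall_mem_nhdsNE.mp m.codiscrete) z hz.2
    have h4 : {w : ℂ | w.im ≠ 0} ∈ 𝓝 z :=
      (isOpen_ne_fun Complex.continuous_im continuous_const).mem_nhds hz.2
    filter_upwards [h3, nhdsWithin_le_nhds h4] with w hw1 hw2
    exact ⟨hw1.resolve_right fun hh => hh hw2, hw2⟩
  have hc : ∀ z ∈ D, ∀ h : H, ContinuousAt (fun w => transfer R z₀ w (Γ h)) z := fun z hz h =>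
    (analyticAt_transfer (m.isUnit z hz.1)).continuousAt.clm_apply continuousAt_const
  have hc' : ∀ z ∈ D, ∀ h : H, ContinuousAt (fun w => transfer R' z₀ w (Γ' h)) z := fun z hz h =>
    (analyticAt_transfer (m'.isUnit z hz.1)).continuousAt.clm_apply continuousAt_const
  -- Both Gram kernels, multiplied by z - conj w, equal the same expression in Q. At z = conj w the
  -- factor is lost and continuity in z takes over.
  have hgram : ∀ w ∈ D, ∀ z ∈ D, ∀ g h : H,
      B' (transfer R' z₀ w (Γ' g)) (transfer R' z₀ z (Γ' h)) =
        B (transfer R z₀ w (Γ g)) (transfer R z₀ z (Γ h)) := by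
    intro w hw
    have hne : ∀ z ∈ D, z ≠ conj w → ∀ g h : H,
        B' (transfer R' z₀ w (Γ' g)) (transfer R' z₀ z (Γ' h)) =
          B (transfer R z₀ w (Γ g)) (transfer R z₀ z (Γ h)) := by
      intro z hz hzw g h
      have h1 := inner_reprVal_sub_adjoint hB m.adj hS (m.isUnit z hz.1) (m.isUnit w hw.1) g h
      have h2 := inner_reprVal_sub_adjoint hB' m'.adj hS' (m'.isUnit z hz.1)
        (m'.isUnit w hw.1) g h
      rw [← hval _ hz.1, ← hval _ hw.1] at h1
      rw [← hval' _ hz.1, ← hval' _ hw.1, h1] at h2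
      exact (mul_left_cancel₀ (sub_ne_zero.mpr hzw) h2).symm
    intro z hz g h
    by_cases hzw : z = conj w
    · have h1 := ((B' (transfer R' z₀ w (Γ' g))).continuous.continuousAt.comp
        (hc' z hz h)).tendsto.mono_left (nhdsWithin_le_nhds (s := {z}ᶜ))
      have h2 := ((B (transfer R z₀ w (Γ g))).continuous.continuousAt.comp
        (hc z hz h)).tendsto.mono_left (nhdsWithin_le_nhds (s := {z}ᶜ))
      refine tendsto_nhds_unique_of_eventuallyEq h1 h2 ?_
      filter_upwards [hnhds z hz, self_mem_nhdsWithin] with u hu1 hu2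
      exact hne u hu1 (by rw [← hzw]; exact hu2) g h
    · exact hne z hz hzw g h
  let x : D × H → K := fun p => transfer R z₀ p.1 (Γ p.2)
  let x' : D × H → K' := fun p => transfer R' z₀ p.1 (Γ' p.2)
  have hd : Dense (Submodule.span ℂ (Set.range x) : Set K) := by
    rw [Submodule.dense_iff_topologicalClosure_eq_top, ← m.topologicalClosure_transferSpan]
    congr 2
    ext y
    constructor
    · rintro ⟨⟨z, h⟩, rfl⟩
      exact ⟨z, z.2, h, rfl⟩
    · rintro ⟨z, hz, h, rfl⟩
      exact ⟨(⟨z, hz⟩, h), rfl⟩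
  have hd' : Dense (Submodule.span ℂ (Set.range x') : Set K') := by
    rw [Submodule.dense_iff_topologicalClosure_eq_top, ← m'.topologicalClosure_transferSpan]
    congr 2
    ext y
    constructor
    · rintro ⟨⟨z, h⟩, rfl⟩
      exact ⟨z, z.2, h, rfl⟩
    · rintro ⟨z, hz, h, rfl⟩
      exact ⟨(⟨z, hz⟩, h), rfl⟩
  obtain ⟨U, hUB, hUx⟩ := exists_isometric_equiv m.pontryagin m'.pontryagin hd hd'
    fun p q => hgram p.1 p.1.2 q.1 q.1.2 p.2 q.2
  have hUt : ∀ z ∈ D, ∀ h, U (transfer R z₀ z (Γ h)) = transfer R' z₀ z (Γ' h) :=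
    fun z hz h => hUx (⟨z, hz⟩, h)
  have hz₀ : z₀ ∈ D := ⟨m.mem, m.im_pos.ne'⟩
  have hUΓ : ∀ h, U (Γ h) = Γ' h := fun h => by simpa using hUt z₀ hz₀ h
  -- (z - z₀) R₀ transfer(z) = transfer(z) - 1 expresses the resolvent through vectors that U is
  -- known to match; z = z₀ is again a limit.
  have hint : ∀ z ∈ D, ∀ h : H, U (R (transfer R z₀ z (Γ h))) = R' (U (transfer R z₀ z (Γ h))) := by
    have hne : ∀ z ∈ D, z ≠ z₀ → ∀ h : H,
        U (R (transfer R z₀ z (Γ h))) = R' (U (transfer R z₀ z (Γ h))) := by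
      intro z hz hzz h
      have h1 := congrArg U (transfer_mul_resolvent (m.isUnit z hz.1) (Γ h))
      have h2 := transfer_mul_resolvent (m'.isUnit z hz.1) (Γ' h)
      rw [map_smul, map_sub, hUt z hz, hUΓ, ← h2] at h1
      rw [hUt z hz]
      exact smul_right_injective _ (sub_ne_zero.mpr hzz) h1
    intro z hz h
    by_cases hzz : z = z₀
    · have h1 := (U.continuous.continuousAt.comp (R.continuous.continuousAt.comp
        (hc z hz h))).tendsto.mono_left (nhdsWithin_le_nhds (s := {z}ᶜ))
      have h2 := (R'.continuous.continuousAt.comp (U.continuous.continuousAt.comp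
        (hc z hz h))).tendsto.mono_left (nhdsWithin_le_nhds (s := {z}ᶜ))
      refine tendsto_nhds_unique_of_eventuallyEq h1 h2 ?_
      filter_upwards [hnhds z hz, self_mem_nhdsWithin] with u hu1 hu2
      exact hne u hu1 (by rw [← hzz]; exact hu2) h
    · exact hne z hz hzz h
  have hUR : ∀ y, U (R y) = R' (U y) := by
    have h1 : (U : K →L[ℂ] K').comp R = R'.comp (U : K →L[ℂ] K') := by
      refine ContinuousLinearMap.ext_on hd ?_
      rintro _ ⟨p, rfl⟩
      exact hint p.1 p.1.2 p.2
    exact fun y => congrArg (fun T : K →L[ℂ] K' => T y) h1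
  refine ⟨U, hUB, fun y z => ?_, fun h => (hUΓ h).symm⟩
  have h1 := hA (z - z₀ • y) y
  have h2 := hA' (U z - z₀ • U y) (U y)
  rw [sub_add_cancel] at h1 h2
  rw [h1, h2, ← map_smul, ← map_sub, ← hUR, U.injective.eq_iff]

end Uniqueness

/-! ### Direct sums of triplets. -/

section DirectSum

theorem norm_prod_sq_le {E F : Type*} [NormedAddCommGroup E] [NormedAddCommGroup F] (x : E × F) : ‖x‖ ^ 2 ≤ ‖x.1‖ ^ 2 + ‖x.2‖ ^ 2 := by
  rcases max_choice ‖x.1‖ ‖x.2‖ with h | h <;> rw [Prod.norm_def, h] <;>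
    nlinarith [sq_nonneg ‖x.1‖, sq_nonneg ‖x.2‖]
variable {H : Type*} [NormedAddCommGroup H] [InnerProductSpace ℂ H] [CompleteSpace H]
variable {K₁ K₂ : Type*} [NormedAddCommGroup K₁] [NormedSpace ℂ K₁] [NormedAddCommGroup K₂]
  [NormedSpace ℂ K₂] {B₁ : SesqForm K₁} {B₂ : SesqForm K₂}

theorem SesqForm.prod_apply (B₁ : SesqForm K₁) (B₂ : SesqForm K₂) (x y : K₁ × K₂) :
    B₁.prod B₂ x y = B₁ x.1 y.1 + B₂ x.2 y.2 := rfl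

theorem IsPontryagin.prod {κ₁ κ₂ : ℕ} (h₁ : IsPontryagin B₁ κ₁) (h₂ : IsPontryagin B₂ κ₂) :
    IsPontryagin (B₁.prod B₂) (κ₁ + κ₂) := by
  have := h₁.complete
  have := h₂.complete
  obtain ⟨P₁, N₁, hPN₁, ho₁, ⟨c₁, hc₁, hP₁, hN₁⟩, hf₁, hd₁⟩ := h₁.decomposition
  obtain ⟨P₂, N₂, hPN₂, ho₂, ⟨c₂, hc₂, hP₂, hN₂⟩, hf₂, hd₂⟩ := h₂.decomposition
  let e : N₁.prod N₂ ≃ₗ[ℂ] N₁ × N₂ :=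
    { toFun := fun x => (⟨x.1.1, x.2.1⟩, ⟨x.1.2, x.2.2⟩)
      invFun := fun x => ⟨(x.1, x.2), x.1.2, x.2.2⟩
      map_add' := fun _ _ => rfl
      map_smul' := fun _ _ => rfl
      left_inv := fun _ => rfl
      right_inv := fun _ => rfl }
  have hc : 0 < min c₁ c₂ := lt_min hc₁ hc₂
  have hnorm : ∀ (x : K₁ × K₂) (s t : ℝ), c₁ * ‖x.1‖ ^ 2 ≤ s → c₂ * ‖x.2‖ ^ 2 ≤ t →
      min c₁ c₂ * ‖x‖ ^ 2 ≤ s + t := by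
    intro x s t hs ht
    calc min c₁ c₂ * ‖x‖ ^ 2 ≤ min c₁ c₂ * (‖x.1‖ ^ 2 + ‖x.2‖ ^ 2) := by
          gcongr; exact norm_prod_sq_le x
      _ = min c₁ c₂ * ‖x.1‖ ^ 2 + min c₁ c₂ * ‖x.2‖ ^ 2 := by ring
      _ ≤ c₁ * ‖x.1‖ ^ 2 + c₂ * ‖x.2‖ ^ 2 := by
          gcongr
          · exact min_le_left _ _
          · exact min_le_right _ _
      _ ≤ s + t := add_le_add hs ht
  refine ⟨inferInstance, fun x y => ?_, P₁.prod P₂, N₁.prod N₂, ⟨?_, ?_⟩, fun x hx y hy => ?_,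
    ⟨min c₁ c₂, hc, fun x hx => ?_, fun x hx => ?_⟩, ?_, ?_⟩
  · rw [SesqForm.prod_apply, SesqForm.prod_apply, map_add, h₁.hermitian, h₂.hermitian]
  · rw [disjoint_iff, Submodule.prod_inf_prod, hPN₁.inf_eq_bot, hPN₂.inf_eq_bot,
      Submodule.prod_bot]
  · rw [codisjoint_iff, Submodule.prod_sup_prod, hPN₁.sup_eq_top, hPN₂.sup_eq_top,
      Submodule.prod_top]
  · rw [SesqForm.prod_apply, ho₁ _ hx.1 _ hy.1, ho₂ _ hx.2 _ hy.2, add_zero]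
  · rw [SesqForm.prod_apply, Complex.add_re]
    exact hnorm x _ _ (hP₁ _ hx.1) (hP₂ _ hx.2)
  · rw [SesqForm.prod_apply, Complex.add_re, neg_add]
    exact hnorm x _ _ (hN₁ _ hx.1) (hN₂ _ hx.2)
  · exact Module.Finite.equiv e.symm
  · rw [e.finrank_eq, Module.finrank_prod, hd₁, hd₂]

variable {A₁ : LinRel K₁} {A₂ : LinRel K₂}

theorem LinRel.mem_prod (x y : K₁ × K₂) :
    (x, y) ∈ A₁.prod A₂ ↔ (x.1, y.1) ∈ A₁ ∧ (x.2, y.2) ∈ A₂ := Iff.rfl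

theorem LinRel.IsSelfAdj.prod (h₁ : A₁.IsSelfAdj B₁) (h₂ : A₂.IsSelfAdj B₂) :
    (A₁.prod A₂).IsSelfAdj (B₁.prod B₂) := by
  intro x y
  constructor
  · rintro ⟨hx₁, hx₂⟩ u v ⟨hu₁, hu₂⟩
    rw [SesqForm.prod_apply, SesqForm.prod_apply]
    exact congrArg₂ _ ((h₁ _ _).mp hx₁ _ _ hu₁) ((h₂ _ _).mp hx₂ _ _ hu₂)
  · intro h
    refine ⟨(h₁ _ _).mpr fun u v huv => ?_, (h₂ _ _).mpr fun u v huv => ?_⟩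
    · have := h (u, 0) (v, 0) ⟨huv, A₂.zero_mem⟩
      simpa [SesqForm.prod_apply] using this
    · have := h (0, u) (0, v) ⟨A₁.zero_mem, huv⟩
      simpa [SesqForm.prod_apply] using this

theorem LinRel.IsResolvent.prod {z : ℂ} {R₁ : K₁ →L[ℂ] K₁} {R₂ : K₂ →L[ℂ] K₂}
    (h₁ : A₁.IsResolvent z R₁) (h₂ : A₂.IsResolvent z R₂) :
    (A₁.prod A₂).IsResolvent z (R₁.prodMap R₂) := by
  intro x y
  rw [LinRel.mem_prod, Prod.ext_iff]
  exact and_congr (h₁ x.1 y.1) (h₂ x.2 y.2)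

theorem plus_prod (h₁ : ∀ x y, conj (B₁ x y) = B₁ y x) (h₂ : ∀ x y, conj (B₂ x y) = B₂ y x)
    (Γ₁ : H →L[ℂ] K₁) (Γ₂ : H →L[ℂ] K₂) (k : K₁ × K₂) :
    plus (B₁.prod B₂) (Γ₁.prod Γ₂) k = plus B₁ Γ₁ k.1 + plus B₂ Γ₂ k.2 := by
  refine ext_inner_left ℂ fun g => ?_
  rw [inner_add_right, inner_plus h₁, inner_plus h₂, inner_plus]
  · rfl
  · intro x y
    rw [SesqForm.prod_apply, SesqForm.prod_apply, map_add, h₁, h₂]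

/-- Hahn-Banach in the quotient by the closed subspace. -/
theorem exists_functional_of_notMem {E : Type*} [NormedAddCommGroup E] [NormedSpace ℂ E]
    {p : Submodule ℂ E} (hp : IsClosed (p : Set E)) {x : E} (hx : x ∉ p) :
    ∃ f : E →L[ℂ] ℂ, f x ≠ 0 ∧ ∀ y ∈ p, f y = 0 := by
  have : IsClosed (p : Set E) := hp
  have h0 : ‖p.mkQ x‖ ≠ 0 := by
    rw [norm_ne_zero_iff]
    simpa using hx
  obtain ⟨g, -, hg⟩ := exists_dual_vector ℂ (p.mkQ x) h0
  refine ⟨g.comp p.mkQL, ?_, fun y hy => ?_⟩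
  · change g (p.mkQ x) ≠ 0
    rw [hg]
    exact Complex.ofReal_ne_zero.mpr h0
  · change g (p.mkQ y) = 0
    rw [show p.mkQ y = 0 from (Submodule.Quotient.mk_eq_zero p).mpr hy, map_zero]

/-- If `Γ⁺` is injective, the range of `Γ` is dense. -/
theorem IsPontryagin.dense_of_injective_plus {K : Type*} [NormedAddCommGroup K] [NormedSpace ℂ K]
    {B : SesqForm K} {κ : ℕ} (h : IsPontryagin B κ) {Γ : H →L[ℂ] K}
    (hΓ : ∀ k, plus B Γ k = 0 → k = 0) {L : Submodule ℂ K} (hL : ∀ g, Γ g ∈ L) :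
    L.topologicalClosure = ⊤ := by
  by_contra hne
  obtain ⟨x, hx⟩ : ∃ x, x ∉ L.topologicalClosure := by
    by_contra! hall
    exact hne ((Submodule.eq_top_iff').mpr hall)
  obtain ⟨f, hfx, hf⟩ := exists_functional_of_notMem L.isClosed_topologicalClosure hx
  obtain ⟨k, rfl⟩ := h.exists_riesz f
  have hk : k = 0 := by
    refine hΓ k (ext_inner_left ℂ fun g => ?_)
    rw [inner_plus h.hermitian, inner_zero_right]
    exact form_eq_zero_symm h.hermitian (hf _ (Submodule.le_topologicalClosure _ (hL g)))
  rw [hk, map_zero] at hfx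
  exact hfx rfl

/-- Only minimality needs an argument: the point z = z₀ already contributes the range of Γ, which is
dense because Γ⁺ = Γ₁⁺ + Γ₂⁺ is injective. -/
theorem IsMinimalRepresentation.prod {Γ₁ : H →L[ℂ] K₁} {Γ₂ : H →L[ℂ] K₂} {z₀ : ℂ}
    {Q Q₁ Q₂ : OpFun H} {κ₁ κ₂ : ℕ} (h₁ : IsMinimalRepresentation κ₁ B₁ A₁ Γ₁ z₀ Q₁)
    (h₂ : IsMinimalRepresentation κ₂ B₂ A₂ Γ₂ z₀ Q₂) (hQ : Q.IsSum Q₁ Q₂)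
    (hinj : Function.Injective fun k : K₁ × K₂ => plus B₁ Γ₁ k.1 + plus B₂ Γ₂ k.2) :
    IsMinimalRepresentation (κ₁ + κ₂) (B₁.prod B₂) (A₁.prod A₂) (Γ₁.prod Γ₂) z₀ Q := by
  have hP := h₁.pontryagin.prod h₂.pontryagin
  have hplus := plus_prod h₁.pontryagin.hermitian h₂.pontryagin.hermitian Γ₁ Γ₂
  have hmem : ∀ z ∈ Q.dom, z ∈ Q₁.dom ∧ z ∈ Q₂.dom := fun z hz => by rwa [hQ.1] at hz
  have hz₀ : z₀ ∈ Q.dom := by rw [hQ.1]; exact ⟨h₁.mem_dom, h₂.mem_dom⟩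
  refine ⟨⟨hP, h₁.selfAdj.prod h₂.selfAdj, h₁.im_pos, hz₀, fun z hz => ?_⟩, ?_⟩
  · obtain ⟨R₁, hR₁, he₁⟩ := h₁.eq z (hmem z hz).1
    obtain ⟨R₂, hR₂, he₂⟩ := h₂.eq z (hmem z hz).2
    refine ⟨R₁.prodMap R₂, hR₁.prod hR₂, ?_⟩
    rw [hQ.2 z hz, hQ.2 z₀ hz₀, he₁, he₂, map_add]
    ext g
    simp only [_root_.add_apply, _root_.smul_apply, ContinuousLinearMap.comp_apply, hplus]
    change _ = _ + _ + (z - conj z₀) • (plus B₁ Γ₁ (Γ₁ g + (z - z₀) • R₁ (Γ₁ g)) +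
      plus B₂ Γ₂ (Γ₂ g + (z - z₀) • R₂ (Γ₂ g)))
    rw [smul_add]
    exact add_add_add_comm _ _ _ _
  · refine hP.dense_of_injective_plus (Γ := Γ₁.prod Γ₂) (fun k hk => ?_) fun g => ?_
    · refine hinj (a₁ := k) (a₂ := 0) ?_
      change plus B₁ Γ₁ k.1 + plus B₂ Γ₂ k.2 = plus B₁ Γ₁ 0 + plus B₂ Γ₂ 0
      rw [← hplus, hk, map_zero, map_zero, add_zero]
    · obtain ⟨R₁, hR₁, -⟩ := h₁.eq z₀ h₁.mem_dom
      obtain ⟨R₂, hR₂, -⟩ := h₂.eq z₀ h₂.mem_dom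
      exact Submodule.subset_span ⟨z₀, _, g, hR₁.prod hR₂, by simp⟩

theorem OpFun.IsSum.isOpen_dom {Q Q₁ Q₂ : OpFun H} {κ₁ κ₂ : ℕ} (hQ : Q.IsSum Q₁ Q₂)
    (h₁ : Q₁.IsGenNevanlinna κ₁) (h₂ : Q₂.IsGenNevanlinna κ₂) : IsOpen Q.dom := by
  rw [hQ.1]
  exact h₁.isOpen_dom.inter h₂.isOpen_dom

end DirectSum

/-! ### Restricting a model to a reducing subspace. -/

section Reduction

variable {H : Type*} [NormedAddCommGroup H] [InnerProductSpace ℂ H]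
variable {K : Type*} [NormedAddCommGroup K] [NormedSpace ℂ K] {B : SesqForm K} {A : LinRel K}
  {L : Submodule ℂ K}

theorem SesqForm.restrict_apply (B : SesqForm K) (L : Submodule ℂ K) (x y : L) :
    B.restrict L x y = B x y := rfl

/-- `E` is an orthogonal projection onto `L`. -/
structure IsOrthProj (B : SesqForm K) (E : K →L[ℂ] L) : Prop where
  self : ∀ x : L, E x = x
  orth : ∀ (y : L) (x : K), B y x = B y (E x)

/-- `E` is an orthogonal projection that reduces `A`. -/
structure Reduces (B : SesqForm K) (A : LinRel K) (E : K →L[ℂ] L) : Prop extends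
    IsOrthProj B E where
  mem : ∀ x y, (x, y) ∈ A → ((E x : K), (E y : K)) ∈ A

theorem IsOrthProj.orth' {E : K →L[ℂ] L} (hE : IsOrthProj B E)
    (hB : ∀ x y, conj (B x y) = B y x) (x : K) (y : L) : B x y = B (E x) y := by
  rw [← hB, hE.orth, hB]

/-- For x in L the functional `B x` factors through E, so the restricted form stays bounded below.
Negative tuples in L have length at most κ, and one of maximal length yields a frame. -/
theorem IsOrthProj.isPontryagin_restrict {E : K →L[ℂ] L} (hE : IsOrthProj B E) {κ : ℕ}
    (h : IsPontryagin B κ) (hL : IsClosed (L : Set K)) :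
    ∃ κ', IsPontryagin (B.restrict L) κ' := by
  classical
  have := h.complete
  have hBL : ∀ x y, conj (B.restrict L x y) = B.restrict L y x := fun x y => h.hermitian _ _
  have hbdd : IsBddBelow (B.restrict L) := by
    obtain ⟨c, hc, hcB⟩ := h.isBddBelow
    refine ⟨c / (‖E‖ + 1), by positivity, fun x => ?_⟩
    have h1 : ‖B x‖ ≤ ‖B.restrict L x‖ * ‖E‖ := by
      refine ContinuousLinearMap.opNorm_le_bound _ (by positivity) fun y => ?_
      rw [hE.orth, ← SesqForm.restrict_apply, mul_assoc]
      exact ((B.restrict L x).le_opNorm _).trans (by gcongr; exact E.le_opNorm y)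
    have h2 := hcB x
    rw [div_mul_eq_mul_div, div_le_iff₀ (by positivity)]
    calc c * ‖x‖ ≤ ‖B x‖ := h2
      _ ≤ ‖B.restrict L x‖ * ‖E‖ := h1
      _ ≤ _ := by gcongr; linarith
  have hex : ∃ k, ∀ v : Fin k → L, ¬ IsNegTuple (B.restrict L) v := by
    refine ⟨κ + 1, fun v hv => ?_⟩
    have := h.le_of_isNegTuple (v := fun i => (v i : K)) (hv.comp_isometry fun _ _ => rfl)
    omega
  -- The least impossible length is positive because the empty tuple is negative vacuously; its
  -- predecessor k is the maximal length.
  obtain ⟨k, hk⟩ : ∃ k, Nat.find hex = k + 1 := by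
    refine Nat.exists_eq_succ_of_ne_zero fun h0 => ?_
    have := Nat.find_spec hex
    rw [h0] at this
    exact this (fun i => i.elim0) fun c hc => absurd (Subsingleton.elim c 0) hc
  have hmax : ∀ w : Fin (k + 1) → L, ¬ IsNegTuple (B.restrict L) w := by
    have := Nat.find_spec hex
    rwa [hk] at this
  have hmin : ∃ v : Fin k → L, IsNegTuple (B.restrict L) v := by
    have := Nat.find_min hex (m := k) (by omega)
    push Not at this
    exact this
  obtain ⟨v, hv⟩ := hmin
  obtain ⟨π, hf⟩ := hv.exists_isFrame hBL hbdd hmax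
  exact ⟨k, hf.isPontryagin hL.completeSpace_coe hBL⟩

/-- Addition and the pair of projections are isometries between K and the product of the summands,
so negative tuples pass both ways. -/
theorem IsPontryagin.add_eq {κ κ₁ κ₂ : ℕ} {L₁ L₂ : Submodule ℂ K} {E₁ : K →L[ℂ] L₁}
    {E₂ : K →L[ℂ] L₂} (h : IsPontryagin B κ)
    (h₁ : IsPontryagin (B.restrict L₁) κ₁) (h₂ : IsPontryagin (B.restrict L₂) κ₂)
    (horth : ∀ x ∈ L₁, ∀ y ∈ L₂, B x y = 0) (hsum : ∀ x : K, x = E₁ x + E₂ x) :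
    κ₁ + κ₂ = κ := by
  have hP := h₁.prod h₂
  have key : ∀ (a c : L₁) (b d : L₂), B (a + b : K) (c + d : K) = B a c + B b d := by
    intro a c b d
    simp only [map_add, _root_.add_apply, horth a a.2 d d.2,
      form_eq_zero_symm h.hermitian (horth c c.2 b b.2)]
    ring
  refine le_antisymm ?_ ?_
  · obtain ⟨v, hv⟩ := hP.exists_isNegTuple
    exact h.le_of_isNegTuple (v := fun i => ((v i).1 : K) + ((v i).2 : K))
      (hv.comp_isometry fun i j => key _ _ _ _)
  · obtain ⟨v, hv⟩ := h.exists_isNegTuple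
    refine hP.le_of_isNegTuple (v := fun i => (E₁ (v i), E₂ (v i))) (hv.comp_isometry fun i j => ?_)
    conv_rhs => rw [hsum (v i), hsum (v j), key]
    rfl

theorem Reduces.isSelfAdj_part {E : K →L[ℂ] L} (hE : Reduces B A E)
    (hB : ∀ x y, conj (B x y) = B y x) (hA : A.IsSelfAdj B) :
    (A.part L).IsSelfAdj (B.restrict L) := by
  intro x y
  constructor
  · intro hxy u v huv
    exact (hA _ _).mp hxy _ _ huv
  · intro h
    refine (hA _ _).mpr fun u v huv => ?_
    change B v x = B u y
    rw [hE.orth' hB v x, hE.orth' hB u y]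
    exact h _ _ (hE.mem _ _ huv)

theorem Reduces.apply_resolvent {E : K →L[ℂ] L} (hE : Reduces B A E) {z : ℂ} {R : K →L[ℂ] K}
    (hR : A.IsResolvent z R) (x : K) : (E (R x) : K) = R (E x) := by
  have h1 := hE.mem _ _ ((hR x _).mpr rfl)
  rw [map_add, map_smul] at h1
  exact (hR (E x) _).mp h1

/-- The compression of an operator by the projection `E` onto `L`. -/
def compress (E : K →L[ℂ] L) (R : K →L[ℂ] K) : L →L[ℂ] L := E.comp (R.comp L.subtypeL)

theorem Reduces.coe_compress {E : K →L[ℂ] L} (hE : Reduces B A E) {z : ℂ} {R : K →L[ℂ] K}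
    (hR : A.IsResolvent z R) (x : L) : (compress E R x : K) = R x := by
  change ((E (R x) : L) : K) = R x
  rw [hE.apply_resolvent hR, hE.self]

theorem Reduces.isResolvent_part {E : K →L[ℂ] L} (hE : Reduces B A E) {z : ℂ} {R : K →L[ℂ] K}
    (hR : A.IsResolvent z R) : (A.part L).IsResolvent z (compress E R) := by
  intro x y
  rw [← Subtype.coe_inj, hE.coe_compress hR]
  exact hR x y

variable {z₀ z : ℂ} {R₀ : K →L[ℂ] K}

theorem Reduces.isUnit_pencil {E : K →L[ℂ] L} (hE : Reduces B A E) (hR : A.IsResolvent z₀ R₀)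
    (hz : IsUnit (pencil R₀ z₀ z)) : IsUnit (pencil (compress E R₀) z₀ z) := by
  have h1 := hE.isResolvent_part ((isResolvent_iff hR z _).mpr ⟨hz, rfl⟩)
  exact ((isResolvent_iff (hE.isResolvent_part hR) z _).mp h1).1

theorem Reduces.apply_transfer {E : K →L[ℂ] L} (hE : Reduces B A E) (hR : A.IsResolvent z₀ R₀)
    (hz : IsUnit (pencil R₀ z₀ z)) (x : K) :
    E (transfer R₀ z₀ z x) = transfer (compress E R₀) z₀ z (E x) := by
  have hz' := hE.isUnit_pencil hR hz
  have h1 : ∀ y, E (pencil R₀ z₀ z y) = pencil (compress E R₀) z₀ z (E y) := by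
    intro y
    refine Subtype.ext ?_
    rw [pencil_apply, pencil_apply, map_sub, map_smul]
    push_cast
    rw [hE.apply_resolvent hR, hE.coe_compress hR]
  conv_rhs => rw [← pencil_transfer_apply hz x, h1, ← mul_apply_eq_comp, transfer_mul_pencil hz']
  rfl

/-- Minimality descends because E is continuous, surjective and takes transfer vectors to transfer
vectors, so it maps a dense span onto a dense set. -/
theorem Reduces.isModel {E : K →L[ℂ] L} (hE : Reduces B A E) {κ κ' : ℕ} {Γ : H →L[ℂ] K}
    {D : Set ℂ} (m : IsModel κ B R₀ Γ z₀ D) (hA : A.IsSelfAdj B) (hR : A.IsResolvent z₀ R₀)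
    (hP : IsPontryagin (B.restrict L) κ') :
    IsModel κ' (B.restrict L) (compress E R₀) (E.comp Γ) z₀ D := by
  refine ⟨hP, (hE.isSelfAdj_part m.pontryagin.hermitian hA).adj_resolvent
    (hE.isResolvent_part hR), m.im_pos, m.mem, m.codiscrete, m.conj_mem,
    fun z hz => hE.isUnit_pencil hR (m.isUnit z hz), ?_⟩
  have h1 := Submodule.dense_iff_topologicalClosure_eq_top.mpr m.minimal
  have hsurj : Function.Surjective E := fun x => ⟨x, hE.self x⟩
  rw [← Submodule.dense_iff_topologicalClosure_eq_top]
  refine (hsurj.denseRange.dense_image E.continuous h1).mono ?_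
  rw [← ContinuousLinearMap.coe_coe, ← Submodule.map_coe, Submodule.map_span]
  refine Submodule.span_mono ?_
  rintro _ ⟨_, ⟨z, h, hz, rfl⟩, rfl⟩
  exact ⟨z, h, hE.isUnit_pencil hR hz, hE.apply_transfer hR hz _⟩

end Reduction

/-! ### Invariant orthogonal sums reduce the relation. -/

section Splitting

variable {K : Type*} [NormedAddCommGroup K] [NormedSpace ℂ K] {B : SesqForm K} {A : LinRel K}
  {K₁ K₂ : Submodule ℂ K}

theorem IsOrthSum.symm (hB : ∀ x y, conj (B x y) = B y x) (h : IsOrthSum B K₁ K₂) :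
    IsOrthSum B K₂ K₁ :=
  ⟨h.1.symm, fun x hx y hy => form_eq_zero_symm hB (h.2 y hy x hx)⟩

/-- Nondegeneracy of K₂ identifies K₁ with the orthogonal complement of K₂, an intersection of
closed sets. -/
theorem IsOrthSum.isClosed (h : IsOrthSum B K₁ K₂) (h₂ : IsNondegenerate B K₂) :
    IsClosed (K₁ : Set K) := by
  have : (K₁ : Set K) = ⋂ y ∈ K₂, {x | B x y = 0} := by
    ext x
    simp only [SetLike.mem_coe, Set.mem_iInter, Set.mem_ofPred_eq]
    refine ⟨fun hx y hy => h.2 x hx y hy, fun hx => ?_⟩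
    obtain ⟨a, ha, b, hb, rfl⟩ := Submodule.mem_sup.mp (h.1.sup_eq_top.symm ▸ Submodule.mem_top :
      x ∈ K₁ ⊔ K₂)
    have hb0 : b = 0 := h₂ b hb fun y hy => by
      have := hx y hy
      rwa [map_add, _root_.add_apply, h.2 a ha y hy, zero_add] at this
    rwa [hb0, add_zero]
  rw [this]
  refine isClosed_biInter fun y _ => isClosed_eq ?_ continuous_const
  exact B.continuous.clm_apply continuous_const

theorem LinRel.SplitsDom.symm (h : A.SplitsDom K₁ K₂) : A.SplitsDom K₂ K₁ := by
  rw [LinRel.SplitsDom, sup_comm]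
  exact h

theorem IsOrthSum.exists_reduces [CompleteSpace K] (hB : ∀ x y, conj (B x y) = B y x)
    (h : IsOrthSum B K₁ K₂) (h₁ : IsNondegenerate B K₁) (h₂ : IsNondegenerate B K₂)
    (hA : A.IsSelfAdj B) (hi₁ : A.IsInvariant K₁) (hi₂ : A.IsInvariant K₂)
    (hs : A.SplitsDom K₁ K₂) :
    ∃ E : K →L[ℂ] K₁, Reduces B A E ∧ (∀ x, x - E x ∈ K₂) := by
  have hT := Submodule.IsCompl.isTopCompl_of_isClosed h.1 (h.isClosed h₂)
    ((h.symm hB).isClosed h₁)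
  obtain ⟨E, hE⟩ : ∃ E, E = K₁.projectionOntoL K₂ hT := ⟨_, rfl⟩
  have hself : ∀ x : K₁, E x = x := fun x => by
    rw [hE]; exact Submodule.projectionOntoL_apply_left hT x
  have hzero : ∀ x ∈ K₂, E x = 0 := fun x hx => by
    rw [hE]; exact (Submodule.projectionOntoL_apply_eq_zero_iff hT).mpr hx
  have hcompl : ∀ x, x - E x ∈ K₂ := fun x => by
    rw [← Submodule.projectionOntoL_apply_eq_zero_iff hT, ← hE, map_sub, hself, sub_self]
  have horth : ∀ (y : K₁) (x : K), B y x = B y (E x) := fun y x => by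
    have := h.2 y y.2 _ (hcompl x)
    rwa [map_sub, sub_eq_zero] at this
  have hsplit : ∀ x ∈ A.dom, ∃ a b a' b', a ∈ K₁ ∧ b ∈ K₂ ∧ a' ∈ K₁ ∧ b' ∈ K₂ ∧ x = a + b ∧
      (a, a') ∈ A ∧ (b, b') ∈ A := by
    intro x hx
    rw [hs] at hx
    obtain ⟨a, ha, b, hb, rfl⟩ := Submodule.mem_sup.mp hx
    obtain ⟨a', ha', haA⟩ := hi₁ a ha.2 ha.1
    obtain ⟨b', hb', hbA⟩ := hi₂ b hb.2 hb.1
    exact ⟨a, b, a', b', ha.2, hb.2, ha', hb', rfl, haA, hbA⟩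
  -- Invariance provides only some image in each summand, and images are unique only modulo the
  -- multivalued part A(0). Self-adjointness makes A(0) the orthogonal complement of dom A, and E
  -- preserves it since dom A splits.
  have hmul : ∀ m, ((0 : K), m) ∈ A → ((0 : K), (E m : K)) ∈ A := by
    intro m hm
    refine (hA _ _).mpr fun u v huv => ?_
    obtain ⟨a, b, a', b', ha, hb, -, -, rfl, haA, -⟩ := hsplit u ⟨_, huv, rfl⟩
    have h1 := (hA _ _).mp hm a a' haA
    rw [map_zero] at h1
    have h2 := horth ⟨a, ha⟩ m
    have h3 := form_eq_zero_symm hB (h.2 (E m) (E m).2 b hb)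
    rw [map_zero, map_add, _root_.add_apply, ← h2, h3, add_zero]
    exact h1
  refine ⟨E, ⟨⟨hself, horth⟩, fun x y hxy => ?_⟩, hcompl⟩
  obtain ⟨a, b, a', b', ha, hb, ha', hb', rfl, haA, hbA⟩ := hsplit x ⟨_, hxy, rfl⟩
  have hm : ((0 : K), y - a' - b') ∈ A := by
    have := A.sub_mem (A.sub_mem hxy haA) hbA
    simpa using this
  have h1 := A.add_mem haA (hmul _ hm)
  have h2 : E (a + b) = ⟨a, ha⟩ := by rw [map_add, hzero b hb, add_zero]; exact hself ⟨a, ha⟩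
  have h3 : E (y - a' - b') = E y - ⟨a', ha'⟩ := by
    rw [map_sub, map_sub, hzero b' hb', sub_zero]
    congr 1
    exact hself ⟨a', ha'⟩
  rw [h3] at h1
  rw [h2]
  simpa using h1

end Splitting

/-! ### Splitting the function along a reducing decomposition. -/

section Decomposition

variable {H : Type*} [NormedAddCommGroup H] [InnerProductSpace ℂ H] [CompleteSpace H]

theorem adjoint_plus_comp {K : Type*} [NormedAddCommGroup K] [NormedSpace ℂ K] {B : SesqForm K}
    (hB : ∀ x y, conj (B x y) = B y x) (Γ : H →L[ℂ] K) :
    ContinuousLinearMap.adjoint (plus B Γ ∘L Γ) = plus B Γ ∘L Γ := by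
  refine ContinuousLinearMap.ext fun h => ext_inner_left ℂ fun g => ?_
  rw [ContinuousLinearMap.adjoint_inner_right, ← inner_conj_symm]
  simp only [ContinuousLinearMap.comp_apply, inner_plus hB, hB]

theorem exists_split {K : Type*} [NormedAddCommGroup K] [NormedSpace ℂ K] {B : SesqForm K}
    {A : LinRel K} {Γ : H →L[ℂ] K} {z₀ : ℂ} {Q : OpFun H} {κ κ' : ℕ} {K₁ K₂ : Submodule ℂ K}
    (hQ : Q.IsGenNevanlinna κ) (h : IsMinimalRepresentation κ' B A Γ z₀ Q)
    (hK : IsOrthSum B K₁ K₂) (h₁ : IsNondegenerate B K₁) (h₂ : IsNondegenerate B K₂)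
    (hi₁ : A.IsInvariant K₁) (hi₂ : A.IsInvariant K₂) (hs : A.SplitsDom K₁ K₂) :
    ∃ (Γ₁ : H →L[ℂ] K₁) (Γ₂ : H →L[ℂ] K₂) (Q₁ Q₂ : OpFun H) (κ₁ κ₂ : ℕ),
      (∀ h, Γ h = Γ₁ h + Γ₂ h) ∧
      Q₁.IsGenNevanlinna κ₁ ∧
      IsMinimalRepresentation κ₁ (B.restrict K₁) (A.part K₁) Γ₁ z₀ Q₁ ∧
      Q₂.IsGenNevanlinna κ₂ ∧
      IsMinimalRepresentation κ₂ (B.restrict K₂) (A.part K₂) Γ₂ z₀ Q₂ ∧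
      Q.IsSum Q₁ Q₂ ∧
      κ₁ + κ₂ = κ := by
  obtain rfl : κ = κ' := h.index_eq hQ
  have hB := h.pontryagin.hermitian
  have := h.pontryagin.complete
  obtain ⟨R, S, hR, m, hS, hval⟩ := h.exists_isModel hQ.codiscrete_dom fun z hz => (hQ.symm z hz).1
  obtain ⟨E₁, hE₁, hc₁⟩ := hK.exists_reduces hB h₁ h₂ h.selfAdj hi₁ hi₂ hs
  obtain ⟨E₂, hE₂, hc₂⟩ := (hK.symm hB).exists_reduces hB h₂ h₁ h.selfAdj hi₂ hi₁ hs.symm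
  have hsum : ∀ x : K, x = E₁ x + E₂ x := by
    intro x
    have h3 : (E₂ x : K) = x - E₁ x := by
      rw [← sub_eq_zero]
      have h4 : (E₂ x : K) - (x - E₁ x) ∈ K₂ := K₂.sub_mem (E₂ x).2 (hc₁ x)
      have h5 : (E₂ x : K) - (x - E₁ x) ∈ K₁ := by
        have := K₁.sub_mem (E₁ x).2 (hc₂ x)
        rwa [show (E₁ x : K) - (x - E₂ x) = E₂ x - (x - E₁ x) by abel] at this
      exact Submodule.disjoint_def.mp hK.1.disjoint _ h5 h4
    rw [h3, add_sub_cancel]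
  obtain ⟨κ₁, hP₁⟩ := hE₁.isPontryagin_restrict h.pontryagin (hK.isClosed h₂)
  obtain ⟨κ₂, hP₂⟩ := hE₂.isPontryagin_restrict h.pontryagin ((hK.symm hB).isClosed h₁)
  have m₁ := hE₁.isModel m h.selfAdj hR hP₁
  have m₂ := hE₂.isModel m h.selfAdj hR hP₂
  have hB₁ := hP₁.hermitian
  have hB₂ := hP₂.hermitian
  have key : ∀ x y : K, B x y = B.restrict K₁ (E₁ x) (E₁ y) + B.restrict K₂ (E₂ x) (E₂ y) := by
    intro x y
    conv_lhs => rw [hsum x, map_add, _root_.add_apply, hE₁.orth, hE₂.orth]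
    rfl
  have hplus : ∀ T : K →L[ℂ] K, plus B Γ ∘L T ∘L Γ =
      plus (B.restrict K₁) (E₁.comp Γ) ∘L (E₁.comp T) ∘L Γ +
        plus (B.restrict K₂) (E₂.comp Γ) ∘L (E₂.comp T) ∘L Γ := by
    intro T
    refine ContinuousLinearMap.ext fun x => ext_inner_left ℂ fun g => ?_
    simp only [_root_.add_apply, ContinuousLinearMap.comp_apply, inner_add_right, inner_plus hB,
      inner_plus hB₁, inner_plus hB₂, key]
  set P₁ : H →L[ℂ] H := plus (B.restrict K₁) (E₁.comp Γ) ∘L (E₁.comp Γ) with hP₁def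
  set P₂ : H →L[ℂ] H := plus (B.restrict K₂) (E₂.comp Γ) ∘L (E₂.comp Γ) with hP₂def
  have hPP : plus B Γ ∘L Γ = P₁ + P₂ := hplus 1
  -- Each constant must satisfy S_i^* = S_i + (z₀ - conj z₀)Γ_i⁺Γ_i. As c is purely imaginary and P₁
  -- self-adjoint, -cP₁ is the skew-adjoint solution for the first summand; the second takes the
  -- remainder S + cP₁.
  set c : ℂ := (z₀ - conj z₀) / 2 with hc
  have hcc : conj c = -c := by
    rw [hc, map_div₀, map_sub, Complex.conj_conj, map_ofNat]
    ring
  have hc2 : z₀ - conj z₀ = 2 * c := by rw [hc]; ring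
  have hS₁ : ContinuousLinearMap.adjoint (-c • P₁) = -c • P₁ + (z₀ - conj z₀) • P₁ := by
    rw [map_smulₛₗ, adjoint_plus_comp hB₁, map_neg, hcc, hc2]
    module
  have hS₂ : ContinuousLinearMap.adjoint (S - -c • P₁) =
      (S - -c • P₁) + (z₀ - conj z₀) • P₂ := by
    rw [map_sub, hS, hS₁, hPP]
    module
  -- Both summands are taken on all of D(Q), so the intersection of their domains is D(Q).
  let Q₁ : OpFun H := ⟨Q.dom, reprVal (-c • P₁) (B.restrict K₁) (compress E₁ R) (E₁.comp Γ) z₀⟩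
  let Q₂ : OpFun H :=
    ⟨Q.dom, reprVal (S - -c • P₁) (B.restrict K₂) (compress E₂ R) (E₂.comp Γ) z₀⟩
  refine ⟨E₁.comp Γ, E₂.comp Γ, Q₁, Q₂, κ₁, κ₂, fun x => hsum (Γ x),
    IsModel.isGenNevanlinna (Q := Q₁) m₁ hQ.isOpen_dom hS₁ fun _ _ => rfl,
    IsModel.isMinimalRepresentation (Q := Q₁) m₁ (hE₁.isSelfAdj_part hB h.selfAdj)
      (hE₁.isResolvent_part hR) hS₁ fun _ _ => rfl,
    IsModel.isGenNevanlinna (Q := Q₂) m₂ hQ.isOpen_dom hS₂ fun _ _ => rfl,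
    IsModel.isMinimalRepresentation (Q := Q₂) m₂ (hE₂.isSelfAdj_part hB h.selfAdj)
      (hE₂.isResolvent_part hR) hS₂ fun _ _ => rfl,
    ⟨(Set.inter_self _).symm, fun z hz => ?_⟩, h.pontryagin.add_eq hP₁ hP₂ hK.2 hsum⟩
  have ht₁ : E₁.comp (transfer R z₀ z) = (transfer (compress E₁ R) z₀ z).comp E₁ :=
    ContinuousLinearMap.ext fun x => hE₁.apply_transfer hR (m.isUnit z hz) x
  have ht₂ : E₂.comp (transfer R z₀ z) = (transfer (compress E₂ R) z₀ z).comp E₂ :=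
    ContinuousLinearMap.ext fun x => hE₂.apply_transfer hR (m.isUnit z hz) x
  rw [hval z hz, reprVal, hplus, ht₁, ht₂]
  simp only [Q₁, Q₂, reprVal, ContinuousLinearMap.comp_assoc, smul_add]
  abel

end Decomposition

end GenNevanlinna

end
open scoped ComplexConjugate
open GenNevanlinna

theorem theorem1 {H : Type*} [NormedAddCommGroup H] [InnerProductSpace ℂ H] [CompleteSpace H] :
    -- part (i)
    (∀ (K : Type*) [NormedAddCommGroup K] [NormedSpace ℂ K] (B : SesqForm K) (A : LinRel K)
        (Γ : H →L[ℂ] K) (z₀ : ℂ) (Q : OpFun H) (κ κ' : ℕ) (K₁ K₂ : Submodule ℂ K),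
        Q.IsGenNevanlinna κ →
        IsMinimalRepresentation κ' B A Γ z₀ Q →
        IsOrthSum B K₁ K₂ →
        IsNondegenerate B K₁ → IsNondegenerate B K₂ →
        A.IsInvariant K₁ → A.IsInvariant K₂ → A.SplitsDom K₁ K₂ →
        ∃ (Γ₁ : H →L[ℂ] K₁) (Γ₂ : H →L[ℂ] K₂) (Q₁ Q₂ : OpFun H) (κ₁ κ₂ : ℕ),
          (∀ h, Γ h = Γ₁ h + Γ₂ h) ∧
          Q₁.IsGenNevanlinna κ₁ ∧
          IsMinimalRepresentation κ₁ (B.restrict K₁) (A.part K₁) Γ₁ z₀ Q₁ ∧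
          Q₂.IsGenNevanlinna κ₂ ∧
          IsMinimalRepresentation κ₂ (B.restrict K₂) (A.part K₂) Γ₂ z₀ Q₂ ∧
          Q.IsSum Q₁ Q₂ ∧
          κ₁ + κ₂ = κ) ∧
    -- part (ii)
    (∀ (K₁ : Type*) [NormedAddCommGroup K₁] [NormedSpace ℂ K₁]
        (K₂ : Type*) [NormedAddCommGroup K₂] [NormedSpace ℂ K₂]
        (B₁ : SesqForm K₁) (A₁ : LinRel K₁) (Γ₁ : H →L[ℂ] K₁)
        (B₂ : SesqForm K₂) (A₂ : LinRel K₂) (Γ₂ : H →L[ℂ] K₂)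
        (z₀ : ℂ) (Q Q₁ Q₂ : OpFun H) (κ₁ κ₂ κ₁' κ₂' : ℕ),
        Q₁.IsGenNevanlinna κ₁ →
        IsMinimalRepresentation κ₁' B₁ A₁ Γ₁ z₀ Q₁ →
        Q₂.IsGenNevanlinna κ₂ →
        IsMinimalRepresentation κ₂' B₂ A₂ Γ₂ z₀ Q₂ →
        Q.IsSum Q₁ Q₂ →
        Function.Injective (fun k : K₁ × K₂ => plus B₁ Γ₁ k.1 + plus B₂ Γ₂ k.2) →
        IsMinimalRepresentation (κ₁ + κ₂) (B₁.prod B₂) (A₁.prod A₂) (Γ₁.prod Γ₂) z₀ Q ∧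
        (∀ (K' : Type*) [NormedAddCommGroup K'] [NormedSpace ℂ K'] (B' : SesqForm K')
          (A' : LinRel K') (Γ' : H →L[ℂ] K') (κ' : ℕ),
          IsMinimalRepresentation κ' B' A' Γ' z₀ Q →
          TripletIso (B₁.prod B₂) (A₁.prod A₂) (Γ₁.prod Γ₂) B' A' Γ') ∧
        Q.IsGenNevanlinna (κ₁ + κ₂)) := by
  refine ⟨?_, ?_⟩
  · intro K _ _ B A Γ z₀ Q κ κ' K₁ K₂ hQ h hK h₁ h₂ hi₁ hi₂ hs
    exact exists_split hQ h hK h₁ h₂ hi₁ hi₂ hs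
  · intro K₁ _ _ K₂ _ _ B₁ A₁ Γ₁ B₂ A₂ Γ₂ z₀ Q Q₁ Q₂ κ₁ κ₂ κ₁' κ₂' hQ₁ h₁ hQ₂ h₂ hQ hinj
    -- The index of the representing space is not assumed to agree with that of the function;
    -- minimality forces it.
    obtain rfl := h₁.index_eq hQ₁
    obtain rfl := h₂.index_eq hQ₂
    have h := h₁.prod h₂ hQ hinj
    obtain ⟨R, S, -, m, hS, hval⟩ := h.exists_isModel
      (by rw [hQ.1]; exact Filter.inter_mem hQ₁.codiscrete_dom hQ₂.codiscrete_dom)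
      (fun z hz => by
        rw [hQ.1] at hz ⊢
        exact ⟨(hQ₁.symm z hz.1).1, (hQ₂.symm z hz.2).1⟩)
    have hgen := m.isGenNevanlinna (hQ.isOpen_dom hQ₁ hQ₂) hS hval
    exact ⟨h, fun K' _ _ B' A' Γ' κ' h' => h.tripletIso hgen h', hgen⟩
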